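/- **Lemma 3 (consistency).** Let $d\in\{2,3\}$, let $\mathcal O\subset\mathbb R^d$ be a nonempty open bounded convex polyhedral domain, and put $q=\frac{2d}{d+1}$. Let $\lambda,\kappa,T>0$, $\mu=2\kappa\lambda^{-1}$, $\gamma=2\lambda^{-1}(\mu-\kappa\lambda^{-1})$, $\eta=\lambda^{-1}$ and $\beta(t)=\gamma e^{-\eta t}$. *Exact solution.* Let $S\subseteq(0,T]$ contain almost every $t\in(0,T]$ (for instance $S=(0,T]$), let $\mathbf f(t)\in L^2(\mathcal O)^d$ and $\mathbf u_0\in L^2(\mathcal O)^d$, and let $(\mathbf u,p)$, with $\mathbf u(t)\in L^2(\mathcal O)^d$ and $p(t)\in L^2(\mathcal O)$, solve the Oldroyd problem of order one $$\partial_t\mathbf u-\mu\Delta\mathbf u+\mathbf u\cdot\nabla\mathbf u-\int_0^t\beta(t-s)\Delta\mathbf u(s)\,ds+\nabla p=\mathbf f,\qquad \nabla\cdot\mathbf u=0\quad\text{in }\mathcal O,$$ $$\mathbf u=\mathbf 0\ \text{on }\partial\mathcal O,\qquad \int_{\mathcal O}p=0,\qquad \mathbf u(0)=\mathbf u_0,$$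 in the following sense: for every $t\in S$, $\mathbf u(t)\in (W^{2,q}(\mathcal O)\cap H^1_0(\mathcal O))^d$, $p(t)\in W^{1,q}(\mathcal O)$, $\mathbf u$ is differentiable at $t$ (within $[0,T]$) as an $L^2(\mathcal O)^d$-valued function with derivative $\partial_t\mathbf u(t)$, the two equations hold a.e. in $\mathcal O$, and $\int_{\mathcal O}p(t)=0$; moreover $\Delta\mathbf u\in L^1(0,T;L^q(\mathcal O)^d)$, the memory integral being a Bochner integral, and $\mathbf u$ is continuous at $0$ in $L^2(\mathcal O)^d$ with $\mathbf u(0)=\mathbf u_0$. *Mesh.* Let $\mathcal K_h$ be a finite partition of $\overline{\mathcal O}$ into closed convex polytopes $K$ with nonempty, pairwise disjoint interiors (for instance triangles or tetrahedra). The interior faces $F\in\mathcal F_h^i$ are the sets $F=\partial K_F^1\cap\partial K_F^2$ of positive $(d-1)$-dimensional measure, each with a chosen unit normal $\mathbf n_F$ directed from $K_F^1$ to $K_F^2$; the boundary faces $F\in\mathcal F_h^b$ are the $(d-1)$-dimensional faces of elements $K_F$ contained in $\partial\mathcal O$, with $\mathbf n_F$ the outward unit normal; $\mathcal F_h=\mathcal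 F_h^i\cup\mathcal F_h^b$ and $h_F=|F|^{1/(d-1)}$. With traces taken from inside the elements, $\{v\}=\frac12(v|_{K_F^1}+v|_{K_F^2})$ and $[v]=v|_{K_F^1}-v|_{K_F^2}$ on interior faces, and $\{v\}=[v]=v|_{K_F}$ on boundary faces. On $\partial K$, $\mathbf n_K$ is the outward unit normal, and $v^{\rm int}$, $v^{\rm ext}$ are the traces from inside and outside $K$, with $v^{\rm ext}=0$ on $\partial\mathcal O$. Let $$\mathbf M=\{\mathbf w\in L^2(\mathcal O)^d:\ \mathbf w|_K\in W^{2,q}(K)^d\ \ \forall K\in\mathcal K_h\},$$ and, for $\epsilon\in\{-1,0,1\}$ and $\sigma>0$, $$\mathcal A_c(\boldsymbol\theta;\mathbf z,\boldsymbol\varphi,\mathbf w)=\sum_{K}\Big(\int_K(\mathbf z\cdot\nabla\boldsymbol\varphi)\cdot\mathbf w+\tfrac12\int_K(\nabla\cdot\mathbf z)\,\boldsymbol\varphi\cdot\mathbf w\Big)-\tfrac12\sum_{F\in\mathcal F_h}\int_F[\mathbf z]\cdot\mathbf n_F\{\boldsymbol\varphi\cdot\mathbf w\}+\sum_K\int_{\partial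 K_-^{\boldsymbol\theta}}|\{\mathbf z\}\cdot\mathbf n_K|(\boldsymbol\varphi^{\rm int}-\boldsymbol\varphi^{\rm ext})\cdot\mathbf w^{\rm int},$$ where $\partial K_-^{\boldsymbol\theta}=\{x\in\partial K:\{\boldsymbol\theta(x)\}\cdot\mathbf n_K<0\}$, $$\mathcal A_\epsilon(\mathbf v,\mathbf w)=\sum_K\int_K\nabla\mathbf v:\nabla\mathbf w-\sum_{F\in\mathcal F_h}\int_F\{\nabla\mathbf v\}\mathbf n_F\cdot[\mathbf w]+\epsilon\sum_{F\in\mathcal F_h}\int_F\{\nabla\mathbf w\}\mathbf n_F\cdot[\mathbf v]+\sum_{F\in\mathcal F_h}\frac{\sigma}{h_F}\int_F[\mathbf v]\cdot[\mathbf w],$$ $$b(\mathbf w,g)=\sum_K\int_K(\nabla\cdot\mathbf w)\,g-\sum_{F\in\mathcal F_h}\int_F\{g\}\,\mathbf n_F\cdot[\mathbf w].$$ *Claim.* For every $t\in S$ and every $\mathbf w\in\mathbf M$, the function $s\mapsto\beta(t-s)\mathcal A_\epsilon(\mathbf u(s),\mathbf w)$ is integrable on $(0,t)$ and $$(\partial_t\mathbf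 u(t),\mathbf w)+\mathcal A_c(\mathbf u(t);\mathbf u(t),\mathbf u(t),\mathbf w)+\mu\mathcal A_\epsilon(\mathbf u(t),\mathbf w)+\int_0^t\beta(t-s)\mathcal A_\epsilon(\mathbf u(s),\mathbf w)\,ds=b(\mathbf w,p(t))+(\mathbf f(t),\mathbf w),$$ where $(\cdot,\cdot)$ is the inner product of $L^2(\mathcal O)^d$. -/

import Mathlib

open MeasureTheory Set Filter Topology
open scoped ContDiff ENNReal InnerProductSpace

noncomputable section

namespace OldroydDG

/-- Euclidean space `ℝᵈ`. -/
abbrev E (d : ℕ) : Type := EuclideanSpace ℝ (Fin d)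

/-- The `j`-th standard basis vector of `ℝᵈ`. -/
abbrev basisVec {d : ℕ} (j : Fin d) : E d := EuclideanSpace.single j 1

/-- The `(d-1)`-dimensional surface measure in `ℝᵈ` (Hausdorff measure, normalised to agree with
Lebesgue measure on hyperplanes). -/
abbrev surf (d : ℕ) : Measure (E d) := Measure.euclideanHausdorffMeasure (d - 1)

section Sobolev

variable {d : ℕ} {F : Type*} [NormedAddCommGroup F] [NormedSpace ℝ F]

/-- `g'` is the weak partial derivative `∂ⱼ g` on the open set `Ω`. -/
def HasWeakPartial (Ω : Set (E d)) (j : Fin d) (g g' : E d → F) : Prop :=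
  LocallyIntegrableOn g Ω volume ∧ LocallyIntegrableOn g' Ω volume ∧
    ∀ φ : E d → ℝ, ContDiff ℝ ∞ φ → HasCompactSupport φ → tsupport φ ⊆ Ω →
      ∫ x in Ω, (fderiv ℝ φ x (basisVec j)) • g x = -∫ x in Ω, φ x • g' x

open Classical in
/-- The weak partial derivative `∂ⱼ g` on `Ω` (unique almost everywhere in `Ω`; zero if there is
none). -/
def weakPartial (Ω : Set (E d)) (j : Fin d) (g : E d → F) : E d → F :=
  if h : ∃ g', HasWeakPartial Ω j g g' then h.choose else 0

/-- Membership in the Sobolev space `W^{k,q}(Ω)`. -/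
def MemSobolev (Ω : Set (E d)) (q : ℝ≥0∞) : ℕ → (E d → F) → Prop
  | 0, g => MemLp g q (volume.restrict Ω)
  | k + 1, g => MemLp g q (volume.restrict Ω) ∧
      ∀ j, ∃ g', HasWeakPartial Ω j g g' ∧ MemSobolev Ω q k g'

/-- The smooth functions `φ n` converge to `g` in `W^{1,q}(Ω)`. -/
def TendstoW1 (Ω : Set (E d)) (q : ℝ≥0∞) (φ : ℕ → E d → F) (g : E d → F) : Prop :=
  Tendsto (fun n => eLpNorm (fun x => φ n x - g x) q (volume.restrict Ω)) atTop (𝓝 0) ∧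
    ∀ j, ∃ g', HasWeakPartial Ω j g g' ∧
      Tendsto (fun n => eLpNorm (fun x => fderiv ℝ (φ n) x (basisVec j) - g' x) q
        (volume.restrict Ω)) atTop (𝓝 0)

/-- Membership in `H¹₀(Ω)`, the closure of `C_c^∞(Ω)` in `H¹(Ω)`. -/
def MemH10 (Ω : Set (E d)) (g : E d → F) : Prop :=
  ∃ φ : ℕ → E d → F,
    (∀ n, ContDiff ℝ ∞ (φ n) ∧ HasCompactSupport (φ n) ∧ tsupport (φ n) ⊆ Ω) ∧
      TendstoW1 Ω 2 φ g

/-- `τ` is the trace of `g` on the boundary of the body `K`: the limit in `L¹(∂K)` of the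
restrictions of smooth functions (smooth up to the boundary) that converge to `g` in `W^{1,1}(K)`. -/
def IsTrace (K : Set (E d)) (g τ : E d → F) : Prop :=
  AEStronglyMeasurable τ ((surf d).restrict (frontier K)) ∧
    ∃ φ : ℕ → E d → F, (∀ n, ContDiff ℝ ∞ (φ n)) ∧ TendstoW1 (interior K) 1 φ g ∧
      Tendsto (fun n => eLpNorm (fun x => φ n x - τ x) 1 ((surf d).restrict (frontier K)))
        atTop (𝓝 0)

open Classical in
/-- The trace of `g` on `∂K` taken from inside `K` (unique almost everywhere on `∂K`). -/
def trace (K : Set (E d)) (g : E d → F) : E d → F :=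
  if h : ∃ τ, IsTrace K g τ then h.choose else 0

/-- The weak Laplacian on `Ω`. -/
def weakLaplacian (Ω : Set (E d)) (g : E d → F) (x : E d) : F :=
  ∑ j, weakPartial Ω j (weakPartial Ω j g) x

/-- The weak gradient on `Ω` of a scalar function. -/
def weakGrad (Ω : Set (E d)) (g : E d → ℝ) (x : E d) : E d :=
  WithLp.toLp 2 fun j => weakPartial Ω j g x

/-- The weak divergence on `Ω` of a vector field. -/
def weakDiv (Ω : Set (E d)) (z : E d → E d) (x : E d) : ℝ :=
  ∑ j, weakPartial Ω j z x j

/-- `(z · ∇) φ` on `Ω`. -/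
def convect (Ω : Set (E d)) (z φ : E d → E d) (x : E d) : E d :=
  ∑ j, z x j • weakPartial Ω j φ x

end Sobolev

/-- The exponent `2d/(d+1)`. -/
def sobExp (d : ℕ) : ℝ≥0∞ := ENNReal.ofReal (2 * d / (d + 1))

instance fact_one_le_sobExp (d : ℕ) [hd : Fact (d = 2 ∨ d = 3)] : Fact (1 ≤ sobExp d) := ⟨by
  unfold sobExp
  rw [← ENNReal.ofReal_one]
  apply ENNReal.ofReal_le_ofReal
  rcases hd.out with h | h <;> subst h <;> norm_num⟩

/-- `L²(Ω)` with values in `ℝᵈ`. -/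
abbrev VecL2 {d : ℕ} (Ω : Set (E d)) : Type := Lp (E d) 2 (volume.restrict Ω)

/-- `L²(Ω)`. -/
abbrev ScalL2 {d : ℕ} (Ω : Set (E d)) : Type := Lp ℝ 2 (volume.restrict Ω)

section Mesh

variable {d : ℕ}

/-- An open bounded nonempty convex polyhedral domain. -/
def IsConvexPolyhedralDomain (O : Set (E d)) : Prop :=
  O.Nonempty ∧ Bornology.IsBounded O ∧
    ∃ (m : ℕ) (a : Fin m → E d) (b : Fin m → ℝ), O = {x | ∀ i, ⟪a i, x⟫_ℝ < b i}

/-- A closed bounded convex polytope with nonempty interior. -/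
def IsPolytope (K : Set (E d)) : Prop :=
  (interior K).Nonempty ∧ Bornology.IsBounded K ∧
    ∃ (m : ℕ) (a : Fin m → E d) (b : Fin m → ℝ), K = {x | ∀ i, ⟪a i, x⟫_ℝ ≤ b i}

/-- `F` is a `(d-1)`-dimensional face of the polytope `K`. -/
def IsFacet (K F : Set (E d)) : Prop :=
  0 < surf d F ∧ ∃ (n : E d) (b : ℝ), n ≠ 0 ∧ (∀ x ∈ K, ⟪n, x⟫_ℝ ≤ b) ∧
    F = {x ∈ K | ⟪n, x⟫_ℝ = b}

/-- A finite partition of the domain `O` into convex polytopes (in particular any triangulation into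
triangles or tetrahedra), together with its faces and a choice of an orientation of every interior
face. -/
structure Mesh (O : Set (E d)) where
  /-- The elements. -/
  elems : Finset (Set (E d))
  polytope : ∀ K ∈ elems, IsPolytope K
  disjoint : ∀ K ∈ elems, ∀ K' ∈ elems, K ≠ K' → Disjoint (interior K) (interior K')
  cover : ⋃ K ∈ elems, K = closure O
  /-- An interior face `F = ∂K₁ ∩ ∂K₂` is given by the ordered pair `(K₁, K₂)` of the elements that
  share it; the normal `n_F` points from `K₁` to `K₂`. -/
  ifaces : Finset (Set (E d) × Set (E d))
  ifaces_mem : ∀ P ∈ ifaces, P.1 ∈ elems ∧ P.2 ∈ elems ∧ P.1 ≠ P.2 ∧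
    0 < surf d (frontier P.1 ∩ frontier P.2)
  /-- Any two elements that share a face occur in exactly one of the two possible orders. -/
  ifaces_orient : ∀ K ∈ elems, ∀ K' ∈ elems, K ≠ K' →
    0 < surf d (frontier K ∩ frontier K') → ((K, K') ∈ ifaces ↔ (K', K) ∉ ifaces)
  /-- A boundary face `F` is given by the pair `(K, F)` with the element `K` it belongs to. -/
  bfaces : Finset (Set (E d) × Set (E d))
  bfaces_mem : ∀ P : Set (E d) × Set (E d),
    P ∈ bfaces ↔ P.1 ∈ elems ∧ IsFacet P.1 P.2 ∧ P.2 ⊆ frontier O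

open Classical in
/-- The outward unit normal of the convex body `K` at a boundary point (unique at almost every
boundary point). -/
def normal (K : Set (E d)) (x : E d) : E d :=
  if h : ∃ ν : E d, ‖ν‖ = 1 ∧ ∀ y ∈ K, ⟪ν, y - x⟫_ℝ ≤ 0 then h.choose else 0

/-- `h_F = |F|^{1/(d-1)}`. -/
def faceSize (F : Set (E d)) : ℝ := ((surf d F).toReal) ^ (1 / ((d : ℝ) - 1))

/-- The trace on `∂K`, from inside `K`, of `∇φ` applied to the vector field `n`. -/
def gradTrace (K : Set (E d)) (φ n : E d → E d) (x : E d) : E d :=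
  ∑ j, n x j • trace K (weakPartial (interior K) j φ) x

variable {O : Set (E d)}

/-- The broken space `M`. -/
def Mesh.MemM (𝒦 : Mesh O) (w : VecL2 O) : Prop :=
  ∀ K ∈ 𝒦.elems, MemSobolev (interior K) (sobExp d) 2 w

open Classical in
/-- The form `A_c(θ; z, φ, w)`.  The boundary of an element `K` is split into its intersections with
the other elements, where the exterior trace is that of the neighbour, and its part on `∂O`, where the
exterior trace is zero and the average is the interior trace. -/
def Mesh.Ac (𝒦 : Mesh O) (θ z φ w : E d → E d) : ℝ :=
  ∑ K ∈ 𝒦.elems, ((∫ x in interior K, ⟪convect (interior K) z φ x, w x⟫_ℝ)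
      + 1 / 2 * ∫ x in interior K, weakDiv (interior K) z x * ⟪φ x, w x⟫_ℝ)
    - 1 / 2 * (∑ P ∈ 𝒦.ifaces, ∫ x in frontier P.1 ∩ frontier P.2,
          ⟪trace P.1 z x - trace P.2 z x, normal P.1 x⟫_ℝ *
            (1 / 2 * (⟪trace P.1 φ x, trace P.1 w x⟫_ℝ + ⟪trace P.2 φ x, trace P.2 w x⟫_ℝ)) ∂(surf d)
      + ∑ P ∈ 𝒦.bfaces, ∫ x in P.2,
          ⟪trace P.1 z x, normal P.1 x⟫_ℝ * ⟪trace P.1 φ x, trace P.1 w x⟫_ℝ ∂(surf d))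
    + ∑ K ∈ 𝒦.elems,
        ((∑ K' ∈ 𝒦.elems with K' ≠ K,
          ∫ x in {x ∈ frontier K ∩ frontier K' |
              ⟪(1 / 2 : ℝ) • (trace K θ x + trace K' θ x), normal K x⟫_ℝ < 0},
            |⟪(1 / 2 : ℝ) • (trace K z x + trace K' z x), normal K x⟫_ℝ| *
              ⟪trace K φ x - trace K' φ x, trace K w x⟫_ℝ ∂(surf d))
        + ∫ x in {x ∈ frontier K ∩ frontier O | ⟪trace K θ x, normal K x⟫_ℝ < 0},
            |⟪trace K z x, normal K x⟫_ℝ| * ⟪trace K φ x - 0, trace K w x⟫_ℝ ∂(surf d))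

/-- The interior penalty form `A_ε(v, w)` with penalty parameter `σ`. -/
def Mesh.Aeps (𝒦 : Mesh O) (ε σ : ℝ) (v w : E d → E d) : ℝ :=
  (∑ K ∈ 𝒦.elems, ∫ x in interior K,
      ∑ j, ⟪weakPartial (interior K) j v x, weakPartial (interior K) j w x⟫_ℝ)
    - (∑ P ∈ 𝒦.ifaces, ∫ x in frontier P.1 ∩ frontier P.2,
          ⟪(1 / 2 : ℝ) • (gradTrace P.1 v (normal P.1) x + gradTrace P.2 v (normal P.1) x),
            trace P.1 w x - trace P.2 w x⟫_ℝ ∂(surf d)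
      + ∑ P ∈ 𝒦.bfaces, ∫ x in P.2,
          ⟪gradTrace P.1 v (normal P.1) x, trace P.1 w x⟫_ℝ ∂(surf d))
    + ε * (∑ P ∈ 𝒦.ifaces, ∫ x in frontier P.1 ∩ frontier P.2,
          ⟪(1 / 2 : ℝ) • (gradTrace P.1 w (normal P.1) x + gradTrace P.2 w (normal P.1) x),
            trace P.1 v x - trace P.2 v x⟫_ℝ ∂(surf d)
      + ∑ P ∈ 𝒦.bfaces, ∫ x in P.2,
          ⟪gradTrace P.1 w (normal P.1) x, trace P.1 v x⟫_ℝ ∂(surf d))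
    + (∑ P ∈ 𝒦.ifaces, σ / faceSize (frontier P.1 ∩ frontier P.2) *
          ∫ x in frontier P.1 ∩ frontier P.2,
            ⟪trace P.1 v x - trace P.2 v x, trace P.1 w x - trace P.2 w x⟫_ℝ ∂(surf d)
      + ∑ P ∈ 𝒦.bfaces, σ / faceSize P.2 *
          ∫ x in P.2, ⟪trace P.1 v x, trace P.1 w x⟫_ℝ ∂(surf d))

/-- The form `b(w, g)`. -/
def Mesh.b (𝒦 : Mesh O) (w : E d → E d) (g : E d → ℝ) : ℝ :=
  (∑ K ∈ 𝒦.elems, ∫ x in interior K, weakDiv (interior K) w x * g x)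
    - (∑ P ∈ 𝒦.ifaces, ∫ x in frontier P.1 ∩ frontier P.2,
          (1 / 2 * (trace P.1 g x + trace P.2 g x)) *
            ⟪normal P.1 x, trace P.1 w x - trace P.2 w x⟫_ℝ ∂(surf d)
      + ∑ P ∈ 𝒦.bfaces, ∫ x in P.2,
          trace P.1 g x * ⟪normal P.1 x, trace P.1 w x⟫_ℝ ∂(surf d))

end Mesh

section Oldroyd

/-- The viscosity `μ = 2 κ λ⁻¹`, from the relaxation time `lam` and the retardation time `kap`. -/
def viscosity (lam kap : ℝ) : ℝ := 2 * kap * lam⁻¹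

/-- The memory kernel `β(t) = γ exp(-η t)`, `γ = 2 λ⁻¹ (μ - κ λ⁻¹)`, `η = λ⁻¹`. -/
def kernel (lam kap t : ℝ) : ℝ :=
  2 * lam⁻¹ * (viscosity lam kap - kap * lam⁻¹) * Real.exp (-(lam⁻¹ * t))

variable {d : ℕ} {O : Set (E d)}

open Classical in
/-- The weak Laplacian of a field as an element of `L^q(O)`, `q = 2d/(d+1)` (zero if it is not in
that space). -/
def lapLp (v : VecL2 O) : Lp (E d) (sobExp d) (volume.restrict O) :=
  if h : MemLp (weakLaplacian O v) (sobExp d) (volume.restrict O) then h.toLp else 0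

/-- `(u, p)` solves the Oldroyd problem of order one on `O × (0, T]` with force `f` and initial value
`u₀`; the equations hold at the times in `S`, which make up almost all of `(0, T]` (`S = (0, T]` for
a solution in the everywhere sense).  The spatial regularity, `u(t) ∈ W^{2,q} ∩ H¹₀` and
`p(t) ∈ W^{1,q}` with `q = 2d/(d+1)`, is that of the spaces on which the discrete forms are defined;
`∂ₜu` is the derivative in `L²(O)` and the memory integral is a Bochner integral in `L^q(O)`. -/
structure IsSolution [Fact (d = 2 ∨ d = 3)] (O : Set (E d)) (lam kap T : ℝ) (S : Set ℝ)
    (f : ℝ → VecL2 O) (u₀ : VecL2 O) (u : ℝ → VecL2 O) (p : ℝ → ScalL2 O) : Prop where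
  times_sub : S ⊆ Ioc 0 T
  times_ae : ∀ᵐ t ∂(volume.restrict (Ioc 0 T)), t ∈ S
  vel_mem : ∀ t ∈ S, MemSobolev O (sobExp d) 2 (u t)
  pres_mem : ∀ t ∈ S, MemSobolev O (sobExp d) 1 (p t)
  vel_diff : ∀ t ∈ S, DifferentiableWithinAt ℝ u (Icc 0 T) t
  lap_integrable : IntervalIntegrable (fun s => lapLp (u s)) volume 0 T
  momentum : ∀ t ∈ S, ∀ᵐ x ∂(volume.restrict O),
    derivWithin u (Icc 0 T) t x - viscosity lam kap • weakLaplacian O (u t) x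
      + convect O (u t) (u t) x
      - (∫ s in (0 : ℝ)..t, kernel lam kap (t - s) • lapLp (u s) :
          Lp (E d) (sobExp d) (volume.restrict O)) x
      + weakGrad O (p t) x = f t x
  incompressible : ∀ t ∈ S, ∀ᵐ x ∂(volume.restrict O), weakDiv O (u t) x = 0
  initial : u 0 = u₀
  initial_cont : ContinuousWithinAt u (Icc 0 T) 0
  boundary : ∀ t ∈ S, MemH10 O (u t)
  pres_mean : ∀ t ∈ S, ∫ x in O, p t x = 0

end Oldroyd

end OldroydDG

end

namespace OldroydDG

section WeakDerivative

theorem locallyIntegrableOn_congr_ae {d : ℕ} {F : Type*} [NormedAddCommGroup F]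
    {Ω : Set (E d)} {g₁ g₂ : E d → F}
    (hg : LocallyIntegrableOn g₁ Ω volume)
    (h : g₁ =ᵐ[volume.restrict Ω] g₂) : LocallyIntegrableOn g₂ Ω volume := by
  intro x hx
  obtain ⟨s, hs, hi⟩ := hg x hx
  refine ⟨s ∩ Ω, inter_mem hs self_mem_nhdsWithin, ?_⟩
  exact (hi.mono_set inter_subset_left).congr
    (ae_restrict_of_ae_restrict_of_subset inter_subset_right h)

variable {d : ℕ} {F G : Type*} [NormedAddCommGroup F] [NormedSpace ℝ F]
  [NormedAddCommGroup G] [NormedSpace ℝ G]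
  {Ω Ω' : Set (E d)} {j : Fin d} {g g₁ g₂ g' : E d → F}

theorem integrable_smul_of_tsupport_subset (hg : LocallyIntegrableOn g Ω volume) {φ : E d → ℝ}
    (hφ : Continuous φ) (hc : HasCompactSupport φ) (hs : tsupport φ ⊆ Ω) :
    Integrable (fun x => φ x • g x) volume := by
  have h1 : IntegrableOn g (tsupport φ) volume := hg.integrableOn_compact_subset hs hc
  have h2 : IntegrableOn (fun x => φ x • g x) (tsupport φ) volume :=
    h1.continuousOn_smul hφ.continuousOn hc
  refine (integrableOn_iff_integrable_of_support_subset ?_).1 h2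
  intro x hx
  refine subset_tsupport φ ?_
  intro h0
  exact hx (by simp [h0])

theorem setIntegral_smul_eq_integral {φ : E d → ℝ} (hs : tsupport φ ⊆ Ω) :
    ∫ x in Ω, φ x • g x = ∫ x, φ x • g x := by
  refine setIntegral_eq_integral_of_forall_compl_eq_zero fun x hx => ?_
  rw [image_eq_zero_of_notMem_tsupport (fun h => hx (hs h)), zero_smul]

theorem tsupport_fderiv_apply_subset (φ : E d → ℝ) (v : E d) :
    tsupport (fun x => fderiv ℝ φ x v) ⊆ tsupport φ :=
  _root_.tsupport_fderiv_apply_subset ℝ v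

theorem HasWeakPartial.integral_eq (h : HasWeakPartial Ω j g g') {φ : E d → ℝ}
    (hφ : ContDiff ℝ ∞ φ) (hc : HasCompactSupport φ) (hs : tsupport φ ⊆ Ω) :
    ∫ x, (fderiv ℝ φ x (basisVec j)) • g x = -∫ x, φ x • g' x := by
  have := h.2.2 φ hφ hc hs
  rwa [setIntegral_smul_eq_integral hs,
    setIntegral_smul_eq_integral ((tsupport_fderiv_apply_subset φ _).trans hs)] at this

theorem HasWeakPartial.unique [CompleteSpace F] (hΩ : IsOpen Ω) (h₁ : HasWeakPartial Ω j g g₁)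
    (h₂ : HasWeakPartial Ω j g g₂) : g₁ =ᵐ[volume.restrict Ω] g₂ := by
  have := hΩ.ae_eq_zero_of_integral_contDiff_smul_eq_zero (f := fun x => g₁ x - g₂ x)
    (μ := volume) (h₁.2.1.sub h₂.2.1) fun φ hφ hc hs => by
      simp_rw [smul_sub]
      rw [integral_sub (integrable_smul_of_tsupport_subset h₁.2.1 hφ.continuous hc hs)
        (integrable_smul_of_tsupport_subset h₂.2.1 hφ.continuous hc hs), sub_eq_zero]
      exact neg_injective ((h₁.integral_eq hφ hc hs).symm.trans (h₂.integral_eq hφ hc hs))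
  rw [EventuallyEq, ae_restrict_iff' hΩ.measurableSet]
  filter_upwards [this] with x hx hxΩ using sub_eq_zero.1 (hx hxΩ)

theorem HasWeakPartial.mono (h : HasWeakPartial Ω j g g') (hs : Ω' ⊆ Ω) :
    HasWeakPartial Ω' j g g' := by
  refine ⟨h.1.mono_set hs, h.2.1.mono_set hs, fun φ hφ hc hφs => ?_⟩
  rw [setIntegral_smul_eq_integral hφs,
    setIntegral_smul_eq_integral ((tsupport_fderiv_apply_subset φ _).trans hφs)]
  exact h.integral_eq hφ hc (hφs.trans hs)

theorem HasWeakPartial.congr {g₁' g₂' : E d → F}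
    (h : HasWeakPartial Ω j g₁ g₁') (hg : g₁ =ᵐ[volume.restrict Ω] g₂)
    (hg' : g₁' =ᵐ[volume.restrict Ω] g₂') : HasWeakPartial Ω j g₂ g₂' := by
  refine ⟨locallyIntegrableOn_congr_ae h.1 hg, locallyIntegrableOn_congr_ae h.2.1 hg',
    fun φ hφ hc hφs => ?_⟩
  have h0 := h.2.2 φ hφ hc hφs
  have e₁ : ∫ x in Ω, (fderiv ℝ φ x (basisVec j)) • g₁ x
      = ∫ x in Ω, (fderiv ℝ φ x (basisVec j)) • g₂ x :=
    integral_congr_ae (by filter_upwards [hg] with x hx; rw [hx])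
  have e₂ : ∫ x in Ω, φ x • g₁' x = ∫ x in Ω, φ x • g₂' x :=
    integral_congr_ae (by filter_upwards [hg'] with x hx; rw [hx])
  rw [← e₁, ← e₂, h0]

theorem locallyIntegrableOn_clm_comp (L : F →L[ℝ] G) (hg : LocallyIntegrableOn g Ω volume) :
    LocallyIntegrableOn (fun x => L (g x)) Ω volume := by
  intro x hx
  obtain ⟨s, hs, hi⟩ := hg x hx
  exact ⟨s, hs, L.integrable_comp hi⟩

theorem HasWeakPartial.clm_comp [CompleteSpace F] [CompleteSpace G] (L : F →L[ℝ] G)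
    (h : HasWeakPartial Ω j g g') :
    HasWeakPartial Ω j (fun x => L (g x)) (fun x => L (g' x)) := by
  refine ⟨locallyIntegrableOn_clm_comp L h.1, locallyIntegrableOn_clm_comp L h.2.1,
    fun φ hφ hc hφs => ?_⟩
  have hs' := (tsupport_fderiv_apply_subset φ (basisVec j)).trans hφs
  have hc' : HasCompactSupport fun x => fderiv ℝ φ x (basisVec j) := hc.fderiv_apply ℝ _
  have hcont : Continuous fun x => fderiv ℝ φ x (basisVec j) :=
    (hφ.continuous_fderiv (by simp)).clm_apply continuous_const
  rw [setIntegral_smul_eq_integral hφs, setIntegral_smul_eq_integral hs']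
  have e := congrArg L (h.integral_eq hφ hc hφs)
  rw [map_neg, ← L.integral_comp_comm (integrable_smul_of_tsupport_subset h.1 hcont hc' hs'),
    ← L.integral_comp_comm (integrable_smul_of_tsupport_subset h.2.1 hφ.continuous hc hφs)] at e
  simpa using e

theorem weakPartial_spec (h : ∃ g', HasWeakPartial Ω j g g') :
    HasWeakPartial Ω j g (weakPartial Ω j g) := by
  unfold weakPartial
  rw [dif_pos h]
  exact h.choose_spec

theorem HasWeakPartial.weakPartial_ae_eq [CompleteSpace F] (hΩ : IsOpen Ω)
    (h : HasWeakPartial Ω j g g') : weakPartial Ω j g =ᵐ[volume.restrict Ω] g' :=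
  (weakPartial_spec ⟨g', h⟩).unique hΩ h

theorem MemSobolev.memLp {q : ℝ≥0∞} {k : ℕ} (h : MemSobolev Ω q k g) :
    MemLp g q (volume.restrict Ω) := by
  cases k with
  | zero => exact h
  | succ k => exact h.1

theorem MemSobolev.congr {q : ℝ≥0∞} {k : ℕ} (h : MemSobolev Ω q k g₁)
    (hg : g₁ =ᵐ[volume.restrict Ω] g₂) : MemSobolev Ω q k g₂ := by
  cases k with
  | zero => exact (memLp_congr_ae hg).1 h
  | succ k =>
    refine ⟨(memLp_congr_ae hg).1 h.1, fun j => ?_⟩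
    obtain ⟨g', h1, h2⟩ := h.2 j
    exact ⟨g', h1.congr hg EventuallyEq.rfl, h2⟩

theorem MemSobolev.mono {q : ℝ≥0∞} (hs : Ω' ⊆ Ω) :
    ∀ {k : ℕ} {g : E d → F}, MemSobolev Ω q k g → MemSobolev Ω' q k g
  | 0, _, h => MemLp.mono_measure (Measure.restrict_mono hs le_rfl) h
  | _ + 1, _, h => ⟨h.1.mono_measure (Measure.restrict_mono hs le_rfl), fun j => by
      obtain ⟨g', h1, h2⟩ := h.2 j
      exact ⟨g', h1.mono hs, h2.mono hs⟩⟩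

theorem MemSobolev.hasWeakPartial {q : ℝ≥0∞} {k : ℕ} (h : MemSobolev Ω q (k + 1) g) (j : Fin d) :
    HasWeakPartial Ω j g (weakPartial Ω j g) := by
  obtain ⟨g', h1, -⟩ := h.2 j
  exact weakPartial_spec ⟨g', h1⟩

theorem MemSobolev.weakPartial [CompleteSpace F] (hΩ : IsOpen Ω) {q : ℝ≥0∞} {k : ℕ}
    (h : MemSobolev Ω q (k + 1) g) (j : Fin d) : MemSobolev Ω q k (weakPartial Ω j g) := by
  obtain ⟨g', h1, h2⟩ := h.2 j
  exact h2.congr (h1.weakPartial_ae_eq hΩ).symm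

theorem MemSobolev.of_succ {q : ℝ≥0∞} :
    ∀ {k : ℕ} {g : E d → F}, MemSobolev Ω q (k + 1) g → MemSobolev Ω q k g
  | 0, _, h => h.1
  | _ + 1, _, h => ⟨h.1, fun j => by
      obtain ⟨g', h1, h2⟩ := h.2 j
      exact ⟨g', h1, h2.of_succ⟩⟩

theorem MemSobolev.clm_comp [CompleteSpace F] [CompleteSpace G] {q : ℝ≥0∞} (L : F →L[ℝ] G) :
    ∀ {k : ℕ} {g : E d → F}, MemSobolev Ω q k g → MemSobolev Ω q k (fun x => L (g x))
  | 0, _, h => L.comp_memLp' h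
  | _ + 1, _, h => ⟨L.comp_memLp' h.1, fun j => by
      obtain ⟨g', h1, h2⟩ := h.2 j
      exact ⟨_, h1.clm_comp L, h2.clm_comp L⟩⟩

end WeakDerivative

end OldroydDG

namespace OldroydDG

section Density

theorem eLpNorm_comp_affine_le {d : ℕ} {F : Type*} [NormedAddCommGroup F] {q : ℝ≥0∞} (hq : 1 ≤ q)
    (hq' : q ≠ ⊤) {f : E d → F}
    (hf : AEStronglyMeasurable f volume) {r : ℝ} (hr : r ∈ Ioc (0 : ℝ) (1 / 2)) (z : E d) :
    eLpNorm (fun x => f ((1 - r) • x + r • z)) q volume ≤ 2 ^ d * eLpNorm f q volume := by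
  have hr1 : (1 - r) ≠ 0 := by linarith [hr.2]
  set A : E d → E d := fun x => (1 - r) • x + r • z
  have hA : Measurable A := by fun_prop
  have hmap : Measure.map A volume = ENNReal.ofReal |((1 - r) ^ d)⁻¹| • volume := by
    have : A = (fun x => x + r • z) ∘ fun x => (1 - r) • x := rfl
    rw [this, ← Measure.map_map (by fun_prop) (by fun_prop), Measure.map_addHaar_smul _ hr1,
      Measure.map_smul, (measurePreserving_add_right volume (r • z)).map_eq]
    simp
  have hac : Measure.map A volume ≪ volume := by
    rw [hmap]; exact Measure.smul_absolutelyContinuous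
  have : eLpNorm (fun x => f (A x)) q volume = eLpNorm f q (Measure.map A volume) :=
    (eLpNorm_map_measure (hf.mono_ac hac) hA.aemeasurable).symm
  rw [this, hmap]
  have hc : ENNReal.ofReal |((1 - r) ^ d)⁻¹| ≤ 2 ^ d := by
    have h0 : (0 : ℝ) < 1 - r := by linarith [hr.2]
    rw [abs_of_pos (by positivity), ← inv_pow]
    have h2 : (1 - r)⁻¹ ≤ 2 := by
      rw [inv_le_comm₀ h0 (by norm_num)]; linarith [hr.2]
    calc ENNReal.ofReal ((1 - r)⁻¹ ^ d) ≤ ENNReal.ofReal (2 ^ d) :=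
          ENNReal.ofReal_le_ofReal (by gcongr)
      _ = 2 ^ d := by rw [ENNReal.ofReal_pow (by norm_num)]; simp
  calc eLpNorm f q (ENNReal.ofReal |((1 - r) ^ d)⁻¹| • volume)
      ≤ eLpNorm f q ((2 ^ d : ℝ≥0∞) • volume) := by
        refine eLpNorm_mono_measure _ ?_
        exact Measure.le_iff.2 fun s _ => by simp only [Measure.smul_apply, smul_eq_mul]; gcongr
    _ ≤ 2 ^ d * eLpNorm f q volume := by
        have h1 : (1 : ℝ≥0∞) ≤ 2 ^ d := one_le_pow_of_one_le' (by norm_num) d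
        have h2 : 1 / q.toReal ≤ 1 := by
          rw [one_div]
          refine inv_le_one_of_one_le₀ ?_
          rw [← ENNReal.toReal_one]
          exact ENNReal.toReal_mono hq' hq
        rw [eLpNorm_smul_measure_of_ne_top hq', smul_eq_mul]
        gcongr
        simpa using ENNReal.rpow_le_rpow_of_exponent_le h1 h2

variable {d : ℕ} {F : Type*} [NormedAddCommGroup F] [NormedSpace ℝ F]

/-- Jensen's inequality for `Lᵖ`-norms of averages. -/
theorem eLpNorm_integral_le_of_forall_le {X Z : Type*} [MeasurableSpace X]
    [MeasurableSpace Z]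
    {μ : Measure X} [SFinite μ] {ν : Measure Z} [IsProbabilityMeasure ν] {G : X → Z → F}
    (hG : StronglyMeasurable (Function.uncurry G)) {q : ℝ≥0∞} (hq : 1 ≤ q) (hq' : q ≠ ⊤)
    {C : ℝ≥0∞} (hC : ∀ᵐ z ∂ν, eLpNorm (fun x => G x z) q μ ≤ C) :
    eLpNorm (fun x => ∫ z, G x z ∂ν) q μ ≤ C := by
  have hq0 : q ≠ 0 := (zero_lt_one.trans_le hq).ne'
  have hqr : 0 < q.toReal := ENNReal.toReal_pos hq0 hq'
  rw [← ENNReal.rpow_le_rpow_iff hqr]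
  have key : ∀ f : X → F, eLpNorm f q μ ^ q.toReal = ∫⁻ x, ‖f x‖ₑ ^ q.toReal ∂μ := fun f => by
    rw [eLpNorm_eq_lintegral_rpow_enorm_toReal hq0 hq', ← ENNReal.rpow_mul,
      one_div_mul_cancel hqr.ne', ENNReal.rpow_one]
  rw [key]
  have hGm : ∀ x, AEStronglyMeasurable (G x) ν := fun x =>
    (hG.comp_measurable measurable_prodMk_left).aestronglyMeasurable
  calc ∫⁻ x, ‖∫ z, G x z ∂ν‖ₑ ^ q.toReal ∂μ
      ≤ ∫⁻ x, ∫⁻ z, ‖G x z‖ₑ ^ q.toReal ∂ν ∂μ := by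
        refine lintegral_mono fun x => ?_
        have h1 : ‖∫ z, G x z ∂ν‖ₑ ≤ eLpNorm (G x) q ν := by
          refine (enorm_integral_le_lintegral_enorm _).trans ?_
          rw [← eLpNorm_one_eq_lintegral_enorm]
          exact eLpNorm_le_eLpNorm_of_exponent_le hq (hGm x)
        refine (ENNReal.rpow_le_rpow h1 hqr.le).trans (le_of_eq ?_)
        rw [eLpNorm_eq_lintegral_rpow_enorm_toReal hq0 hq', ← ENNReal.rpow_mul,
          one_div_mul_cancel hqr.ne', ENNReal.rpow_one]
    _ = ∫⁻ z, ∫⁻ x, ‖G x z‖ₑ ^ q.toReal ∂μ ∂ν := by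
        refine lintegral_lintegral_swap ?_
        exact (hG.enorm.pow_const _).aemeasurable
    _ ≤ ∫⁻ _, C ^ q.toReal ∂ν := by
        refine lintegral_mono_ae ?_
        filter_upwards [hC] with z hz
        rw [← key]
        exact ENNReal.rpow_le_rpow hz hqr.le
    _ = C ^ q.toReal := by simp

theorem eventually_eLpNorm_comp_affine_sub_le {q : ℝ≥0∞} (hq : 1 ≤ q) (hq' : q ≠ ⊤) {f : E d → F}
    (hf : MemLp f q volume) {R : ℝ} (hR : 0 ≤ R) {ε : ℝ≥0∞} (hε : ε ≠ 0) :
    ∀ᶠ r in 𝓝[>] (0 : ℝ), ∀ z : E d, ‖z‖ ≤ R →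
      eLpNorm (fun x => f ((1 - r) • x + r • z) - f x) q volume ≤ ε := by
  set δ : ℝ≥0∞ := ε / 3 / 2 ^ d with hδ
  have h2d : (2 ^ d : ℝ≥0∞) ≠ 0 := by positivity
  have h2d' : (2 ^ d : ℝ≥0∞) ≠ ⊤ := by finiteness
  have hδ0 : δ ≠ 0 := by
    rw [hδ]
    exact (ENNReal.div_pos (ENNReal.div_pos hε (by norm_num)).ne' h2d').ne'
  obtain ⟨c, hc, hfc, hcc, hcm⟩ := hf.exists_hasCompactSupport_eLpNorm_sub_le hq' hδ0
  obtain ⟨R₀, hR₀⟩ : ∃ R₀, 0 ≤ R₀ ∧ ∀ x, R₀ < ‖x‖ → c x = 0 := by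
    obtain ⟨R₀, h⟩ := hc.isBounded.subset_closedBall (0 : E d)
    refine ⟨max R₀ 0, le_max_right _ _, fun x hx => image_eq_zero_of_notMem_tsupport fun hx' => ?_⟩
    have := h hx'
    rw [mem_closedBall_zero_iff] at this
    exact absurd hx (not_lt.2 (this.trans (le_max_left _ _)))
  obtain ⟨hR₀', hR₀⟩ := hR₀
  set R₁ := 2 * (R₀ + R) + 1 with hR₁
  have hR₁' : 0 < R + R₁ := by positivity
  set B := Metric.closedBall (0 : E d) R₁
  have hBfin : volume B ≠ ⊤ := (isCompact_closedBall _ _).measure_ne_top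
  obtain ⟨η, hη, hηε⟩ : ∃ η : ℝ, 0 < η ∧
      ENNReal.ofReal η * volume B ^ (1 / q.toReal) ≤ ε / 3 := by
    have hBr : volume B ^ (1 / q.toReal) ≠ ⊤ := ENNReal.rpow_ne_top_of_nonneg (by positivity) hBfin
    have ht : Tendsto (fun η : ℝ => ENNReal.ofReal η * volume B ^ (1 / q.toReal)) (𝓝[>] 0)
        (𝓝 0) := by
      have := ENNReal.Tendsto.mul_const (b := volume B ^ (1 / q.toReal))
        (ENNReal.tendsto_ofReal (tendsto_id (x := 𝓝 (0 : ℝ)))) (Or.inr hBr)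
      simp only [id, ENNReal.ofReal_zero, zero_mul] at this
      exact this.mono_left nhdsWithin_le_nhds
    have h3 : 0 < ε / 3 := ENNReal.div_pos hε (by norm_num)
    obtain ⟨η, h1, h2⟩ := ((ht.eventually (eventually_le_nhds h3)).and
      self_mem_nhdsWithin).exists
    exact ⟨η, h2, h1⟩
  obtain ⟨θ, hθ, hθc⟩ := Metric.uniformContinuous_iff.1
    (hc.uniformContinuous_of_continuous hcc) η hη
  have hev : ∀ᶠ r in 𝓝[>] (0 : ℝ), r ∈ Ioo (0 : ℝ) (min (1 / 2) (θ / (R + R₁))) :=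
    Ioo_mem_nhdsGT (lt_min (by norm_num) (div_pos hθ hR₁'))
  filter_upwards [hev] with r hr z hz
  have hr0 : 0 < r := hr.1
  have hr2 : r < 1 / 2 := hr.2.trans_le (min_le_left _ _)
  have hrθ : r * (R + R₁) < θ := by
    have := hr.2.trans_le (min_le_right _ _)
    rwa [lt_div_iff₀ hR₁'] at this
  have hcz : eLpNorm (fun x => c ((1 - r) • x + r • z) - c x) q volume ≤ ε / 3 := by
    have hsupp : ∀ x : E d, R₁ < ‖x‖ → c x = 0 ∧ c ((1 - r) • x + r • z) = 0 := by
      intro x hx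
      refine ⟨hR₀ x (by linarith [hR₀']), hR₀ _ ?_⟩
      have h1 : ‖(1 - r) • x‖ ≤ ‖(1 - r) • x + r • z‖ + ‖r • z‖ := by
        simpa using norm_sub_le ((1 - r) • x + r • z) (r • z)
      rw [norm_smul, norm_smul, Real.norm_of_nonneg hr0.le, Real.norm_of_nonneg (by linarith)] at h1
      have h2 : r * ‖z‖ ≤ 1 / 2 * R := by gcongr
      have h3 : 1 / 2 * ‖x‖ ≤ (1 - r) * ‖x‖ := by gcongr; linarith
      linarith
    refine le_trans ?_ hηε
    refine eLpNorm_sub_le_of_dist_bdd (s := B) volume hq' measurableSet_closedBall hη.le ?_ ?_ ?_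
    · intro x
      by_cases hx : ‖x‖ ≤ R₁
      · refine (hθc ?_).le
        rw [dist_eq_norm]
        have : (1 - r) • x + r • z - x = r • (z - x) := by module
        rw [this, norm_smul, Real.norm_of_nonneg hr0.le]
        refine lt_of_le_of_lt ?_ hrθ
        gcongr
        exact (norm_sub_le _ _).trans (by linarith)
      · rw [(hsupp x (not_le.1 hx)).1, (hsupp x (not_le.1 hx)).2, dist_self]
        exact hη.le
    · intro x hx
      by_contra h
      rw [mem_closedBall_zero_iff, not_le] at h
      exact hx (hsupp x h).2
    · intro x hx
      by_contra h
      rw [mem_closedBall_zero_iff, not_le] at h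
      exact hx (hsupp x h).1
  have hfcm : AEStronglyMeasurable (f - c) volume := hf.1.sub hcm.1
  have hac : Measure.QuasiMeasurePreserving (fun x : E d => (1 - r) • x + r • z) volume volume := by
    have h1 : Measure.QuasiMeasurePreserving (fun x : E d => (1 - r) • x) volume volume :=
      Measure.quasiMeasurePreserving_smul volume (r := 1 - r) (by linarith)
    exact (measurePreserving_add_right volume (r • z)).quasiMeasurePreserving.comp h1
  have e : (fun x => f ((1 - r) • x + r • z) - f x) =
      (fun x => (f - c) ((1 - r) • x + r • z)) +
        ((fun x => c ((1 - r) • x + r • z) - c x) - (f - c)) := by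
    ext x; simp
  have hcm' : AEStronglyMeasurable (fun x => c ((1 - r) • x + r • z) - c x) volume :=
    ((hcc.comp (by fun_prop)).sub hcc).aestronglyMeasurable
  have h1 : eLpNorm (fun x => (f - c) ((1 - r) • x + r • z)) q volume ≤ ε / 3 := by
    refine (eLpNorm_comp_affine_le hq hq' hfcm ⟨hr0, hr2.le⟩ z).trans ?_
    calc 2 ^ d * eLpNorm (f - c) q volume ≤ 2 ^ d * δ := by gcongr
      _ = ε / 3 := by rw [hδ]; exact ENNReal.mul_div_cancel h2d h2d'
  have h3 : eLpNorm (f - c) q volume ≤ ε / 3 := by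
    refine hfc.trans ?_
    rw [hδ]
    exact ENNReal.div_le_of_le_mul (le_mul_of_one_le_right (by positivity)
      (one_le_pow₀ (by norm_num)))
  rw [e]
  refine (eLpNorm_add_le (hfcm.comp_quasiMeasurePreserving hac) (hcm'.sub hfcm) hq).trans ?_
  refine (add_le_add h1 ((eLpNorm_sub_le hcm' hfcm hq).trans (add_le_add hcz h3))).trans
    (le_of_eq ?_)
  rw [← add_assoc, ENNReal.add_thirds]

end Density

end OldroydDG

namespace OldroydDG

section Density

variable {d : ℕ} {F : Type*} [NormedAddCommGroup F] [NormedSpace ℝ F]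

/-- The average of `h` over the contraction of the weight `ρ` towards `x`. -/
noncomputable def contractMollify (ρ : E d → ℝ) (r : ℝ) (h : E d → F) (x : E d) : F :=
  ∫ z, ρ z • h ((1 - r) • x + r • z)

/-- The kernel that represents `contractMollify` as a convolution. -/
noncomputable def contractKernel (ρ : E d → ℝ) (r : ℝ) (s : E d) : ℝ :=
  (r ^ d)⁻¹ * ρ (-(r⁻¹ • s))

variable {ρ : E d → ℝ} {r : ℝ} {h : E d → F}

theorem integrable_smul_comp_affine (hρ : Continuous ρ) (hc : HasCompactSupport ρ) (hr : r ≠ 0)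
    (hh : LocallyIntegrable h volume) (a : E d) :
    Integrable (fun z => ρ z • h (a + r • z)) volume := by
  have h1 : Integrable (fun y => ρ (r⁻¹ • (y - a)) • h y) volume := by
    refine hh.integrable_smul_left_of_hasCompactSupport (by fun_prop) ?_
    have : (fun y => ρ (r⁻¹ • (y - a))) = ρ ∘ ((Homeomorph.subRight a).trans
        (Homeomorph.smulOfNeZero r⁻¹ (inv_ne_zero hr))) := rfl
    rw [this]
    exact hc.comp_homeomorph _
  have h2 := (h1.comp_add_left a).comp_smul hr
  refine h2.congr (Eventually.of_forall fun z => ?_)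
  simp [smul_smul, inv_mul_cancel₀ hr]

theorem contractMollify_eq (hr : 0 < r) (x : E d) :
    contractMollify ρ r h x = ∫ y, contractKernel ρ r ((1 - r) • x - y) • h y := by
  set a := (1 - r) • x with ha
  have h1 := Measure.integral_comp_smul_of_nonneg volume
    (fun w => ρ (r⁻¹ • w) • h (a + w)) r (hR := hr.le)
  have h2 := integral_add_left_eq_self (μ := (volume : Measure (E d)))
    (fun y => ρ (r⁻¹ • (y - a)) • h y) a
  simp only [add_sub_cancel_left] at h2
  rw [h2] at h1
  simp only [smul_smul, inv_mul_cancel₀ hr.ne', one_smul, finrank_euclideanSpace,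
    Fintype.card_fin] at h1
  rw [contractMollify, ← ha, h1, ← integral_smul]
  refine integral_congr_ae (Eventually.of_forall fun y => ?_)
  simp only [contractKernel, smul_smul]
  congr 3
  rw [← smul_neg, neg_sub]

theorem contDiff_contractKernel (hρ : ContDiff ℝ ∞ ρ) : ContDiff ℝ ∞ (contractKernel ρ r) := by
  unfold contractKernel
  fun_prop

theorem hasCompactSupport_contractKernel (hc : HasCompactSupport ρ) (hr : r ≠ 0) :
    HasCompactSupport (contractKernel ρ r) := by
  have : (fun s => ρ (-(r⁻¹ • s))) = ρ ∘ ((Homeomorph.smulOfNeZero r⁻¹ (inv_ne_zero hr)).trans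
      (Homeomorph.neg (E d))) := rfl
  have h2 : HasCompactSupport fun s => ρ (-(r⁻¹ • s)) := by
    rw [this]; exact hc.comp_homeomorph _
  exact h2.mul_left (f := fun _ => (r ^ d)⁻¹)

theorem contractMollify_eq_convolution (hr : 0 < r) :
    contractMollify ρ r h = fun x => (convolution h (contractKernel ρ r)
      (ContinuousLinearMap.lsmul ℝ ℝ).flip volume) ((1 - r) • x) := by
  ext x
  rw [contractMollify_eq hr]
  rfl

theorem contDiff_contractMollify (hρ : ContDiff ℝ ∞ ρ) (hc : HasCompactSupport ρ) (hr : 0 < r)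
    (hh : LocallyIntegrable h volume) : ContDiff ℝ ∞ (contractMollify ρ r h) := by
  rw [contractMollify_eq_convolution hr]
  refine ContDiff.comp (g := convolution h (contractKernel ρ r)
      (ContinuousLinearMap.lsmul ℝ ℝ).flip volume) (f := fun x : E d => (1 - r) • x) ?_ (by fun_prop)
  exact (hasCompactSupport_contractKernel hc hr.ne').contDiff_convolution_right _ hh
    (contDiff_contractKernel hρ)

theorem fderiv_contractMollify (hρ : ContDiff ℝ ∞ ρ) (hc : HasCompactSupport ρ) (hr : 0 < r)
    (hh : LocallyIntegrable h volume) (x v : E d) :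
    fderiv ℝ (contractMollify ρ r h) x v =
      (1 - r) • ∫ y, fderiv ℝ (contractKernel ρ r) ((1 - r) • x - y) v • h y := by
  rw [contractMollify_eq_convolution hr]
  have hk := hasCompactSupport_contractKernel hc hr.ne'
  have hk' : ContDiff ℝ ∞ (contractKernel ρ r) := contDiff_contractKernel hρ
  have h1 := hk.hasFDerivAt_convolution_right (μ := volume)
    (ContinuousLinearMap.lsmul ℝ ℝ : ℝ →L[ℝ] F →L[ℝ] F).flip hh (hk'.of_le (by simp)) ((1 - r) • x)
  have h2 : HasFDerivAt (fun x : E d => (1 - r) • x)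
      ((1 - r) • ContinuousLinearMap.id ℝ (E d)) x := (hasFDerivAt_id x).const_smul (1 - r)
  have h3 := h1.comp x h2
  rw [show (fun x => (convolution h (contractKernel ρ r)
      (ContinuousLinearMap.lsmul ℝ ℝ).flip volume) ((1 - r) • x)) = (convolution h
      (contractKernel ρ r) (ContinuousLinearMap.lsmul ℝ ℝ).flip volume) ∘
      fun x : E d => (1 - r) • x from rfl, h3.fderiv]
  rw [ContinuousLinearMap.comp_apply, smul_apply, ContinuousLinearMap.id_apply,
    map_smul, convolution_precompR_apply _ hh (hk.fderiv ℝ) (hk'.continuous_fderiv (by simp))]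
  rfl

theorem fderiv_contractMollify_of_hasWeakPartial (hρ : ContDiff ℝ ∞ ρ) (hc : HasCompactSupport ρ)
    (hr : r ∈ Ioo (0 : ℝ) 1) {Ω : Set (E d)} (hΩ : Convex ℝ Ω) (hs : tsupport ρ ⊆ Ω)
    {j : Fin d} {g g' : E d → F} (hg : HasWeakPartial Ω j g g')
    (hi : LocallyIntegrable (Ω.indicator g) volume) {x : E d} (hx : x ∈ Ω) :
    fderiv ℝ (contractMollify ρ r (Ω.indicator g)) x (basisVec j) =
      (1 - r) • contractMollify ρ r (Ω.indicator g') x := by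
  rw [fderiv_contractMollify hρ hc hr.1 hi, contractMollify_eq hr.1]
  congr 1
  set a := (1 - r) • x with ha
  set ψ : E d → ℝ := fun y => contractKernel ρ r (a - y) with hψ
  have hk' : ContDiff ℝ ∞ (contractKernel ρ r) := contDiff_contractKernel hρ
  have hψ' : ContDiff ℝ ∞ ψ := hk'.comp (by fun_prop)
  have hψc : HasCompactSupport ψ :=
    (hasCompactSupport_contractKernel hc hr.1.ne').comp_homeomorph (Homeomorph.subLeft a)
  have hψs : tsupport ψ ⊆ Ω := by
    have h1 : tsupport ψ ⊆ (fun y => r⁻¹ • (y - a)) ⁻¹' tsupport ρ := by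
      refine closure_minimal ?_ ((isClosed_tsupport ρ).preimage (by fun_prop))
      intro y hy
      refine subset_tsupport ρ ?_
      intro h0
      refine hy ?_
      simp only [hψ, contractKernel]
      rw [← smul_neg, neg_sub, h0, mul_zero]
    intro y hy
    have h2 := hs (h1 hy)
    have h3 := hΩ hx h2 (by linarith [hr.2] : 0 ≤ 1 - r) hr.1.le (by ring)
    rwa [smul_smul, mul_inv_cancel₀ hr.1.ne', one_smul, ← ha, add_sub_cancel] at h3
  have hd : ∀ y, fderiv ℝ ψ y (basisVec j) = -fderiv ℝ (contractKernel ρ r) (a - y) (basisVec j) := by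
    intro y
    have h1 : HasFDerivAt (fun y => a - y) (-ContinuousLinearMap.id ℝ (E d)) y :=
      (hasFDerivAt_id y).const_sub a
    have h2 : HasFDerivAt ψ _ y :=
      ((hk'.differentiable (by simp) (a - y)).hasFDerivAt).comp y h1
    rw [h2.fderiv]
    simp
  have hind : ∀ (θ : E d → ℝ) (f : E d → F), tsupport θ ⊆ Ω →
      ∫ y, θ y • Ω.indicator f y = ∫ y, θ y • f y := by
    intro θ f hθ
    refine integral_congr_ae (Eventually.of_forall fun y => ?_)
    by_cases hy : y ∈ Ω
    · simp [hy]
    · simp [image_eq_zero_of_notMem_tsupport (fun h => hy (hθ h))]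
  have h1 := hg.integral_eq hψ' hψc hψs
  rw [hind ψ g' hψs, ← neg_eq_iff_eq_neg.2 h1, ← hind _ g
    ((tsupport_fderiv_apply_subset ψ _).trans hψs), ← integral_neg]
  refine integral_congr_ae (Eventually.of_forall fun y => ?_)
  simp only [hd, neg_smul, neg_neg]

theorem contractMollify_congr_ae {h' : E d → F} (hr : r ≠ 0) (e : h =ᵐ[volume] h') :
    contractMollify ρ r h = contractMollify ρ r h' := by
  ext x
  refine integral_congr_ae ?_
  have hq : Measure.QuasiMeasurePreserving (fun z : E d => (1 - r) • x + r • z) volume volume :=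
    (measurePreserving_add_left volume ((1 - r) • x)).quasiMeasurePreserving.comp
      (Measure.quasiMeasurePreserving_smul volume hr)
  filter_upwards [hq.ae e] with z hz
  rw [hz]

theorem tendsto_contractMollify [CompleteSpace F] (hρ : Continuous ρ) (hc : HasCompactSupport ρ)
    (hρ0 : ∀ z, 0 ≤ ρ z) (hρ1 : ∫ z, ρ z = 1) {q : ℝ≥0∞} (hq : 1 ≤ q) (hq' : q ≠ ⊤) (hh : MemLp h q volume) :
    Tendsto (fun r => eLpNorm (fun x => contractMollify ρ r h x - h x) q volume) (𝓝[>] 0)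
      (𝓝 0) := by
  obtain ⟨h', hm, e⟩ := hh.1
  have hh' : MemLp h' q volume := (memLp_congr_ae e).1 hh
  have hloc : LocallyIntegrable h' volume := hh'.locallyIntegrable hq
  set ν : Measure (E d) := volume.withDensity fun z => ENNReal.ofReal (ρ z) with hν
  have hνp : IsProbabilityMeasure ν := ⟨by
    rw [hν, withDensity_apply _ MeasurableSet.univ, Measure.restrict_univ,
      ← ofReal_integral_eq_lintegral_ofReal (hρ.integrable_of_hasCompactSupport hc)
        (Eventually.of_forall hρ0), hρ1, ENNReal.ofReal_one]⟩
  obtain ⟨R, hR0, hR⟩ : ∃ R : ℝ, 0 ≤ R ∧ ∀ z, ρ z ≠ 0 → ‖z‖ ≤ R := by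
    obtain ⟨R₀, h⟩ := hc.isBounded.subset_closedBall (0 : E d)
    refine ⟨max R₀ 0, le_max_right _ _, fun x hx => ?_⟩
    have := h (subset_tsupport ρ hx)
    rw [mem_closedBall_zero_iff] at this
    exact this.trans (le_max_left _ _)
  have hνR : ∀ᵐ z ∂ν, ‖z‖ ≤ R := by
    rw [hν, ae_withDensity_iff (by fun_prop)]
    refine Eventually.of_forall fun z hz => hR z fun h0 => hz (by simp [h0])
  rw [ENNReal.tendsto_nhds_zero]
  intro ε hε
  filter_upwards [eventually_eLpNorm_comp_affine_sub_le hq hq' hh' hR0 hε.ne',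
    self_mem_nhdsWithin] with r hr hr0
  have hr0 : r ≠ 0 := ne_of_gt hr0
  have e1 : (fun x => contractMollify ρ r h x - h x) =ᵐ[volume]
      fun x => ∫ z, (h' ((1 - r) • x + r • z) - h' x) ∂ν := by
    filter_upwards [e] with x hx
    rw [hx, contractMollify_congr_ae hr0 e, hν,
      integral_withDensity_eq_integral_toReal_smul (by fun_prop)
        (Eventually.of_forall fun z => ENNReal.ofReal_lt_top)]
    have e2 : ∀ z, (ENNReal.ofReal (ρ z)).toReal • (h' ((1 - r) • x + r • z) - h' x) =
        ρ z • h' ((1 - r) • x + r • z) - ρ z • h' x := fun z => by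
      rw [ENNReal.toReal_ofReal (hρ0 z), smul_sub]
    simp_rw [e2]
    rw [integral_sub (integrable_smul_comp_affine hρ hc hr0 hloc _)
      ((hρ.integrable_of_hasCompactSupport hc).smul_const _), integral_smul_const, hρ1, one_smul]
    rfl
  rw [eLpNorm_congr_ae e1]
  refine eLpNorm_integral_le_of_forall_le ?_ hq hq' ?_
  · have hm1 : Measurable fun p : E d × E d => (1 - r) • p.1 + r • p.2 := by fun_prop
    exact (hm.comp_measurable hm1).sub (hm.comp_measurable measurable_fst)
  · filter_upwards [hνR] with z hz using hr z hz

/-- The smooth functions `φ n` converge to `g` in `L^q(Ω)`, and their partial derivatives converge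
to `g'`. -/
structure IsSmoothApprox (Ω : Set (E d)) (q : ℝ≥0∞) (φ : ℕ → E d → F) (g : E d → F)
    (g' : Fin d → E d → F) : Prop where
  aesm : AEStronglyMeasurable g (volume.restrict Ω)
  aesm' : ∀ j, AEStronglyMeasurable (g' j) (volume.restrict Ω)
  contDiff : ∀ n, ContDiff ℝ ∞ (φ n)
  tendsto : Tendsto (fun n => eLpNorm (fun x => φ n x - g x) q (volume.restrict Ω)) atTop (𝓝 0)
  tendsto_fderiv : ∀ j, Tendsto (fun n => eLpNorm (fun x => fderiv ℝ (φ n) x (basisVec j) - g' j x) q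
    (volume.restrict Ω)) atTop (𝓝 0)

/-- Smooth functions are dense in the Sobolev space of an open convex set. -/
theorem exists_isSmoothApprox [CompleteSpace F] {Ω : Set (E d)} (hΩ : IsOpen Ω) (hcΩ : Convex ℝ Ω)
    (hne : Ω.Nonempty) {q : ℝ≥0∞} (hq : 1 ≤ q) (hq' : q ≠ ⊤) {g : E d → F} {g' : Fin d → E d → F}
    (hg : MemLp g q (volume.restrict Ω)) (hw : ∀ j, HasWeakPartial Ω j g (g' j))
    (hg' : ∀ j, MemLp (g' j) q (volume.restrict Ω)) :
    ∃ φ, IsSmoothApprox Ω q φ g g' := by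
  obtain ⟨x₀, hx₀⟩ := hne
  obtain ⟨δ, hδ, hball⟩ := Metric.isOpen_iff.1 hΩ x₀ hx₀
  let b : ContDiffBump x₀ := ⟨δ / 4, δ / 2, by positivity, by linarith⟩
  set ρ : E d → ℝ := b.normed volume with hρ
  have hsm : ContDiff ℝ ∞ ρ := b.contDiff_normed
  have hc : HasCompactSupport ρ := b.hasCompactSupport_normed
  have hs : tsupport ρ ⊆ Ω := by
    rw [hρ, b.tsupport_normed_eq]
    exact (Metric.closedBall_subset_ball (by change δ / 2 < δ; linarith)).trans hball
  have h0 : ∀ z, 0 ≤ ρ z := fun z => b.nonneg_normed z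
  have h1 : ∫ z, ρ z = 1 := b.integral_normed
  set h : E d → F := Ω.indicator g
  set h' : Fin d → E d → F := fun j => Ω.indicator (g' j)
  have hh : MemLp h q volume := (memLp_indicator_iff_restrict hΩ.measurableSet).2 hg
  have hh' : ∀ j, MemLp (h' j) q volume := fun j =>
    (memLp_indicator_iff_restrict hΩ.measurableSet).2 (hg' j)
  have hloc : LocallyIntegrable h volume := hh.locallyIntegrable hq
  set r : ℕ → ℝ := fun n => 1 / ((n : ℝ) + 2) with hr
  have hr01 : ∀ n, r n ∈ Ioo (0 : ℝ) 1 := fun n => by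
    have : (0 : ℝ) < (n : ℝ) + 2 := by positivity
    refine ⟨by positivity, ?_⟩
    rw [hr, div_lt_one this]
    linarith [(Nat.cast_nonneg n : (0 : ℝ) ≤ n)]
  have hr0 : Tendsto r atTop (𝓝 0) := by
    have := (tendsto_const_div_atTop_nhds_zero_nat (1 : ℝ)).comp (tendsto_add_atTop_nat 2)
    refine this.congr fun n => ?_
    simp [hr]
  have hr0' : Tendsto r atTop (𝓝[>] 0) :=
    tendsto_nhdsWithin_iff.2 ⟨hr0, Eventually.of_forall fun n => (hr01 n).1⟩
  refine ⟨fun n => contractMollify ρ (r n) h, hg.1, fun j => (hg' j).1, fun n =>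
    contDiff_contractMollify hsm hc (hr01 n).1 hloc, ?_, fun j => ?_⟩
  · have ht := (tendsto_contractMollify hsm.continuous hc h0 h1 hq hq' hh).comp hr0'
    refine tendsto_of_tendsto_of_tendsto_of_le_of_le tendsto_const_nhds ht (fun _ => zero_le)
      fun n => ?_
    refine le_trans (le_of_eq ?_) (eLpNorm_mono_measure _ (Measure.restrict_le_self (s := Ω)))
    refine eLpNorm_congr_ae ?_
    filter_upwards [ae_restrict_mem hΩ.measurableSet] with x hx
    simp [h, hx]
  · have ht := (tendsto_contractMollify hsm.continuous hc h0 h1 hq hq' (hh' j)).comp hr0'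
    have ht2 : Tendsto (fun n => ‖r n‖ₑ * eLpNorm (h' j) q volume) atTop (𝓝 0) := by
      have h3 : Tendsto (fun n => ‖r n‖ₑ) atTop (𝓝 0) := by
        simpa using hr0.enorm
      simpa using ENNReal.Tendsto.mul_const h3 (Or.inr (hh' j).eLpNorm_ne_top)
    have ht3 := ht.add ht2
    rw [add_zero] at ht3
    refine tendsto_of_tendsto_of_tendsto_of_le_of_le tendsto_const_nhds ht3 (fun _ => zero_le)
      fun n => ?_
    have hmeas : AEStronglyMeasurable (fun x => contractMollify ρ (r n) (h' j) x - h' j x) volume :=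
      (contDiff_contractMollify hsm hc (hr01 n).1
        ((hh' j).locallyIntegrable hq)).continuous.aestronglyMeasurable.sub (hh' j).1
    have e : (fun x => fderiv ℝ (contractMollify ρ (r n) h) x (basisVec j) - g' j x)
        =ᵐ[volume.restrict Ω]
        ((1 - r n) • fun x => contractMollify ρ (r n) (h' j) x - h' j x) - r n • h' j := by
      filter_upwards [ae_restrict_mem hΩ.measurableSet] with x hx
      rw [fderiv_contractMollify_of_hasWeakPartial hsm hc (hr01 n) hcΩ hs (hw j) hloc hx]
      simp only [Pi.sub_apply, Pi.smul_apply, h', indicator_of_mem hx]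
      module
    rw [eLpNorm_congr_ae e]
    refine (eLpNorm_mono_measure _ (Measure.restrict_le_self (s := Ω))).trans ?_
    refine (eLpNorm_sub_le (hmeas.const_smul _) ((hh' j).1.const_smul _) hq).trans ?_
    rw [eLpNorm_const_smul, eLpNorm_const_smul]
    refine add_le_add ?_ le_rfl
    refine mul_le_of_le_one_left zero_le ?_
    rw [← ofReal_norm, Real.norm_of_nonneg (by linarith [(hr01 n).2]), ENNReal.ofReal_le_one]
    linarith [(hr01 n).1]

end Density

end OldroydDG

namespace OldroydDG

section Cone

variable {d : ℕ}

/-- The hyperplane with normal `n` and offset `c`. -/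
def hyperplane (n : E d) (c : ℝ) : Set (E d) := {x | ⟪n, x⟫_ℝ = c}

theorem isClosed_hyperplane (n : E d) (c : ℝ) : IsClosed (hyperplane n c) :=
  isClosed_eq (by fun_prop) continuous_const

theorem lintegral_comp_smul_eq {V : Type*} [NormedAddCommGroup V] [NormedSpace ℝ V]
    [MeasurableSpace V] [BorelSpace V] [FiniteDimensional ℝ V] (μ : Measure V) [μ.IsAddHaarMeasure]
    (f : V → ℝ≥0∞) {r : ℝ} (hr : r ≠ 0) :
    ∫⁻ z, f (r • z) ∂μ = ENNReal.ofReal |(r ^ Module.finrank ℝ V)⁻¹| * ∫⁻ z, f z ∂μ := by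
  have h := lintegral_map_equiv (μ := μ) f (Homeomorph.smulOfNeZero r hr).toMeasurableEquiv
  have e : (⇑(Homeomorph.smulOfNeZero r hr).toMeasurableEquiv : V → V) = fun z => r • z := rfl
  rw [e, Measure.map_addHaar_smul μ hr, lintegral_smul_measure, smul_eq_mul] at h
  exact h.symm

/-- Orthogonal coordinates adapted to the unit vector `n`. -/
theorem exists_orthogonal_coordinates {n : E d} (hn : ‖n‖ = 1) :
    ∃ A : E (d - 1) →ₗᵢ[ℝ] E d, (∀ z, ⟪n, A z⟫_ℝ = 0) ∧ (∀ x, ⟪n, x⟫_ℝ = 0 → ∃ z, A z = x) ∧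
      MeasurePreserving (fun p : ℝ × E (d - 1) => p.1 • n + A p.2) (volume.prod volume) volume := by
  have hn0 : n ≠ 0 := by rintro rfl; simp at hn
  set s : Submodule ℝ (E d) := ℝ ∙ n with hs
  have hfr : Module.finrank ℝ sᗮ = d - 1 := by
    have h1 := s.finrank_add_finrank_orthogonal
    rw [finrank_span_singleton hn0, finrank_euclideanSpace, Fintype.card_fin] at h1
    omega
  let e₁ : ℝ ≃ₗᵢ[ℝ] s := LinearIsometryEquiv.toSpanUnitSingleton n hn
  let e₂ : E (d - 1) ≃ₗᵢ[ℝ] sᗮ := ((stdOrthonormalBasis ℝ sᗮ).reindex (finCongr hfr)).repr.symm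
  refine ⟨sᗮ.subtypeₗᵢ.comp e₂.toLinearIsometry, fun z => ?_, fun x hx => ?_, ?_⟩
  · exact Submodule.mem_orthogonal_singleton_iff_inner_right.1 (e₂ z).2
  · exact ⟨e₂.symm ⟨x, Submodule.mem_orthogonal_singleton_iff_inner_right.2 hx⟩, by simp⟩
  · have h1 := (s.measurePreserving_measurableEquivProd (0 : E d)).symm
    rw [InnerProductSpace.euclideanHausdorffMeasure_eq_volume] at h1
    have h2 := h1.comp (e₁.measurePreserving.prod e₂.measurePreserving)
    have e : (fun p : ℝ × E (d - 1) => p.1 • n + sᗮ.subtypeₗᵢ.comp e₂.toLinearIsometry p.2) =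
        (s.measurableEquivProd (0 : E d)).symm ∘ Prod.map e₁ e₂ := by
      funext p
      simp [e₁]
      rfl
    rw [e]
    exact h2

variable {n x₀ : E d} {c : ℝ}

theorem surf_restrict_hyperplane {A : E (d - 1) →ₗᵢ[ℝ] E d} (hn : ‖n‖ = 1)
    (hA : ∀ z, ⟪n, A z⟫_ℝ = 0) (hA' : ∀ x, ⟪n, x⟫_ℝ = 0 → ∃ z, A z = x) (c : ℝ) :
    (surf d).restrict (hyperplane n c) = Measure.map (fun z => c • n + A z) volume := by
  have hiso : Isometry fun z => c • n + A z := (isometry_add_left (c • n)).comp A.isometry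
  have hnn : ⟪n, n⟫_ℝ = 1 := by rw [real_inner_self_eq_norm_sq, hn, one_pow]
  have hrange : range (fun z => c • n + A z) = hyperplane n c := by
    ext x
    constructor
    · rintro ⟨z, rfl⟩
      simp [hyperplane, inner_add_right, inner_smul_right, hA, hn]
    · intro hx
      obtain ⟨z, hz⟩ := hA' (x - c • n) (by
        rw [inner_sub_right, inner_smul_right, hnn, mul_one, show ⟪n, x⟫_ℝ = c from hx, sub_self])
      exact ⟨z, by simp [hz]⟩
  rw [← hrange, ← hiso.map_euclideanHausdorffMeasure,
    EuclideanSpace.euclideanHausdorffMeasure_eq_volume]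

/-- Integration in polar coordinates with centre `x₀` over a half space, where the sphere is
replaced with a hyperplane. -/
theorem lintegral_halfSpace_eq (hn : ‖n‖ = 1) (hc : ⟪n, x₀⟫_ℝ < c) {G : E d → ℝ≥0∞}
    (hG : Measurable G) :
    ∫⁻ x in {x | 0 < ⟪n, x - x₀⟫_ℝ}, G x = ∫⁻ r in Ioi (0 : ℝ),
      ENNReal.ofReal ((c - ⟪n, x₀⟫_ℝ) * r ^ (d - 1)) *
        ∫⁻ y in hyperplane n c, G (x₀ + r • (y - x₀)) ∂(surf d) := by
  obtain ⟨A, hA, hA', hmp⟩ := exists_orthogonal_coordinates hn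
  have hnn : ⟪n, n⟫_ℝ = 1 := by rw [real_inner_self_eq_norm_sq, hn, one_pow]
  set h := c - ⟪n, x₀⟫_ℝ with hh
  have hh0 : 0 < h := sub_pos.2 hc
  obtain ⟨z₀, hz₀⟩ := hA' (x₀ - ⟪n, x₀⟫_ℝ • n) (by
    rw [inner_sub_right, inner_smul_right, hnn, mul_one, sub_self])
  set Γ : ℝ → ℝ≥0∞ := fun t => ∫⁻ z, G (x₀ + (t • n + A z)) with hΓ
  have hAm : Measurable A := A.continuous.measurable
  have hinner : ∀ r ∈ Ioi (0 : ℝ), ENNReal.ofReal (h * r ^ (d - 1)) *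
        ∫⁻ y in hyperplane n c, G (x₀ + r • (y - x₀)) ∂(surf d) = ENNReal.ofReal h * Γ (h • r) := by
    intro r hr
    rw [surf_restrict_hyperplane hn hA hA' c, lintegral_map (by fun_prop) (by fun_prop)]
    have e : ∀ z, x₀ + r • (c • n + A z - x₀) = x₀ + ((h • r) • n + A (r • (z - z₀))) := by
      intro z
      rw [map_smul, map_sub, hz₀, hh]
      simp only [smul_eq_mul]
      module
    simp_rw [e]
    rw [lintegral_sub_right_eq_self (fun z => G (x₀ + ((h • r) • n + A (r • z)))) z₀,
      lintegral_comp_smul_eq volume (fun z => G (x₀ + ((h • r) • n + A z))) (ne_of_gt hr),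
      ← mul_assoc, ← ENNReal.ofReal_mul (mul_nonneg hh0.le (pow_nonneg (le_of_lt hr) _))]
    congr 2
    rw [abs_of_pos (inv_pos.2 (pow_pos hr _)), finrank_euclideanSpace, Fintype.card_fin, mul_assoc,
      mul_inv_cancel₀ (pow_pos hr _).ne', mul_one]
  rw [setLIntegral_congr_fun measurableSet_Ioi hinner]
  have hΓm : Measurable Γ := by
    refine Measurable.lintegral_prod_right' (f := fun p : ℝ × E (d - 1) => G (x₀ + (p.1 • n + A p.2))) ?_
    fun_prop
  have hscale : ∫⁻ r in Ioi (0 : ℝ), ENNReal.ofReal h * Γ (h • r) = ∫⁻ t in Ioi (0 : ℝ), Γ t := by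
    rw [lintegral_const_mul _ (by fun_prop), ← lintegral_indicator measurableSet_Ioi,
      ← lintegral_indicator measurableSet_Ioi]
    have e : ∀ r, (Ioi (0 : ℝ)).indicator (fun r => Γ (h • r)) r =
        (Ioi (0 : ℝ)).indicator Γ (h • r) := by
      intro r
      simp only [indicator, mem_Ioi, smul_eq_mul, mul_pos_iff_of_pos_left hh0]
    simp_rw [e]
    rw [lintegral_comp_smul_eq volume _ hh0.ne', ← mul_assoc, ← ENNReal.ofReal_mul hh0.le,
      Module.finrank_self, pow_one, abs_of_pos (inv_pos.2 hh0), mul_inv_cancel₀ hh0.ne',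
      ENNReal.ofReal_one, one_mul]
  rw [hscale]
  have hS : MeasurableSet {x : E d | 0 < ⟪n, x - x₀⟫_ℝ} :=
    (isOpen_lt continuous_const (by fun_prop)).measurableSet
  rw [← lintegral_indicator hS, ← lintegral_add_left_eq_self _ x₀,
    ← hmp.lintegral_comp (by exact (hG.indicator hS).comp (by fun_prop)),
    lintegral_prod _ (by
      refine Measurable.aemeasurable ?_
      exact (hG.indicator hS).comp (by fun_prop)), ← lintegral_indicator measurableSet_Ioi]
  refine lintegral_congr fun t => ?_
  have e : ∀ z, {x : E d | 0 < ⟪n, x - x₀⟫_ℝ}.indicator G (x₀ + (t • n + A z)) =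
      (Ioi (0 : ℝ)).indicator (fun t => G (x₀ + (t • n + A z))) t := by
    intro z
    simp [indicator, inner_add_right, inner_smul_right, hA, hn]
  simp_rw [e]
  by_cases ht : t ∈ Ioi (0 : ℝ)
  · simp [ht, hΓ]
  · simp [ht]

end Cone

end OldroydDG

namespace OldroydDG

section Polytope

variable {d : ℕ}

theorem volume_hyperplane {v : E d} (hv : v ≠ 0) (c : ℝ) : volume (hyperplane v c) = 0 := by
  have hvv : ‖v‖ ^ 2 ≠ 0 := pow_ne_zero _ (norm_ne_zero_iff.2 hv)
  set x₁ : E d := (c / ‖v‖ ^ 2) • v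
  have h1 : hyperplane v c = (fun x => x - x₁) ⁻¹' (LinearMap.ker (innerSL ℝ v).toLinearMap : Set (E d)) := by
    ext x
    simp [hyperplane, x₁, inner_sub_right, inner_smul_right, div_mul_cancel₀ _ hvv, sub_eq_zero]
  rw [h1, (measurePreserving_sub_right volume x₁).measure_preimage
    (Submodule.closed_of_finiteDimensional _).measurableSet.nullMeasurableSet]
  refine Measure.addHaar_submodule _ _ fun h => ?_
  have : v ∈ LinearMap.ker (innerSL ℝ v).toLinearMap := h ▸ Submodule.mem_top
  simp at this
  exact hv this

theorem surf_hyperplane_inter {n v : E d} (hn : ‖n‖ = 1) (hv : ∀ t : ℝ, v ≠ t • n) (c c' : ℝ) :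
    surf d (hyperplane n c ∩ hyperplane v c') = 0 := by
  obtain ⟨A, hA, hA', -⟩ := exists_orthogonal_coordinates hn
  have hAm : Measurable fun z => c • n + A z := by
    have := A.continuous.measurable
    fun_prop
  have hnn : ⟪n, n⟫_ℝ = 1 := by rw [real_inner_self_eq_norm_sq, hn, one_pow]
  rw [inter_comm, ← Measure.restrict_apply (isClosed_hyperplane _ _).measurableSet,
    surf_restrict_hyperplane hn hA hA' c, Measure.map_apply hAm (isClosed_hyperplane _ _).measurableSet]
  set w : E (d - 1) := A.toContinuousLinearMap.adjoint v with hw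
  have hw' : ∀ z, ⟪w, z⟫_ℝ = ⟪v, A z⟫_ℝ := fun z => by
    rw [hw, ContinuousLinearMap.adjoint_inner_left]; rfl
  have hw0 : w ≠ 0 := by
    intro h0
    refine hv ⟪n, v⟫_ℝ ?_
    obtain ⟨z, hz⟩ := hA' (v - ⟪n, v⟫_ℝ • n) (by
      rw [inner_sub_right, inner_smul_right, hnn, mul_one, sub_self])
    have h1 : ⟪v, A z⟫_ℝ = 0 := by rw [← hw', h0, inner_zero_left]
    have h2 : ⟪A z, A z⟫_ℝ = 0 := by
      nth_rewrite 1 [hz]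
      rw [inner_sub_left, inner_smul_left, h1, hA]; simp
    rw [inner_self_eq_zero, hz, sub_eq_zero] at h2
    exact h2
  have h1 : (fun z => c • n + A z) ⁻¹' hyperplane v c' = hyperplane w (c' - c * ⟪v, n⟫_ℝ) := by
    ext z
    simp only [hyperplane, mem_preimage, mem_ofPred_eq, inner_add_right, inner_smul_right, hw']
    constructor <;> intro h <;> linarith
  rw [h1]
  exact volume_hyperplane hw0 _

theorem surf_lt_top_of_subset_hyperplane {n : E d} (hn : ‖n‖ = 1) {c : ℝ} {S : Set (E d)}
    (hS : S ⊆ hyperplane n c) (hb : Bornology.IsBounded S) : surf d S < ⊤ := by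
  obtain ⟨A, hA, hA', -⟩ := exists_orthogonal_coordinates hn
  have hiso : Isometry fun z => c • n + A z := (isometry_add_left (c • n)).comp A.isometry
  obtain ⟨R, hR⟩ := hb.subset_closedBall 0
  have h1 : S ⊆ Metric.closedBall (0 : E d) R ∩ hyperplane n c := subset_inter hR hS
  refine (measure_mono h1).trans_lt ?_
  rw [← Measure.restrict_apply measurableSet_closedBall, surf_restrict_hyperplane hn hA hA' c,
    Measure.map_apply hiso.continuous.measurable measurableSet_closedBall]
  exact (hiso.antilipschitz.isBounded_preimage Metric.isBounded_closedBall).measure_lt_top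

/-- `K` is the bounded solution set, with nonempty interior, of the inequalities `⟪n, x⟫ ≤ c`,
`(n, c) ∈ N`, with unit vectors `n`. -/
structure IsRep (K : Set (E d)) (N : Finset (E d × ℝ)) : Prop where
  norm_eq : ∀ p ∈ N, ‖p.1‖ = 1
  eq : K = {x | ∀ p ∈ N, ⟪p.1, x⟫_ℝ ≤ p.2}
  bounded : Bornology.IsBounded K
  nonempty : (interior K).Nonempty

theorem IsPolytope.exists_isRep {K : Set (E d)} (hK : IsPolytope K) : ∃ N, IsRep K N := by
  classical
  obtain ⟨hne, hb, m, a, b, rfl⟩ := hK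
  refine ⟨(Finset.univ.filter fun i => a i ≠ 0).image fun i => (‖a i‖⁻¹ • a i, ‖a i‖⁻¹ * b i),
    ?_, ?_, hb, hne⟩
  · intro p hp
    obtain ⟨i, hi, rfl⟩ := Finset.mem_image.1 hp
    have := (Finset.mem_filter.1 hi).2
    simp [norm_smul, inv_mul_cancel₀ (norm_ne_zero_iff.2 this)]
  · obtain ⟨x₁, hx₁⟩ := hne
    have hx₁ := interior_subset hx₁
    ext x
    simp only [mem_ofPred_eq, Finset.forall_mem_image, Finset.mem_filter, Finset.mem_univ, true_and]
    constructor
    · intro h i hi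
      rw [inner_smul_left]
      exact mul_le_mul_of_nonneg_left (h i) (inv_nonneg.2 (norm_nonneg _))
    · intro h i
      by_cases hi : a i = 0
      · have := hx₁ i
        rw [hi, inner_zero_left] at this ⊢
        exact this
      · have := h hi
        rw [inner_smul_left] at this
        exact le_of_mul_le_mul_left this (inv_pos.2 (norm_pos_iff.2 hi))

variable {K : Set (E d)} {N : Finset (E d × ℝ)}

namespace IsRep

theorem mem_iff (h : IsRep K N) {x : E d} : x ∈ K ↔ ∀ p ∈ N, ⟪p.1, x⟫_ℝ ≤ p.2 := by
  rw [h.eq]; rfl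

theorem isClosed (h : IsRep K N) : IsClosed K := by
  have : K = ⋂ p ∈ N, {x | ⟪p.1, x⟫_ℝ ≤ p.2} := by
    ext x; simp [h.mem_iff]
  rw [this]
  exact isClosed_biInter fun p _ => isClosed_le (by fun_prop) continuous_const

theorem isCompact (h : IsRep K N) : IsCompact K :=
  Metric.isCompact_of_isClosed_isBounded h.isClosed h.bounded

theorem convex (h : IsRep K N) : Convex ℝ K := by
  have : K = ⋂ p ∈ N, {x | ⟪p.1, x⟫_ℝ ≤ p.2} := by
    ext x; simp [h.mem_iff]
  rw [this]
  exact convex_iInter₂ fun p _ => convex_halfSpace_le (innerSL ℝ p.1).isLinear _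

theorem mem_interior_iff (h : IsRep K N) {x : E d} :
    x ∈ interior K ↔ ∀ p ∈ N, ⟪p.1, x⟫_ℝ < p.2 := by
  constructor
  · intro hx p hp
    by_contra hlt
    have hnn : ⟪p.1, p.1⟫_ℝ = 1 := by rw [real_inner_self_eq_norm_sq, h.norm_eq p hp, one_pow]
    have h1 : Tendsto (fun t : ℝ => x + t • p.1) (𝓝[>] 0) (𝓝 x) := by
      have : Continuous fun t : ℝ => x + t • p.1 := by fun_prop
      have := this.tendsto 0
      rw [zero_smul, add_zero] at this
      exact this.mono_left nhdsWithin_le_nhds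
    obtain ⟨t, ht, ht0⟩ := ((h1.eventually (mem_interior_iff_mem_nhds.1 hx)).and
      self_mem_nhdsWithin).exists
    have h2 := h.mem_iff.1 ht p hp
    rw [inner_add_right, inner_smul_right, hnn] at h2
    have ht0 : 0 < t := ht0
    linarith
  · intro hx
    have ho : IsOpen {x | ∀ p ∈ N, ⟪p.1, x⟫_ℝ < p.2} := by
      have : {x | ∀ p ∈ N, ⟪p.1, x⟫_ℝ < p.2} = ⋂ p ∈ N, {x | ⟪p.1, x⟫_ℝ < p.2} := by ext; simp
      rw [this]
      exact isOpen_biInter_finset fun p _ => isOpen_lt (by fun_prop) continuous_const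
    exact interior_maximal (fun y hy => h.mem_iff.2 fun p hp => (hy p hp).le) ho hx

theorem frontier_eq (h : IsRep K N) : frontier K = ⋃ p ∈ N, K ∩ hyperplane p.1 p.2 := by
  ext x
  rw [h.isClosed.frontier_eq, Set.mem_sdiff, h.mem_interior_iff]
  simp only [mem_iUnion, mem_inter_iff, exists_prop, hyperplane, mem_ofPred_eq]
  constructor
  · rintro ⟨hx, hx'⟩
    push Not at hx'
    obtain ⟨p, hp, hpx⟩ := hx'
    exact ⟨p, hp, hx, le_antisymm (h.mem_iff.1 hx p hp) hpx⟩
  · rintro ⟨p, hp, hx, hpx⟩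
    exact ⟨hx, fun h' => (h' p hp).ne hpx⟩

theorem surf_facet_lt_top (h : IsRep K N) {p : E d × ℝ} (hp : p ∈ N) :
    surf d (K ∩ hyperplane p.1 p.2) < ⊤ :=
  surf_lt_top_of_subset_hyperplane (h.norm_eq p hp) inter_subset_right
    (h.bounded.subset inter_subset_left)

theorem surf_frontier_lt_top (h : IsRep K N) : surf d (frontier K) < ⊤ := by
  rw [h.frontier_eq]
  exact (measure_biUnion_finset_le N _).trans_lt
    (ENNReal.sum_lt_top.2 fun p hp => h.surf_facet_lt_top hp)

/-- Two different facets meet in a set of surface measure zero. -/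
theorem surf_facet_inter (h : IsRep K N) {p q : E d × ℝ} (hp : p ∈ N) (hq : q ∈ N) (hpq : p ≠ q) :
    surf d ((K ∩ hyperplane p.1 p.2) ∩ (K ∩ hyperplane q.1 q.2)) = 0 := by
  by_cases hv : ∀ t : ℝ, q.1 ≠ t • p.1
  · refine measure_mono_null ?_ (surf_hyperplane_inter (h.norm_eq p hp) hv p.2 q.2)
    exact fun x hx => ⟨hx.1.2, hx.2.2⟩
  · push Not at hv
    obtain ⟨t, ht⟩ := hv
    obtain ⟨x₀, hx₀⟩ := h.nonempty
    rw [h.mem_interior_iff] at hx₀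
    convert measure_empty (μ := surf d)
    rw [eq_empty_iff_forall_notMem]
    rintro x ⟨⟨-, hx1⟩, -, hx2⟩
    have hx1 : ⟪p.1, x⟫_ℝ = p.2 := hx1
    have hx2 : ⟪q.1, x⟫_ℝ = q.2 := hx2
    have h1 := hx₀ p hp
    have h2 := hx₀ q hq
    have ht1 : |t| = 1 := by
      have := h.norm_eq q hq
      rwa [ht, norm_smul, h.norm_eq p hp, mul_one] at this
    rw [ht, inner_smul_left] at h2 hx2
    simp only [conj_trivial] at h2 hx2
    rcases (abs_eq one_pos.le).1 ht1 with rfl | rfl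
    · refine hpq (Prod.ext (by simp [ht]) ?_)
      linarith
    · linarith

end IsRep

end Polytope

end OldroydDG

namespace OldroydDG

section Cone

variable {d : ℕ} {K : Set (E d)} {N : Finset (E d × ℝ)} {x₀ : E d} {p : E d × ℝ}

/-- The cone with apex `x₀` over the facet of `K` with normal `p.1` and offset `p.2`. -/
def facetCone (K : Set (E d)) (x₀ : E d) (p : E d × ℝ) : Set (E d) :=
  {x | 0 < ⟪p.1, x - x₀⟫_ℝ ∧ ⟪p.1, x - x₀⟫_ℝ ≤ p.2 - ⟪p.1, x₀⟫_ℝ ∧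
    x₀ + ((p.2 - ⟪p.1, x₀⟫_ℝ) / ⟪p.1, x - x₀⟫_ℝ) • (x - x₀) ∈ K}

theorem measurableSet_facetCone (hK : IsClosed K) : MeasurableSet (facetCone K x₀ p) := by
  have h1 : Measurable fun x : E d => ⟪p.1, x - x₀⟫_ℝ := by fun_prop
  refine (measurableSet_lt measurable_const h1).inter ((measurableSet_le h1 measurable_const).inter ?_)
  exact hK.measurableSet.preimage (f := fun x => x₀ + ((p.2 - ⟪p.1, x₀⟫_ℝ) / ⟪p.1, x - x₀⟫_ℝ) •
    (x - x₀)) (by fun_prop)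

theorem mem_facetCone_iff (hc : ⟪p.1, x₀⟫_ℝ < p.2) {r : ℝ} (hr : 0 < r) {y : E d}
    (hy : y ∈ hyperplane p.1 p.2) :
    x₀ + r • (y - x₀) ∈ facetCone K x₀ p ↔ r ≤ 1 ∧ y ∈ K := by
  have hy' : ⟪p.1, y⟫_ℝ = p.2 := hy
  set h := p.2 - ⟪p.1, x₀⟫_ℝ with hh
  have hh0 : 0 < h := sub_pos.2 hc
  have e : ⟪p.1, x₀ + r • (y - x₀) - x₀⟫_ℝ = r * h := by
    rw [add_sub_cancel_left, inner_smul_right, inner_sub_right, hy']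
  simp only [facetCone, mem_ofPred_eq, e, ← hh]
  rw [add_sub_cancel_left]
  have e2 : (h / (r * h)) • r • (y - x₀) = y - x₀ := by
    rw [smul_smul, show h / (r * h) * r = 1 by field_simp, one_smul]
  rw [e2, add_sub_cancel]
  constructor
  · rintro ⟨-, h2, h3⟩
    exact ⟨by nlinarith, h3⟩
  · rintro ⟨h2, h3⟩
    exact ⟨by positivity, by nlinarith, h3⟩

theorem lintegral_facetCone (hK : IsClosed K) (hn : ‖p.1‖ = 1) (hc : ⟪p.1, x₀⟫_ℝ < p.2)
    {G : E d → ℝ≥0∞} (hG : Measurable G) :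
    ∫⁻ x in facetCone K x₀ p, G x = ∫⁻ r in Ioc (0 : ℝ) 1,
      ENNReal.ofReal ((p.2 - ⟪p.1, x₀⟫_ℝ) * r ^ (d - 1)) *
        ∫⁻ y in K ∩ hyperplane p.1 p.2, G (x₀ + r • (y - x₀)) ∂(surf d) := by
  have hm : MeasurableSet (facetCone K x₀ p) := measurableSet_facetCone hK
  have hsub : facetCone K x₀ p ⊆ {x | 0 < ⟪p.1, x - x₀⟫_ℝ} := fun x hx => hx.1
  have h1 := lintegral_halfSpace_eq hn hc (hG.indicator hm)
  rw [setLIntegral_indicator hm, inter_eq_self_of_subset_left hsub] at h1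
  rw [h1, ← Ioc_union_Ioi_eq_Ioi (zero_le_one (α := ℝ)),
    lintegral_union measurableSet_Ioi Ioc_disjoint_Ioi_same]
  have hH : MeasurableSet (hyperplane p.1 p.2) := (isClosed_hyperplane _ _).measurableSet
  have h2 : ∫⁻ r in Ioi (1 : ℝ), ENNReal.ofReal ((p.2 - ⟪p.1, x₀⟫_ℝ) * r ^ (d - 1)) *
      ∫⁻ y in hyperplane p.1 p.2, (facetCone K x₀ p).indicator G (x₀ + r • (y - x₀)) ∂(surf d)
      = 0 := by
    rw [setLIntegral_congr_fun (g := fun _ => 0) measurableSet_Ioi, lintegral_zero]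
    intro r hr
    have hr : 1 < r := hr
    dsimp only
    rw [setLIntegral_congr_fun (g := fun _ => 0) hH]
    · simp
    · intro y hy
      refine indicator_of_notMem (fun hmem => ?_) _
      rw [mem_facetCone_iff hc (by linarith) hy] at hmem
      linarith [hmem.1]
  rw [h2, add_zero]
  refine setLIntegral_congr_fun measurableSet_Ioc fun r hr => ?_
  congr 1
  rw [← setLIntegral_indicator hK.measurableSet]
  refine setLIntegral_congr_fun hH fun y hy => ?_
  have hiff := mem_facetCone_iff (K := K) hc hr.1 hy
  by_cases hyK : y ∈ K
  · rw [indicator_of_mem (hiff.2 ⟨hr.2, hyK⟩), indicator_of_mem hyK]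
  · rw [indicator_of_notMem (fun h => hyK (hiff.1 h).2), indicator_of_notMem hyK]

theorem IsRep.isFiniteMeasure_facet (h : IsRep K N) (hp : p ∈ N) :
    IsFiniteMeasure ((surf d).restrict (K ∩ hyperplane p.1 p.2)) :=
  ⟨by rw [Measure.restrict_apply_univ]; exact h.surf_facet_lt_top hp⟩

theorem IsRep.volume_restrict_facetCone (h : IsRep K N) (hp : p ∈ N) (hc : ⟪p.1, x₀⟫_ℝ < p.2) :
    volume.restrict (facetCone K x₀ p) = Measure.map (fun s : ℝ × E d => x₀ + s.1 • (s.2 - x₀))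
      (((volume.restrict (Ioc (0 : ℝ) 1)).withDensity
        fun r => ENNReal.ofReal ((p.2 - ⟪p.1, x₀⟫_ℝ) * r ^ (d - 1))).prod
          ((surf d).restrict (K ∩ hyperplane p.1 p.2))) := by
  have := h.isFiniteMeasure_facet hp
  refine Measure.ext_of_lintegral _ fun G hG => ?_
  have hΦ : Measurable fun s : ℝ × E d => x₀ + s.1 • (s.2 - x₀) := by fun_prop
  have hGΦ : Measurable fun s : ℝ × E d => G (x₀ + s.1 • (s.2 - x₀)) := hG.comp hΦ
  rw [lintegral_facetCone h.isClosed (h.norm_eq p hp) hc hG, lintegral_map hG hΦ,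
    lintegral_prod _ hGΦ.aemeasurable,
    lintegral_withDensity_eq_lintegral_mul _ (by fun_prop) hGΦ.lintegral_prod_right']
  rfl

theorem IsRep.facetCone_subset (h : IsRep K N) (hx₀ : x₀ ∈ K) : facetCone K x₀ p ⊆ K := by
  rintro x ⟨h1, h2, h3⟩
  set a := ⟪p.1, x - x₀⟫_ℝ
  set b := p.2 - ⟪p.1, x₀⟫_ℝ
  have hb : 0 < b := h1.trans_le h2
  have h4 := h.convex hx₀ h3 (sub_nonneg.2 ((div_le_one hb).2 h2)) (by positivity : 0 ≤ a / b)
    (by ring)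
  have e : (1 - a / b) • x₀ + (a / b) • (x₀ + (b / a) • (x - x₀)) = x := by
    rw [smul_add, smul_smul, show a / b * (b / a) = 1 by field_simp]
    module
  rwa [e] at h4

theorem IsRep.setIntegral_facetCone {V : Type*} [NormedAddCommGroup V] [NormedSpace ℝ V]
    (h : IsRep K N) (hp : p ∈ N) (hx₀ : x₀ ∈ interior K)
    {g : E d → V} (hg : Continuous g) :
    ∫ x in facetCone K x₀ p, g x = ∫ y in K ∩ hyperplane p.1 p.2, (∫ r in (0 : ℝ)..1,
      ((p.2 - ⟪p.1, x₀⟫_ℝ) * r ^ (d - 1)) • g (x₀ + r • (y - x₀))) ∂(surf d) := by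
  have := h.isFiniteMeasure_facet hp
  have hc := h.mem_interior_iff.1 hx₀ p hp
  have hint : IntegrableOn g (facetCone K x₀ p) volume :=
    (hg.continuousOn.integrableOn_compact h.isCompact).mono_set
      (h.facetCone_subset (interior_subset hx₀))
  have hΦ : Measurable fun s : ℝ × E d => x₀ + s.1 • (s.2 - x₀) := by fun_prop
  rw [IntegrableOn, h.volume_restrict_facetCone hp hc] at hint
  rw [h.volume_restrict_facetCone hp hc, integral_map hΦ.aemeasurable hint.1]
  rw [integrable_map_measure hint.1 hΦ.aemeasurable] at hint
  rw [integral_prod_symm (fun s : ℝ × E d => g (x₀ + s.1 • (s.2 - x₀))) hint]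
  refine integral_congr_ae (Eventually.of_forall fun y => ?_)
  simp only
  rw [integral_withDensity_eq_integral_toReal_smul (by fun_prop)
    (Eventually.of_forall fun _ => ENNReal.ofReal_lt_top),
    intervalIntegral.integral_of_le zero_le_one]
  refine setIntegral_congr_fun measurableSet_Ioc fun r hr => ?_
  rw [ENNReal.toReal_ofReal (mul_nonneg (sub_pos.2 hc).le (pow_nonneg hr.1.le _))]

/-- The radial divergence `div (f (x - x₀)) = d f + Df (x - x₀)`. -/
noncomputable def radialDiv {V : Type*} [NormedAddCommGroup V] [NormedSpace ℝ V] (x₀ : E d)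
    (f : E d → V) (x : E d) : V :=
  (d : ℝ) • f x + fderiv ℝ f x (x - x₀)

theorem continuous_radialDiv {V : Type*} [NormedAddCommGroup V] [NormedSpace ℝ V] {f : E d → V}
    (hf : ContDiff ℝ 1 f) : Continuous (radialDiv x₀ f) := by
  unfold radialDiv
  have := hf.continuous
  have := hf.continuous_fderiv (by simp)
  fun_prop

theorem integral_radialDiv {V : Type*} [NormedAddCommGroup V] [NormedSpace ℝ V] [CompleteSpace V]
    (hd : 0 < d) {f : E d → V} (hf : ContDiff ℝ 1 f) (b : ℝ) (y : E d) :
    ∫ r in (0 : ℝ)..1, (b * r ^ (d - 1)) • radialDiv x₀ f (x₀ + r • (y - x₀)) = b • f y := by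
  have hderiv : ∀ r ∈ uIcc (0 : ℝ) 1, HasDerivAt (fun r : ℝ => (b * r ^ d) • f (x₀ + r • (y - x₀)))
      ((b * r ^ (d - 1)) • radialDiv x₀ f (x₀ + r • (y - x₀))) r := by
    intro r _
    have h1 : HasDerivAt (fun r : ℝ => x₀ + r • (y - x₀)) (y - x₀) r := by
      simpa using ((hasDerivAt_id r).smul_const (y - x₀)).const_add x₀
    have h2 := ((hf.differentiable (by simp) (x₀ + r • (y - x₀))).hasFDerivAt).comp_hasDerivAt r h1
    have h3 : HasDerivAt (fun r : ℝ => b * r ^ d) (b * (d * r ^ (d - 1))) r :=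
      (hasDerivAt_pow d r).const_mul b
    have h4 : HasDerivAt (fun r : ℝ => (b * r ^ d) • f (x₀ + r • (y - x₀))) _ r := h3.smul h2
    refine h4.congr_deriv ?_
    simp only [radialDiv, add_sub_cancel_left, map_smul]
    rw [smul_add, smul_smul, smul_smul, add_comm]
    congr 2
    · rw [mul_assoc, mul_comm (r ^ (d - 1))]
    · rw [mul_assoc, ← pow_succ, Nat.sub_add_cancel hd]
  rw [intervalIntegral.integral_eq_sub_of_hasDerivAt hderiv]
  · simp [zero_pow hd.ne']
  · refine Continuous.intervalIntegrable ?_ _ _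
    have := continuous_radialDiv (x₀ := x₀) hf
    fun_prop

theorem IsRep.setIntegral_facet {V : Type*} [NormedAddCommGroup V] [NormedSpace ℝ V]
    [CompleteSpace V] (hd : 0 < d) (h : IsRep K N) (hp : p ∈ N) (hx₀ : x₀ ∈ interior K)
    {f : E d → V} (hf : ContDiff ℝ 1 f) :
    ∫ x in facetCone K x₀ p, radialDiv x₀ f x =
      (p.2 - ⟪p.1, x₀⟫_ℝ) • ∫ y in K ∩ hyperplane p.1 p.2, f y ∂(surf d) := by
  rw [h.setIntegral_facetCone hp hx₀ (continuous_radialDiv hf), ← integral_smul]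
  simp_rw [integral_radialDiv hd hf]

theorem IsRep.lintegral_facet_le {V : Type*} [NormedAddCommGroup V] [NormedSpace ℝ V]
    [CompleteSpace V] (hd : 0 < d) (h : IsRep K N) (hp : p ∈ N) (hx₀ : x₀ ∈ interior K)
    {f : E d → V} (hf : ContDiff ℝ 1 f) :
    ENNReal.ofReal (p.2 - ⟪p.1, x₀⟫_ℝ) * ∫⁻ y in K ∩ hyperplane p.1 p.2, ‖f y‖ₑ ∂(surf d) ≤
      ∫⁻ x in facetCone K x₀ p, ‖radialDiv x₀ f x‖ₑ := by
  have := h.isFiniteMeasure_facet hp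
  have hc := h.mem_interior_iff.1 hx₀ p hp
  have hb : 0 < p.2 - ⟪p.1, x₀⟫_ℝ := sub_pos.2 hc
  have hcont := continuous_radialDiv (x₀ := x₀) hf
  have hΦ : Measurable fun s : ℝ × E d => x₀ + s.1 • (s.2 - x₀) := by fun_prop
  have hG : Measurable fun x => ‖radialDiv x₀ f x‖ₑ := hcont.enorm.measurable
  have hGΦ : Measurable fun s : ℝ × E d => ‖radialDiv x₀ f (x₀ + s.1 • (s.2 - x₀))‖ₑ := hG.comp hΦ
  rw [h.volume_restrict_facetCone hp hc, lintegral_map hG hΦ, lintegral_prod_symm _ hGΦ.aemeasurable,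
    ← lintegral_const_mul' _ _ ENNReal.ofReal_ne_top]
  refine lintegral_mono fun y => ?_
  have hm : Measurable fun r : ℝ => ‖radialDiv x₀ f (x₀ + r • (y - x₀))‖ₑ :=
    hG.comp (g := fun x => ‖radialDiv x₀ f x‖ₑ) (f := fun r : ℝ => x₀ + r • (y - x₀)) (by fun_prop)
  have hR : ∫⁻ r, ‖radialDiv x₀ f (x₀ + r • (y - x₀))‖ₑ ∂((volume.restrict (Ioc (0 : ℝ) 1)).withDensity
      fun r => ENNReal.ofReal ((p.2 - ⟪p.1, x₀⟫_ℝ) * r ^ (d - 1))) =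
      ∫⁻ r in Ioc (0 : ℝ) 1, ENNReal.ofReal ((p.2 - ⟪p.1, x₀⟫_ℝ) * r ^ (d - 1)) *
        ‖radialDiv x₀ f (x₀ + r • (y - x₀))‖ₑ := by
    rw [lintegral_withDensity_eq_lintegral_mul _ (by fun_prop) hm]
    rfl
  refine le_trans ?_ hR.ge
  rw [← Real.enorm_of_nonneg hb.le, ← enorm_smul,
    ← integral_radialDiv (x₀ := x₀) hd hf (p.2 - ⟪p.1, x₀⟫_ℝ) y,
    intervalIntegral.integral_of_le zero_le_one]
  refine (enorm_integral_le_lintegral_enorm _).trans (le_of_eq ?_)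
  refine setLIntegral_congr_fun measurableSet_Ioc fun r hr => ?_
  rw [enorm_smul, Real.enorm_of_nonneg (mul_nonneg hb.le (pow_nonneg hr.1.le _))]

end Cone

end OldroydDG

namespace OldroydDG

theorem restrict_biUnion_finset_of_aedisjoint {X ι : Type*} [MeasurableSpace X] {μ : Measure X}
    {s : Finset ι} {t : ι → Set X} (hd : Set.Pairwise (↑s) (Function.onFun (AEDisjoint μ) t))
    (hm : ∀ i ∈ s, MeasurableSet (t i)) :
    μ.restrict (⋃ i ∈ s, t i) = ∑ i ∈ s, μ.restrict (t i) := by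
  refine Measure.ext_of_lintegral _ fun G _ => ?_
  rw [lintegral_biUnion_finset₀ hd (fun i hi => (hm i hi).nullMeasurableSet),
    lintegral_finsetSum_measure]

theorem setIntegral_biUnion_finset_of_aedisjoint {X ι V : Type*} [MeasurableSpace X]
    [NormedAddCommGroup V] [NormedSpace ℝ V] {μ : Measure X} {s : Finset ι} {t : ι → Set X}
    (hd : Set.Pairwise (↑s) (Function.onFun (AEDisjoint μ) t)) (hm : ∀ i ∈ s, MeasurableSet (t i))
    {f : X → V} (hf : ∀ i ∈ s, IntegrableOn f (t i) μ) :
    ∫ x in ⋃ i ∈ s, t i, f x ∂μ = ∑ i ∈ s, ∫ x in t i, f x ∂μ := by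
  rw [restrict_biUnion_finset_of_aedisjoint hd hm, integral_finsetSum_measure hf]

section Divergence

variable {d : ℕ} {K : Set (E d)} {N : Finset (E d × ℝ)} {x₀ : E d}
  {V : Type*} [NormedAddCommGroup V] [NormedSpace ℝ V]

/-- `ν` is an outward unit normal vector of the convex body `K` at `x`. -/
def IsUnitNormal (K : Set (E d)) (x ν : E d) : Prop :=
  ‖ν‖ = 1 ∧ ∀ y ∈ K, ⟪ν, y - x⟫_ℝ ≤ 0

theorem isUnitNormal_normal {x : E d} (h : ∃ ν, IsUnitNormal K x ν) :
    IsUnitNormal K x (normal K x) := by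
  have h' : ∃ ν : E d, ‖ν‖ = 1 ∧ ∀ y ∈ K, ⟪ν, y - x⟫_ℝ ≤ 0 := h
  unfold normal
  rw [dif_pos h']
  exact h'.choose_spec

namespace IsRep

theorem pairwise_aedisjoint_facet (h : IsRep K N) : Set.Pairwise (↑N)
    (Function.onFun (AEDisjoint (surf d)) fun p : E d × ℝ => K ∩ hyperplane p.1 p.2) :=
  fun _ hp _ hq hpq => h.surf_facet_inter hp hq hpq

theorem measurableSet_facet (h : IsRep K N) (p : E d × ℝ) :
    MeasurableSet (K ∩ hyperplane p.1 p.2) :=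
  (h.isClosed.inter (isClosed_hyperplane _ _)).measurableSet

theorem surf_restrict_frontier (h : IsRep K N) :
    (surf d).restrict (frontier K) = ∑ p ∈ N, (surf d).restrict (K ∩ hyperplane p.1 p.2) := by
  rw [h.frontier_eq]
  exact restrict_biUnion_finset_of_aedisjoint h.pairwise_aedisjoint_facet
    fun p _ => h.measurableSet_facet p

theorem pairwise_aedisjoint_facetCone (h : IsRep K N) (hx₀ : x₀ ∈ interior K) : Set.Pairwise (↑N)
    (Function.onFun (AEDisjoint volume) (facetCone K x₀)) := by
  intro p hp q hq hpq
  have hp0 := sub_pos.2 (h.mem_interior_iff.1 hx₀ p hp)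
  have hq0 := sub_pos.2 (h.mem_interior_iff.1 hx₀ q hq)
  set a := p.2 - ⟪p.1, x₀⟫_ℝ with ha
  set b := q.2 - ⟪q.1, x₀⟫_ℝ with hb
  set v : E d := b • p.1 - a • q.1 with hv
  have hv0 : v ≠ 0 := by
    intro h0
    have h1 : b • p.1 = a • q.1 := sub_eq_zero.1 h0
    have h2 := congrArg norm h1
    rw [norm_smul, norm_smul, h.norm_eq p hp, h.norm_eq q hq, Real.norm_of_nonneg hp0.le,
      Real.norm_of_nonneg hq0.le, mul_one, mul_one] at h2
    rw [h2] at h1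
    have h3 : p.1 = q.1 := smul_right_injective _ hp0.ne' h1
    refine hpq (Prod.ext h3 ?_)
    rw [ha, hb, h3] at h2
    linarith
  refine measure_mono_null ?_ (volume_hyperplane hv0 ⟪v, x₀⟫_ℝ)
  have key : ∀ p' ∈ N, ∀ q' ∈ N, ∀ x, x ∈ facetCone K x₀ p' → 0 < ⟪q'.1, x - x₀⟫_ℝ →
      (p'.2 - ⟪p'.1, x₀⟫_ℝ) * ⟪q'.1, x - x₀⟫_ℝ ≤ (q'.2 - ⟪q'.1, x₀⟫_ℝ) * ⟪p'.1, x - x₀⟫_ℝ := by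
    intro p' _ q' hq' x hx _
    have h1 := h.mem_iff.1 hx.2.2 q' hq'
    rw [inner_add_right, inner_smul_right] at h1
    have h2 : (p'.2 - ⟪p'.1, x₀⟫_ℝ) / ⟪p'.1, x - x₀⟫_ℝ * ⟪q'.1, x - x₀⟫_ℝ ≤
        q'.2 - ⟪q'.1, x₀⟫_ℝ := by linarith
    rwa [div_mul_eq_mul_div, div_le_iff₀ hx.1] at h2
  rintro x ⟨hx1, hx2⟩
  have h1 := key p hp q hq x hx1 hx2.1
  have h2 := key q hq p hp x hx2 hx1.1
  have h3 : ⟪v, x - x₀⟫_ℝ = 0 := by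
    rw [hv, inner_sub_left, inner_smul_left, inner_smul_left]
    simp only [conj_trivial]
    linarith
  rw [inner_sub_right, sub_eq_zero] at h3
  exact h3

theorem exists_inner_pos (h : IsRep K N) (hx₀ : x₀ ∈ K) {v : E d} (hv : v ≠ 0) :
    ∃ p ∈ N, 0 < ⟪p.1, v⟫_ℝ := by
  by_contra! hcon
  obtain ⟨R, hR⟩ := h.bounded.subset_closedBall x₀
  have hv' : 0 < ‖v‖ := norm_pos_iff.2 hv
  have hmem : x₀ + ((|R| + 1) / ‖v‖) • v ∈ K := by
    rw [h.mem_iff]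
    intro p hp
    rw [inner_add_right, inner_smul_right]
    have h1 := h.mem_iff.1 hx₀ p hp
    have h2 : (|R| + 1) / ‖v‖ * ⟪p.1, v⟫_ℝ ≤ 0 :=
      mul_nonpos_of_nonneg_of_nonpos (by positivity) (hcon p hp)
    linarith
  have h3 := hR hmem
  rw [mem_closedBall_iff_norm, add_sub_cancel_left, norm_smul, norm_div, norm_norm,
    div_mul_cancel₀ _ hv'.ne', Real.norm_of_nonneg (by positivity)] at h3
  linarith [le_abs_self R]

theorem ae_eq_biUnion_facetCone (h : IsRep K N) (hd : 0 < d) (hx₀ : x₀ ∈ interior K) :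
    (⋃ p ∈ N, facetCone K x₀ p : Set (E d)) =ᵐ[volume] K := by
  have hne : Nonempty (Fin d) := ⟨⟨0, hd⟩⟩
  have hx₀K := interior_subset hx₀
  have h1 : (⋃ p ∈ N, facetCone K x₀ p) ⊆ K := iUnion₂_subset fun p _ => h.facetCone_subset hx₀K
  have h2 : K \ {x₀} ⊆ ⋃ p ∈ N, facetCone K x₀ p := by
    rintro x ⟨hxK, hx⟩
    obtain ⟨p₁, hp₁, hpos⟩ := h.exists_inner_pos hx₀K (sub_ne_zero.2 hx)
    obtain ⟨p, hp, hmax⟩ := N.exists_max_image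
      (fun p => ⟪p.1, x - x₀⟫_ℝ / (p.2 - ⟪p.1, x₀⟫_ℝ)) ⟨p₁, hp₁⟩
    have hb : ∀ q ∈ N, 0 < q.2 - ⟪q.1, x₀⟫_ℝ := fun q hq =>
      sub_pos.2 (h.mem_interior_iff.1 hx₀ q hq)
    have ha : 0 < ⟪p.1, x - x₀⟫_ℝ := by
      have h3 := (div_pos hpos (hb p₁ hp₁)).trans_le (hmax p₁ hp₁)
      exact (div_pos_iff_of_pos_right (hb p hp)).1 h3
    refine mem_iUnion₂.2 ⟨p, hp, ha, ?_, ?_⟩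
    · have := h.mem_iff.1 hxK p hp
      rw [inner_sub_right]
      linarith
    · rw [h.mem_iff]
      intro q hq
      have h3 := hmax q hq
      rw [inner_add_right, inner_smul_right]
      rw [div_le_div_iff₀ (hb q hq) (hb p hp)] at h3
      have h4 : (p.2 - ⟪p.1, x₀⟫_ℝ) / ⟪p.1, x - x₀⟫_ℝ * ⟪q.1, x - x₀⟫_ℝ ≤ q.2 - ⟪q.1, x₀⟫_ℝ := by
        rw [div_mul_eq_mul_div, div_le_iff₀ ha]
        linarith
      linarith
  refine ae_eq_set.2 ⟨by rw [sdiff_eq_empty.2 h1, measure_empty], ?_⟩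
  refine measure_mono_null (t := {x₀}) ?_ (measure_singleton x₀)
  intro x hx
  by_contra hx'
  exact hx.2 (h2 ⟨hx.1, hx'⟩)

theorem setIntegral_radialDiv [CompleteSpace V] (h : IsRep K N) (hd : 0 < d) (hx₀ : x₀ ∈ interior K)
    {f : E d → V} (hf : ContDiff ℝ 1 f) :
    ∫ x in K, radialDiv x₀ f x =
      ∑ p ∈ N, (p.2 - ⟪p.1, x₀⟫_ℝ) • ∫ y in K ∩ hyperplane p.1 p.2, f y ∂(surf d) := by
  rw [← Measure.restrict_congr_set (h.ae_eq_biUnion_facetCone hd hx₀),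
    setIntegral_biUnion_finset_of_aedisjoint (h.pairwise_aedisjoint_facetCone hx₀)
      (fun p _ => measurableSet_facetCone h.isClosed)]
  · exact Finset.sum_congr rfl fun p hp => h.setIntegral_facet hd hp hx₀ hf
  · exact fun p _ => ((continuous_radialDiv hf).continuousOn.integrableOn_compact h.isCompact).mono_set
      (h.facetCone_subset (interior_subset hx₀))

/-- The divergence theorem on a polytope. -/
theorem setIntegral_fderiv [CompleteSpace V] (h : IsRep K N) (hd : 0 < d) {f : E d → V}
    (hf : ContDiff ℝ 1 f) (v : E d) :
    ∫ x in K, fderiv ℝ f x v =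
      ∑ p ∈ N, ⟪p.1, v⟫_ℝ • ∫ y in K ∩ hyperplane p.1 p.2, f y ∂(surf d) := by
  obtain ⟨x₀, hx₀⟩ := h.nonempty
  have h1 : Tendsto (fun t : ℝ => x₀ + t • v) (𝓝[>] 0) (𝓝 x₀) := by
    have : Continuous fun t : ℝ => x₀ + t • v := by fun_prop
    have := this.tendsto 0
    rw [zero_smul, add_zero] at this
    exact this.mono_left nhdsWithin_le_nhds
  obtain ⟨t, ht, ht0⟩ := ((h1.eventually (isOpen_interior.mem_nhds hx₀)).and
    self_mem_nhdsWithin).exists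
  have ht0 : t ≠ 0 := ne_of_gt ht0
  have e₀ := h.setIntegral_radialDiv hd hx₀ hf
  have e₁ := h.setIntegral_radialDiv hd ht hf
  have hint : ∀ x₁, IntegrableOn (radialDiv x₁ f) K volume := fun x₁ =>
    (continuous_radialDiv hf).continuousOn.integrableOn_compact h.isCompact
  have e₂ := congrArg₂ (fun a b : V => a - b) e₀ e₁
  rw [← integral_sub (hint _) (hint _), ← Finset.sum_sub_distrib] at e₂
  have e₃ : ∀ x, radialDiv x₀ f x - radialDiv (x₀ + t • v) f x = t • fderiv ℝ f x v := by
    intro x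
    simp only [radialDiv]
    rw [add_sub_add_left_eq_sub, ← map_sub, ← map_smul]
    congr 1
    abel
  simp_rw [e₃, ← sub_smul] at e₂
  rw [integral_smul] at e₂
  have e₄ : ∀ p : E d × ℝ, p.2 - ⟪p.1, x₀⟫_ℝ - (p.2 - ⟪p.1, x₀ + t • v⟫_ℝ) = t * ⟪p.1, v⟫_ℝ := by
    intro p
    rw [inner_add_right, inner_smul_right]
    ring
  simp_rw [e₄, mul_smul, ← Finset.smul_sum] at e₂
  exact smul_right_injective _ ht0 e₂

theorem lintegral_frontier (h : IsRep K N) (G : E d → ℝ≥0∞) :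
    ∫⁻ y in frontier K, G y ∂(surf d) =
      ∑ p ∈ N, ∫⁻ y in K ∩ hyperplane p.1 p.2, G y ∂(surf d) := by
  rw [h.surf_restrict_frontier, lintegral_finsetSum_measure]

variable (V) in
/-- The trace inequality on a polytope. -/
theorem exists_lintegral_frontier_le [CompleteSpace V] (h : IsRep K N) (hd : 0 < d) :
    ∃ C : ℝ≥0∞, C ≠ ⊤ ∧ ∀ f : E d → V, ContDiff ℝ 1 f →
      ∫⁻ y in frontier K, ‖f y‖ₑ ∂(surf d) ≤
        C * ((∫⁻ x in K, ‖f x‖ₑ) + ∫⁻ x in K, ‖fderiv ℝ f x‖ₑ) := by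
  obtain ⟨x₀, hx₀⟩ := h.nonempty
  obtain ⟨R, hR⟩ := h.bounded.subset_closedBall x₀
  set M : ℝ≥0∞ := d + ENNReal.ofReal R with hM
  have hMtop : M ≠ ⊤ := by simp [hM]
  have hb : ∀ p ∈ N, 0 < p.2 - ⟪p.1, x₀⟫_ℝ := fun p hp => sub_pos.2 (h.mem_interior_iff.1 hx₀ p hp)
  refine ⟨∑ p ∈ N, (ENNReal.ofReal (p.2 - ⟪p.1, x₀⟫_ℝ))⁻¹ * M, ?_, fun f hf => ?_⟩
  · exact (ENNReal.sum_lt_top.2 fun p hp => ENNReal.mul_lt_top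
      (ENNReal.inv_lt_top.2 (ENNReal.ofReal_pos.2 (hb p hp))) hMtop.lt_top).ne
  rw [h.lintegral_frontier, Finset.sum_mul]
  refine Finset.sum_le_sum fun p hp => ?_
  have h1 := h.lintegral_facet_le hd hp hx₀ hf
  have h2 : ∫⁻ x in facetCone K x₀ p, ‖radialDiv x₀ f x‖ₑ ≤
      M * ((∫⁻ x in K, ‖f x‖ₑ) + ∫⁻ x in K, ‖fderiv ℝ f x‖ₑ) := by
    rw [← lintegral_add_left hf.continuous.enorm.measurable, ← lintegral_const_mul' _ _ hMtop]
    refine (lintegral_mono_set (h.facetCone_subset (interior_subset hx₀))).trans ?_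
    refine setLIntegral_mono' h.isClosed.measurableSet fun x hx => ?_
    have hx' : ‖x - x₀‖ ≤ R := mem_closedBall_iff_norm.1 (hR hx)
    calc ‖radialDiv x₀ f x‖ₑ ≤ ‖(d : ℝ) • f x‖ₑ + ‖fderiv ℝ f x (x - x₀)‖ₑ := enorm_add_le _ _
      _ ≤ d * ‖f x‖ₑ + ENNReal.ofReal R * ‖fderiv ℝ f x‖ₑ := by
          gcongr
          · rw [enorm_smul]; simp
          · refine ((fderiv ℝ f x).le_opENorm _).trans ?_
            rw [mul_comm]
            gcongr
            rw [← ofReal_norm]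
            exact ENNReal.ofReal_le_ofReal hx'
      _ ≤ M * (‖f x‖ₑ + ‖fderiv ℝ f x‖ₑ) := by
          rw [mul_add]
          gcongr
          · exact le_self_add
          · exact le_add_self
  have hpos := ENNReal.ofReal_pos.2 (hb p hp)
  rw [mul_assoc, ← ENNReal.div_eq_inv_mul, ENNReal.le_div_iff_mul_le (Or.inl hpos.ne')
    (Or.inl ENNReal.ofReal_ne_top), mul_comm]
  exact h1.trans h2

/-- In the relative interior of a facet its normal is the only unit normal vector. -/
theorem isUnitNormal_iff (h : IsRep K N) {p : E d × ℝ} (hp : p ∈ N) {x : E d}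
    (hx : x ∈ K ∩ hyperplane p.1 p.2) (hx' : ∀ q ∈ N, q ≠ p → x ∉ K ∩ hyperplane q.1 q.2) (ν : E d) :
    IsUnitNormal K x ν ↔ ν = p.1 := by
  have hxp : ⟪p.1, x⟫_ℝ = p.2 := hx.2
  have hnn : ⟪p.1, p.1⟫_ℝ = 1 := by rw [real_inner_self_eq_norm_sq, h.norm_eq p hp, one_pow]
  constructor
  swap
  · rintro rfl
    refine ⟨h.norm_eq p hp, fun y hy => ?_⟩
    rw [inner_sub_right, hxp]
    linarith [h.mem_iff.1 hy p hp]
  rintro ⟨hν, hsupp⟩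
  have hlt : ∀ q ∈ N, q ≠ p → ⟪q.1, x⟫_ℝ < q.2 := fun q hq hqp =>
    lt_of_le_of_ne (h.mem_iff.1 hx.1 q hq) fun he => hx' q hq hqp ⟨hx.1, he⟩
  have key : ∀ z : E d, ⟪p.1, z⟫_ℝ ≤ 0 → ⟪ν, z⟫_ℝ ≤ 0 := by
    intro z hz
    have h1 : ∀ q ∈ N, ∀ᶠ t in 𝓝[>] (0 : ℝ), ⟪q.1, x + t • z⟫_ℝ ≤ q.2 := by
      intro q hq
      by_cases hqp : q = p
      · subst hqp
        filter_upwards [self_mem_nhdsWithin] with t ht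
        have ht : 0 < t := ht
        rw [inner_add_right, inner_smul_right, hxp]
        nlinarith
      · have hc : Continuous fun t : ℝ => ⟪q.1, x + t • z⟫_ℝ := by fun_prop
        have h2 := hc.tendsto 0
        rw [zero_smul, add_zero] at h2
        exact ((h2.mono_left nhdsWithin_le_nhds).eventually (gt_mem_nhds (hlt q hq hqp))).mono
          fun t ht => le_of_lt ht
    obtain ⟨t, ht, ht0⟩ := (((Filter.eventually_all_finset N).2 h1).and self_mem_nhdsWithin).exists
    have ht0 : 0 < t := ht0
    have h3 := hsupp _ (h.mem_iff.2 ht)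
    rw [add_sub_cancel_left, inner_smul_right] at h3
    exact nonpos_of_mul_nonpos_right h3 ht0
  set s := ⟪p.1, ν⟫_ℝ with hs
  have hs' : ⟪ν, p.1⟫_ℝ = s := real_inner_comm _ _
  have hz : ν - s • p.1 = 0 := by
    have h1 := key (ν - s • p.1) (by rw [inner_sub_right, inner_smul_right, hnn]; simp [hs])
    have h2 : ⟪ν - s • p.1, ν - s • p.1⟫_ℝ = ⟪ν, ν - s • p.1⟫_ℝ := by
      rw [inner_sub_left, inner_smul_left, inner_sub_right p.1, inner_smul_right, hnn]
      simp [hs]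
    rw [← h2] at h1
    exact real_inner_self_nonpos.1 h1
  rw [sub_eq_zero] at hz
  have h0 : 0 ≤ s := by
    have h1 := key (-p.1) (by rw [inner_neg_right, hnn]; norm_num)
    rw [inner_neg_right, hs'] at h1
    linarith
  have h1 : s = 1 := by
    have := hν
    rw [hz, norm_smul, h.norm_eq p hp, mul_one, Real.norm_of_nonneg h0] at this
    exact this
  rw [hz, h1, one_smul]

theorem ae_facet_isUnitNormal_iff (h : IsRep K N) {p : E d × ℝ} (hp : p ∈ N) :
    ∀ᵐ x ∂((surf d).restrict (K ∩ hyperplane p.1 p.2)), ∀ ν, IsUnitNormal K x ν ↔ ν = p.1 := by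
  have h1 : ∀ q ∈ N, ∀ᵐ x ∂((surf d).restrict (K ∩ hyperplane p.1 p.2)),
      q ≠ p → x ∉ K ∩ hyperplane q.1 q.2 := by
    intro q hq
    by_cases hqp : q = p
    · exact Eventually.of_forall fun x hx => absurd hqp hx
    · have h2 : ((surf d).restrict (K ∩ hyperplane p.1 p.2)) (K ∩ hyperplane q.1 q.2) = 0 := by
        rw [Measure.restrict_apply (h.measurableSet_facet q)]
        exact h.surf_facet_inter hq hp hqp
      filter_upwards [measure_eq_zero_iff_ae_notMem.1 h2] with x hx _ using hx
  filter_upwards [(Filter.eventually_all_finset N).2 h1,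
    ae_restrict_mem (h.measurableSet_facet p)] with x hx hxp
  exact h.isUnitNormal_iff hp hxp hx

theorem ae_frontier_of_ae_facet (h : IsRep K N) {P : E d → Prop}
    (hP : ∀ p ∈ N, ∀ᵐ x ∂((surf d).restrict (K ∩ hyperplane p.1 p.2)), P x) :
    ∀ᵐ x ∂((surf d).restrict (frontier K)), P x := by
  rw [h.frontier_eq, ae_restrict_biUnion_finset_iff]
  exact hP

/-- At almost every boundary point of a polytope there is exactly one unit normal vector. -/
theorem ae_existsUnique_isUnitNormal (h : IsRep K N) :
    ∀ᵐ x ∂((surf d).restrict (frontier K)), ∃! ν, IsUnitNormal K x ν :=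
  h.ae_frontier_of_ae_facet fun p hp => by
    filter_upwards [h.ae_facet_isUnitNormal_iff hp] with x hx
    exact ⟨p.1, (hx p.1).2 rfl, fun ν hν => (hx ν).1 hν⟩

theorem ae_facet_normal_eq (h : IsRep K N) {p : E d × ℝ} (hp : p ∈ N) :
    ∀ᵐ x ∂((surf d).restrict (K ∩ hyperplane p.1 p.2)), normal K x = p.1 := by
  filter_upwards [h.ae_facet_isUnitNormal_iff hp] with x hx
  exact (hx _).1 (isUnitNormal_normal ⟨p.1, (hx p.1).2 rfl⟩)

end IsRep

end Divergence

end OldroydDG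

namespace OldroydDG

section SobolevInequality

variable {d : ℕ} {K : Set (E d)} {N : Finset (E d × ℝ)}

theorem IsRep.volume_restrict_interior (h : IsRep K N) :
    volume.restrict (interior K) = volume.restrict K := by
  refine Measure.restrict_congr_set ?_
  refine ae_eq_set.2 ⟨by rw [sdiff_eq_empty.2 interior_subset, measure_empty], ?_⟩
  rw [← h.isClosed.frontier_eq]
  exact h.convex.addHaar_frontier volume

/-- The mollification of the restriction of `f` to `K`. -/
noncomputable def mollify (K : Set (E d)) (ρ f : E d → ℝ) : E d → ℝ :=
  convolution (K.indicator f) ρ (ContinuousLinearMap.lsmul ℝ ℝ).flip volume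

variable {ρ f : E d → ℝ}

theorem IsRep.integrable_indicator (h : IsRep K N) (hf : Continuous f) :
    Integrable (K.indicator f) volume :=
  (integrable_indicator_iff h.isClosed.measurableSet).2
    (hf.continuousOn.integrableOn_compact h.isCompact)

theorem IsRep.fderiv_mollify (h : IsRep K N) (hd : 0 < d) (hρ : ContDiff ℝ ∞ ρ)
    (hc : HasCompactSupport ρ) (hf : ContDiff ℝ 1 f) (x : E d) :
    fderiv ℝ (mollify K ρ f) x = (∫ y in K, ρ (x - y) • fderiv ℝ f y) -
      ∑ p ∈ N, (∫ y in K ∩ hyperplane p.1 p.2, ρ (x - y) * f y ∂(surf d)) • innerSL ℝ p.1 := by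
  have hloc : LocallyIntegrable (K.indicator f) volume :=
    (h.integrable_indicator hf.continuous).locallyIntegrable
  have hρ1 : ContDiff ℝ 1 ρ := hρ.of_le (by simp)
  have hρ' : Continuous (fderiv ℝ ρ) := hρ1.continuous_fderiv (by simp)
  have hf' : Continuous (fderiv ℝ f) := hf.continuous_fderiv (by simp)
  have h1 := hc.hasFDerivAt_convolution_right (μ := volume)
    (ContinuousLinearMap.lsmul ℝ ℝ : ℝ →L[ℝ] ℝ →L[ℝ] ℝ).flip hloc hρ1 x
  ext v
  rw [mollify, h1.fderiv, convolution_precompR_apply _ hloc (hc.fderiv ℝ) hρ']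
  have e1 : (convolution (K.indicator f) (fun a => fderiv ℝ ρ a v)
      (ContinuousLinearMap.lsmul ℝ ℝ).flip volume) x = ∫ y in K, fderiv ℝ ρ (x - y) v * f y := by
    rw [convolution_def, ← integral_indicator h.isClosed.measurableSet]
    refine integral_congr_ae (Eventually.of_forall fun y => ?_)
    by_cases hy : y ∈ K <;> simp [hy]
  have hF : ContDiff ℝ 1 fun y => ρ (x - y) * f y := (hρ1.comp (by fun_prop)).mul hf
  have e2 : ∀ y, fderiv ℝ (fun y => ρ (x - y) * f y) y v =
      ρ (x - y) * fderiv ℝ f y v - fderiv ℝ ρ (x - y) v * f y := by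
    intro y
    have h2 : HasFDerivAt (fun y => x - y) (-ContinuousLinearMap.id ℝ (E d)) y :=
      (hasFDerivAt_id y).const_sub x
    have h3 : HasFDerivAt (fun y => ρ (x - y)) _ y :=
      ((hρ1.differentiable (by simp) (x - y)).hasFDerivAt).comp y h2
    have h4 : HasFDerivAt (fun y => ρ (x - y) * f y) _ y := h3.mul (hf.differentiable (by simp) y).hasFDerivAt
    rw [h4.fderiv]
    simp
    ring
  have hint : ∀ g : E d → ℝ, Continuous g → IntegrableOn g K volume := fun g hg =>
    hg.continuousOn.integrableOn_compact h.isCompact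
  have hfc := hf.continuous
  have hρc := hρ.continuous
  have e3 := h.setIntegral_fderiv hd hF v
  simp_rw [e2] at e3
  rw [integral_sub (hint _ (by fun_prop)) (hint _ (by fun_prop))] at e3
  have hint2 : Integrable (fun y => ρ (x - y) • fderiv ℝ f y) (volume.restrict K) :=
    (Continuous.continuousOn (by fun_prop)).integrableOn_compact h.isCompact
  rw [e1, sub_apply, ContinuousLinearMap.integral_apply hint2]
  simp only [smul_apply, smul_eq_mul, sum_apply, innerSL_apply_apply]
  simp only [smul_eq_mul] at e3
  simp_rw [mul_comm (∫ _ in _, _ ∂_)]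
  linarith

theorem lintegral_lintegral_enorm_comp_sub_mul {μ : Measure (E d)} [SFinite μ]
    (hρ : Continuous ρ) (hρ1 : ∫⁻ x, ‖ρ x‖ₑ = 1) {g : E d → ℝ≥0∞} (hg : Measurable g) :
    ∫⁻ x, ∫⁻ y, ‖ρ (x - y)‖ₑ * g y ∂μ = ∫⁻ y, g y ∂μ := by
  have hm : Measurable fun s : E d × E d => ‖ρ (s.1 - s.2)‖ₑ * g s.2 :=
    ((hρ.comp (by fun_prop)).enorm.measurable).mul (hg.comp measurable_snd)
  rw [lintegral_lintegral_swap hm.aemeasurable]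
  refine lintegral_congr fun y => ?_
  have hm2 : Measurable fun x => ‖ρ (x - y)‖ₑ := (hρ.comp (by fun_prop)).enorm.measurable
  rw [lintegral_mul_const _ hm2, lintegral_sub_right_eq_self (fun x => ‖ρ x‖ₑ) y, hρ1, one_mul]

theorem IsRep.lintegral_fderiv_mollify_le (h : IsRep K N) (hd : 0 < d) (hρ : ContDiff ℝ ∞ ρ)
    (hc : HasCompactSupport ρ) (hρ1 : ∫⁻ x, ‖ρ x‖ₑ = 1) (hf : ContDiff ℝ 1 f) :
    ∫⁻ x, ‖fderiv ℝ (mollify K ρ f) x‖ₑ ≤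
      (∫⁻ x in K, ‖fderiv ℝ f x‖ₑ) + ∫⁻ y in frontier K, ‖f y‖ₑ ∂(surf d) := by
  have hfm : Measurable fun x => ‖f x‖ₑ := hf.continuous.enorm.measurable
  have hfm' : Measurable fun x => ‖fderiv ℝ f x‖ₑ :=
    (hf.continuous_fderiv (by simp)).enorm.measurable
  have hρc := hρ.continuous
  calc ∫⁻ x, ‖fderiv ℝ (mollify K ρ f) x‖ₑ
      ≤ ∫⁻ x, ((∫⁻ y in K, ‖ρ (x - y)‖ₑ * ‖fderiv ℝ f y‖ₑ) +
          ∑ p ∈ N, ∫⁻ y in K ∩ hyperplane p.1 p.2, ‖ρ (x - y)‖ₑ * ‖f y‖ₑ ∂(surf d)) := by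
        refine lintegral_mono fun x => ?_
        rw [h.fderiv_mollify hd hρ hc hf]
        refine enorm_sub_le.trans (add_le_add ?_ ?_)
        · refine (enorm_integral_le_lintegral_enorm _).trans (le_of_eq ?_)
          simp_rw [enorm_smul]
        · refine (enorm_sum_le N fun p : E d × ℝ =>
            (∫ y in K ∩ hyperplane p.1 p.2, ρ (x - y) * f y ∂(surf d)) • innerSL ℝ p.1).trans (Finset.sum_le_sum fun p hp => ?_)
          rw [enorm_smul]
          have : ‖innerSL ℝ p.1‖ₑ = 1 := by
            rw [← ofReal_norm, innerSL_apply_norm, h.norm_eq p hp, ENNReal.ofReal_one]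
          rw [this, mul_one]
          refine (enorm_integral_le_lintegral_enorm _).trans (le_of_eq ?_)
          simp_rw [enorm_mul]
    _ = _ := by
        have hm1 : Measurable fun x => ∫⁻ y in K, ‖ρ (x - y)‖ₑ * ‖fderiv ℝ f y‖ₑ := by
          refine Measurable.lintegral_prod_right'
            (f := fun s : E d × E d => ‖ρ (s.1 - s.2)‖ₑ * ‖fderiv ℝ f s.2‖ₑ) ?_
          exact ((hρc.comp (by fun_prop)).enorm.measurable).mul (hfm'.comp measurable_snd)
        have hm2 : ∀ p ∈ N, Measurable fun x =>
            ∫⁻ y in K ∩ hyperplane p.1 p.2, ‖ρ (x - y)‖ₑ * ‖f y‖ₑ ∂(surf d) := by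
          intro p hp
          have := h.isFiniteMeasure_facet hp
          refine Measurable.lintegral_prod_right'
            (f := fun s : E d × E d => ‖ρ (s.1 - s.2)‖ₑ * ‖f s.2‖ₑ) ?_
          exact ((hρc.comp (by fun_prop)).enorm.measurable).mul (hfm.comp measurable_snd)
        rw [lintegral_add_left hm1, lintegral_lintegral_enorm_comp_sub_mul hρc hρ1 hfm',
          lintegral_finsetSum _ hm2, h.lintegral_frontier]
        congr 1
        refine Finset.sum_congr rfl fun p hp => ?_
        have := h.isFiniteMeasure_facet hp
        exact lintegral_lintegral_enorm_comp_sub_mul hρc hρ1 hfm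

/-- The Sobolev inequality for `W^{1,1}` of a polytope. -/
theorem IsRep.exists_eLpNorm_le (h : IsRep K N) (hd : 0 < d) {p : NNReal}
    (hp : NNReal.HolderConjugate d p) :
    ∃ C : ℝ≥0∞, C ≠ ⊤ ∧ ∀ f : E d → ℝ, ContDiff ℝ 1 f →
      eLpNorm f p (volume.restrict K) ≤
        C * ((∫⁻ x in K, ‖f x‖ₑ) + ∫⁻ x in K, ‖fderiv ℝ f x‖ₑ) := by
  obtain ⟨C₁, hC₁, htr⟩ := h.exists_lintegral_frontier_le ℝ hd
  set C₂ : ℝ≥0∞ := (eLpNormLESNormFDerivOneConst (volume : Measure (E d)) p : ℝ≥0∞) with hC₂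
  refine ⟨C₂ * (1 + C₁), ENNReal.mul_ne_top ENNReal.coe_ne_top
    (ENNReal.add_ne_top.2 ⟨ENNReal.one_ne_top, hC₁⟩), fun f hf => ?_⟩
  let b : ℕ → ContDiffBump (0 : E d) := fun n => ⟨1 / ((n : ℝ) + 1) / 2, 1 / ((n : ℝ) + 1),
    by positivity, half_lt_self (by positivity)⟩
  have hb : Tendsto (fun n => (b n).rOut) atTop (𝓝 0) := tendsto_one_div_add_atTop_nhds_zero_nat
  have hloc : Integrable (K.indicator f) volume := h.integrable_indicator hf.continuous
  set H : ℕ → E d → ℝ := fun n => mollify K ((b n).normed volume) f with hH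
  have hHs : ∀ n, ContDiff ℝ 1 (H n) := fun n =>
    (b n).hasCompactSupport_normed.contDiff_convolution_right (n := 1) _ hloc.locallyIntegrable
      (b n).contDiff_normed
  have hKc : HasCompactSupport (K.indicator f) :=
    h.isCompact.of_isClosed_subset (isClosed_tsupport _)
      (closure_minimal support_indicator_subset h.isClosed)
  have hHc : ∀ n, HasCompactSupport (H n) := fun n =>
    hKc.convolution _ (b n).hasCompactSupport_normed
  have hbound : ∀ n, eLpNorm (H n) p (volume.restrict (interior K)) ≤
      C₂ * (1 + C₁) * ((∫⁻ x in K, ‖f x‖ₑ) + ∫⁻ x in K, ‖fderiv ℝ f x‖ₑ) := by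
    intro n
    have hfr : Module.finrank ℝ (E d) = d := by simp
    refine (eLpNorm_mono_measure _ Measure.restrict_le_self).trans ?_
    refine (eLpNorm_le_eLpNorm_fderiv_one volume (hHs n) (hHc n) (p := p) (by rwa [hfr])).trans ?_
    rw [mul_assoc, eLpNorm_one_eq_lintegral_enorm]
    gcongr
    have h1 : ∫⁻ x, ‖(b n).normed volume x‖ₑ = 1 := by
      have h2 := ofReal_integral_eq_lintegral_ofReal (μ := volume) (b n).integrable_normed
        (Eventually.of_forall fun x => (b n).nonneg_normed x)
      rw [(b n).integral_normed, ENNReal.ofReal_one] at h2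
      rw [h2]
      exact lintegral_congr fun x => Real.enorm_of_nonneg ((b n).nonneg_normed x)
    refine (h.lintegral_fderiv_mollify_le hd (b n).contDiff_normed (b n).hasCompactSupport_normed
      h1 hf).trans ?_
    rw [add_mul, one_mul]
    exact add_le_add le_add_self (htr f hf)
  have hlim : ∀ᵐ x ∂(volume.restrict (interior K)), Tendsto (fun n => H n x) atTop (𝓝 (f x)) := by
    filter_upwards [ae_restrict_mem isOpen_interior.measurableSet] with x hx
    have h1 : Tendsto (K.indicator f) (𝓝 x) (𝓝 (f x)) := by
      refine (hf.continuous.tendsto x).congr' ?_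
      filter_upwards [isOpen_interior.mem_nhds hx] with y hy
      rw [indicator_of_mem (interior_subset hy)]
    have h2 := ContDiffBump.convolution_tendsto_right (μ := volume) (φ := b)
      (g := fun _ => K.indicator f) (k := fun _ => x) hb
      (Eventually.of_forall fun _ => hloc.1) (h1.comp tendsto_snd) tendsto_const_nhds
    refine h2.congr fun n => ?_
    exact congrFun (convolution_flip (ContinuousLinearMap.lsmul ℝ ℝ)).symm x
  rw [← h.volume_restrict_interior]
  refine (Lp.eLpNorm_lim_le_liminf_eLpNorm
    (fun n => (hHs n).continuous.aestronglyMeasurable) f hlim).trans ?_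
  rw [h.volume_restrict_interior] at hbound ⊢
  exact liminf_le_of_frequently_le' (Eventually.frequently (Eventually.of_forall hbound))

end SobolevInequality

end OldroydDG

namespace OldroydDG

section Hoelder

variable {X V W : Type*} [MeasurableSpace X] {μ : Measure X}
  [NormedAddCommGroup V] [NormedAddCommGroup W]

theorem lintegral_enorm_mul_enorm_le {p q : ℝ≥0∞} [ENNReal.HolderConjugate p q] {f : X → V} {g : X → W}
    (hf : AEStronglyMeasurable f μ) (hg : AEStronglyMeasurable g μ) :
    ∫⁻ x, ‖f x‖ₑ * ‖g x‖ₑ ∂μ ≤ eLpNorm f p μ * eLpNorm g q μ := by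
  have h := eLpNorm_smul_le_mul_eLpNorm (p := p) (q := q) (r := 1) (μ := μ) hg.norm hf.norm
  rw [eLpNorm_norm, eLpNorm_norm, eLpNorm_one_eq_lintegral_enorm] at h
  simpa [enorm_mul] using h

theorem tendsto_eLpNorm_of_exponent_le [IsFiniteMeasure μ] {p q : ℝ≥0∞} (hpq : p ≤ q) {f : ℕ → X → V}
    (hf : ∀ n, AEStronglyMeasurable (f n) μ)
    (h : Tendsto (fun n => eLpNorm (f n) q μ) atTop (𝓝 0)) (hp : p ≠ 0) :
    Tendsto (fun n => eLpNorm (f n) p μ) atTop (𝓝 0) := by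
  have hexp : 0 ≤ 1 / p.toReal - 1 / q.toReal := by
    rcases eq_or_ne q ⊤ with rfl | hq
    · simp
    · rw [sub_nonneg]
      exact one_div_le_one_div_of_le (ENNReal.toReal_pos hp (ne_top_of_le_ne_top hq hpq))
        (ENNReal.toReal_mono hq hpq)
  have h2 := ENNReal.Tendsto.mul_const (b := μ univ ^ (1 / p.toReal - 1 / q.toReal)) h
    (Or.inr (ENNReal.rpow_ne_top_of_nonneg hexp (measure_ne_top μ univ)))
  rw [zero_mul] at h2
  exact tendsto_of_tendsto_of_tendsto_of_le_of_le tendsto_const_nhds h2 (fun _ => zero_le)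
    fun n => eLpNorm_le_eLpNorm_mul_rpow_measure_univ hpq (hf n)

theorem ae_eq_of_tendsto_eLpNorm {p : ℝ≥0∞} (hp : 1 ≤ p) {f : ℕ → X → V} {g₁ g₂ : X → V}
    (hf : ∀ n, AEStronglyMeasurable (f n) μ) (hg₁ : AEStronglyMeasurable g₁ μ)
    (hg₂ : AEStronglyMeasurable g₂ μ)
    (h₁ : Tendsto (fun n => eLpNorm (fun x => f n x - g₁ x) p μ) atTop (𝓝 0))
    (h₂ : Tendsto (fun n => eLpNorm (fun x => f n x - g₂ x) p μ) atTop (𝓝 0)) : g₁ =ᵐ[μ] g₂ := by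
  have h0 : eLpNorm (fun x => g₁ x - g₂ x) p μ ≤ 0 := by
    refine ge_of_tendsto' (by simpa using h₂.add h₁) fun n => ?_
    have e : (fun x => g₁ x - g₂ x) = (fun x => f n x - g₂ x) - fun x => f n x - g₁ x := by
      ext x; simp
    rw [e]
    exact eLpNorm_sub_le ((hf n).sub hg₂) ((hf n).sub hg₁) hp
  have h1 := (eLpNorm_eq_zero_iff (hg₁.sub hg₂) (zero_lt_one.trans_le hp).ne').1
    (nonpos_iff_eq_zero.1 h0)
  filter_upwards [h1] with x hx using sub_eq_zero.1 hx

theorem exists_memLp_of_cauchy [CompleteSpace V] {p : ℝ≥0∞} (hp : 1 ≤ p) {f : ℕ → X → V}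
    (hf : ∀ n, MemLp (f n) p μ) {a : ℕ → ℝ≥0∞} (ha : Tendsto a atTop (𝓝 0))
    (h : ∀ n m, eLpNorm (fun x => f n x - f m x) p μ ≤ a n + a m) :
    ∃ g, MemLp g p μ ∧ Tendsto (fun n => eLpNorm (fun x => f n x - g x) p μ) atTop (𝓝 0) := by
  have : Fact (1 ≤ p) := ⟨hp⟩
  have hc : CauchySeq fun n => (hf n).toLp (f n) := by
    rw [Lp.cauchySeq_Lp_iff_cauchySeq_eLpNorm]
    have h2 : Tendsto (fun n : ℕ × ℕ => a n.1 + a n.2) atTop (𝓝 0) := by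
      rw [← prod_atTop_atTop_eq]
      simpa using (ha.comp tendsto_fst).add (ha.comp tendsto_snd)
    refine tendsto_of_tendsto_of_tendsto_of_le_of_le tendsto_const_nhds h2 (fun _ => zero_le)
      fun n => ?_
    refine le_trans (le_of_eq (eLpNorm_congr_ae ?_)) (h n.1 n.2)
    filter_upwards [(hf n.1).coeFn_toLp, (hf n.2).coeFn_toLp] with x h1 h2
    simp [h1, h2]
  obtain ⟨g, hg⟩ := cauchySeq_tendsto_of_complete hc
  refine ⟨g, Lp.memLp g, ?_⟩
  rw [Lp.tendsto_Lp_iff_tendsto_eLpNorm'] at hg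
  refine hg.congr fun n => eLpNorm_congr_ae ?_
  filter_upwards [(hf n).coeFn_toLp] with x h1
  simp [h1]

theorem enorm_inner_le [InnerProductSpace ℝ V] (v w : V) : ‖⟪v, w⟫_ℝ‖ₑ ≤ ‖v‖ₑ * ‖w‖ₑ := by
  rw [enorm_eq_nnnorm, enorm_eq_nnnorm, enorm_eq_nnnorm]
  exact_mod_cast nnnorm_inner_le_nnnorm (𝕜 := ℝ) v w

theorem lintegral_enorm_inner_le [InnerProductSpace ℝ V] {p q : ℝ≥0∞} [ENNReal.HolderConjugate p q]
    {f g : X → V} (hf : AEStronglyMeasurable f μ) (hg : AEStronglyMeasurable g μ) :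
    ∫⁻ x, ‖⟪f x, g x⟫_ℝ‖ₑ ∂μ ≤ eLpNorm f p μ * eLpNorm g q μ :=
  (lintegral_mono fun _ => enorm_inner_le _ _).trans (lintegral_enorm_mul_enorm_le hf hg)

theorem integrable_inner_of_memLp [InnerProductSpace ℝ V] {p q : ℝ≥0∞} [ENNReal.HolderConjugate p q]
    {f g : X → V} (hf : MemLp f p μ) (hg : MemLp g q μ) : Integrable (fun x => ⟪f x, g x⟫_ℝ) μ :=
  ⟨hf.1.inner hg.1, (lintegral_enorm_inner_le hf.1 hg.1).trans_lt (ENNReal.mul_lt_top hf.2 hg.2)⟩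

theorem tendsto_integral_inner [InnerProductSpace ℝ V] {p q : ℝ≥0∞} [ENNReal.HolderConjugate p q]
    {f g : ℕ → X → V} {f₀ g₀ : X → V} (hf : ∀ n, MemLp (f n) p μ) (hg : ∀ n, MemLp (g n) q μ)
    (hf₀ : MemLp f₀ p μ) (hg₀ : MemLp g₀ q μ)
    (hft : Tendsto (fun n => eLpNorm (fun x => f n x - f₀ x) p μ) atTop (𝓝 0))
    (hgt : Tendsto (fun n => eLpNorm (fun x => g n x - g₀ x) q μ) atTop (𝓝 0)) :
    Tendsto (fun n => ∫ x, ⟪f n x, g n x⟫_ℝ ∂μ) atTop (𝓝 (∫ x, ⟪f₀ x, g₀ x⟫_ℝ ∂μ)) := by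
  refine tendsto_integral_of_L1 _ (integrable_inner_of_memLp hf₀ hg₀).1
    (Eventually.of_forall fun n => integrable_inner_of_memLp (hf n) (hg n)) ?_
  have hlim : Tendsto (fun n => eLpNorm (fun x => f n x - f₀ x) p μ *
      eLpNorm (fun x => g n x - g₀ x) q μ + eLpNorm (fun x => f n x - f₀ x) p μ * eLpNorm g₀ q μ +
      eLpNorm f₀ p μ * eLpNorm (fun x => g n x - g₀ x) q μ) atTop (𝓝 0) := by
    have h1 := ENNReal.Tendsto.mul hft (Or.inr ENNReal.zero_ne_top) hgt (Or.inr ENNReal.zero_ne_top)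
    have h2 := ENNReal.Tendsto.mul_const hft (Or.inr hg₀.2.ne)
    have h3 := ENNReal.Tendsto.const_mul hgt (Or.inr hf₀.2.ne)
    simpa using (h1.add h2).add h3
  refine tendsto_of_tendsto_of_tendsto_of_le_of_le tendsto_const_nhds hlim (fun _ => zero_le)
    fun n => ?_
  have hfn : AEStronglyMeasurable (fun x => f n x - f₀ x) μ := (hf n).1.sub hf₀.1
  have hgn : AEStronglyMeasurable (fun x => g n x - g₀ x) μ := (hg n).1.sub hg₀.1
  calc ∫⁻ x, ‖⟪f n x, g n x⟫_ℝ - ⟪f₀ x, g₀ x⟫_ℝ‖ₑ ∂μ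
      ≤ ∫⁻ x, (‖⟪f n x - f₀ x, g n x - g₀ x⟫_ℝ‖ₑ + ‖⟪f n x - f₀ x, g₀ x⟫_ℝ‖ₑ
          + ‖⟪f₀ x, g n x - g₀ x⟫_ℝ‖ₑ) ∂μ := by
        refine lintegral_mono fun x => ?_
        have e : ⟪f n x, g n x⟫_ℝ - ⟪f₀ x, g₀ x⟫_ℝ = ⟪f n x - f₀ x, g n x - g₀ x⟫_ℝ +
            ⟪f n x - f₀ x, g₀ x⟫_ℝ + ⟪f₀ x, g n x - g₀ x⟫_ℝ := by
          simp only [inner_sub_left, inner_sub_right]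
          ring
        rw [e]
        exact (enorm_add_le _ _).trans (add_le_add_left (enorm_add_le _ _) _)
    _ ≤ _ := by
        rw [lintegral_add_right' _ (hf₀.1.inner hgn).enorm,
          lintegral_add_right' _ (hfn.inner hg₀.1).enorm]
        exact add_le_add (add_le_add (lintegral_enorm_inner_le hfn hgn)
          (lintegral_enorm_inner_le hfn hg₀.1)) (lintegral_enorm_inner_le hf₀.1 hgn)

end Hoelder

end OldroydDG

namespace OldroydDG

/-- The exponent `2d/(d-1)`, conjugate to `sobExp d`. -/
noncomputable def conjExp (d : ℕ) : ℝ≥0∞ := ENNReal.ofReal (2 * d / (d - 1))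

theorem holderConjugate_sobExp {d : ℕ} (hd : 2 ≤ d) :
    ENNReal.HolderConjugate (sobExp d) (conjExp d) := by
  have hd' : (2 : ℝ) ≤ d := by exact_mod_cast hd
  have : Real.HolderConjugate (2 * d / (d + 1) : ℝ) (2 * d / (d - 1)) := by
    have h1 : (d : ℝ) - 1 ≠ 0 := by linarith
    refine Real.holderConjugate_iff.2 ⟨by rw [lt_div_iff₀ (by linarith)]; linarith, ?_⟩
    field_simp
    ring
  exact this.ennrealOfReal

theorem one_le_sobExp {d : ℕ} (hd : 1 ≤ d) : 1 ≤ sobExp d := by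
  have hd' : (1 : ℝ) ≤ d := by exact_mod_cast hd
  rw [sobExp, ← ENNReal.ofReal_one]
  exact ENNReal.ofReal_le_ofReal (by rw [le_div_iff₀ (by linarith)]; linarith)

theorem sobExp_ne_top (d : ℕ) : sobExp d ≠ ⊤ := ENNReal.ofReal_ne_top

theorem one_le_conjExp {d : ℕ} (hd : 2 ≤ d) : 1 ≤ conjExp d := by
  have := holderConjugate_sobExp hd
  exact ENNReal.HolderConjugate.one_le (conjExp d) (sobExp d)

theorem sobExp_le_two (d : ℕ) : sobExp d ≤ 2 := by
  have hd' : (0 : ℝ) ≤ d := by positivity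
  rw [sobExp, show (2 : ℝ≥0∞) = ENNReal.ofReal 2 by simp]
  exact ENNReal.ofReal_le_ofReal (by rw [div_le_iff₀ (by linarith)]; linarith)

theorem sobExp_le_conjExp {d : ℕ} (hd : 2 ≤ d) : sobExp d ≤ conjExp d := by
  have hd' : (2 : ℝ) ≤ d := by exact_mod_cast hd
  exact ENNReal.ofReal_le_ofReal (div_le_div_of_nonneg_left (by linarith) (by linarith) (by linarith))

/-- The `W^{1,q}` norm of a differentiable function. -/
noncomputable def w1Norm {d : ℕ} {V : Type*} [NormedAddCommGroup V] [NormedSpace ℝ V] (q : ℝ≥0∞)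
    (μ : Measure (E d)) (φ : E d → V) : ℝ≥0∞ :=
  eLpNorm φ q μ + ∑ j, eLpNorm (fun x => fderiv ℝ φ x (basisVec j)) q μ

section

variable {d : ℕ} {K : Set (E d)} {N : Finset (E d × ℝ)} {V : Type*} [NormedAddCommGroup V]

theorem norm_clm_le_sum_basisVec [NormedSpace ℝ V] (L : E d →L[ℝ] V) :
    ‖L‖ ≤ ∑ j, ‖L (basisVec j)‖ := by
  refine L.opNorm_le_bound (Finset.sum_nonneg fun _ _ => norm_nonneg _) fun x => ?_
  have e : x = ∑ j, x j • (basisVec j : E d) := by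
    have := (EuclideanSpace.basisFun (Fin d) ℝ).sum_repr x
    simpa using this.symm
  calc ‖L x‖ = ‖∑ j, x j • L (basisVec j)‖ := by
        conv_lhs => rw [e]
        simp
    _ ≤ ∑ j, ‖x j • L (basisVec j)‖ := norm_sum_le _ _
    _ ≤ ∑ j, ‖L (basisVec j)‖ * ‖x‖ := Finset.sum_le_sum fun j _ => by
        rw [norm_smul, mul_comm]
        gcongr
        exact PiLp.norm_apply_le x j
    _ = _ := by rw [Finset.sum_mul]

theorem eLpNorm_fderiv_le [NormedSpace ℝ V] {μ : Measure (E d)} {q : ℝ≥0∞} (hq : 1 ≤ q)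
    {φ : E d → V} (hφ : ContDiff ℝ 1 φ) :
    eLpNorm (fderiv ℝ φ) q μ ≤ ∑ j, eLpNorm (fun x => fderiv ℝ φ x (basisVec j)) q μ := by
  have hc : Continuous (fderiv ℝ φ) := hφ.continuous_fderiv (by simp)
  calc eLpNorm (fderiv ℝ φ) q μ
      ≤ eLpNorm (∑ j : Fin d, fun x => ‖fderiv ℝ φ x (basisVec j)‖) q μ := by
        refine eLpNorm_mono fun x => ?_
        rw [Finset.sum_apply, Real.norm_of_nonneg (Finset.sum_nonneg fun _ _ => norm_nonneg _)]
        exact norm_clm_le_sum_basisVec _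
    _ ≤ ∑ j, eLpNorm (fun x => ‖fderiv ℝ φ x (basisVec j)‖) q μ :=
        eLpNorm_sum_le (fun j _ => by
          have : Continuous fun x => ‖fderiv ℝ φ x (basisVec j)‖ := by fun_prop
          exact this.aestronglyMeasurable) hq
    _ = _ := Finset.sum_congr rfl fun j _ => eLpNorm_norm _

theorem eLpNorm_two_sq {X : Type*} [MeasurableSpace X] {μ : Measure X} (f : X → V) :
    eLpNorm f 2 μ ^ (2 : ℝ) = ∫⁻ x, ‖‖f x‖ ^ 2‖ₑ ∂μ := by
  have := eLpNorm_norm_rpow (μ := μ) (p := 1) f (q := 2) (by norm_num)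
  rw [one_mul, ENNReal.ofReal_ofNat] at this
  rw [← this, eLpNorm_one_eq_lintegral_enorm]
  simp

theorem IsRep.eLpNorm_lt_top (h : IsRep K N) {φ : E d → V} (hφ : Continuous φ) (p : ℝ≥0∞) :
    eLpNorm φ p (volume.restrict K) < ⊤ := by
  have := h.isCompact.measure_lt_top (μ := volume)
  have : IsFiniteMeasure (volume.restrict K) := ⟨by rwa [Measure.restrict_apply_univ]⟩
  obtain ⟨C, hC⟩ := h.isCompact.exists_bound_of_continuousOn hφ.continuousOn
  exact (MemLp.of_bound hφ.aestronglyMeasurable C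
    (ae_restrict_of_forall_mem h.isClosed.measurableSet hC)).2

variable [InnerProductSpace ℝ V]

theorem enorm_fderiv_norm_sq_le {φ : E d → V} {x : E d} (hφ : DifferentiableAt ℝ φ x) :
    ‖fderiv ℝ (fun y => ‖φ y‖ ^ 2) x‖ₑ ≤ 2 * (‖φ x‖ₑ * ‖fderiv ℝ φ x‖ₑ) := by
  have h : HasFDerivAt (fun y => ‖φ y‖ ^ 2) _ x := hφ.hasFDerivAt.norm_sq
  rw [h.fderiv]
  have h2 : ‖2 • (innerSL ℝ (φ x)).comp (fderiv ℝ φ x)‖ ≤ 2 * (‖φ x‖ * ‖fderiv ℝ φ x‖) := by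
    rw [← Nat.cast_smul_eq_nsmul ℝ, norm_smul]
    simp only [Nat.cast_ofNat, Real.norm_ofNat]
    gcongr
    exact (ContinuousLinearMap.opNorm_comp_le _ _).trans_eq (by rw [innerSL_apply_norm])
  rw [← ofReal_norm, ← ofReal_norm, ← ofReal_norm, ← ENNReal.ofReal_mul (norm_nonneg _)]
  have h3 := ENNReal.ofReal_le_ofReal h2
  rwa [ENNReal.ofReal_mul (by norm_num), ENNReal.ofReal_ofNat] at h3

theorem lintegral_norm_sq_add_le {μ : Measure (E d)} (hd : 2 ≤ d) {φ : E d → V}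
    (hφ : ContDiff ℝ 1 φ) :
    (∫⁻ x, ‖‖φ x‖ ^ 2‖ₑ ∂μ) + ∫⁻ x, ‖fderiv ℝ (fun y => ‖φ y‖ ^ 2) x‖ₑ ∂μ ≤
      2 * (eLpNorm φ (conjExp d) μ * w1Norm (sobExp d) μ φ) := by
  have := holderConjugate_sobExp hd
  have : ENNReal.HolderConjugate (conjExp d) (sobExp d) := this.symm
  have hm : AEStronglyMeasurable φ μ := hφ.continuous.aestronglyMeasurable
  have hm' : AEStronglyMeasurable (fderiv ℝ φ) μ :=
    (hφ.continuous_fderiv (by simp)).aestronglyMeasurable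
  have h1 : ∫⁻ x, ‖‖φ x‖ ^ 2‖ₑ ∂μ ≤ eLpNorm φ (conjExp d) μ * eLpNorm φ (sobExp d) μ := by
    refine le_trans (le_of_eq (lintegral_congr fun x => ?_)) (lintegral_enorm_mul_enorm_le hm hm)
    rw [enorm_pow, enorm_norm, sq]
  have h2 : ∫⁻ x, ‖fderiv ℝ (fun y => ‖φ y‖ ^ 2) x‖ₑ ∂μ ≤
      2 * (eLpNorm φ (conjExp d) μ * eLpNorm (fderiv ℝ φ) (sobExp d) μ) := by
    refine (lintegral_mono fun x => enorm_fderiv_norm_sq_le (hφ.differentiable (by simp) x)).trans ?_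
    rw [lintegral_const_mul' _ _ (by simp)]
    gcongr
    exact lintegral_enorm_mul_enorm_le hm hm'
  have h3 := eLpNorm_fderiv_le (μ := μ) (one_le_sobExp (by omega : 1 ≤ d)) hφ
  calc _ ≤ 2 * (eLpNorm φ (conjExp d) μ * eLpNorm φ (sobExp d) μ) +
        2 * (eLpNorm φ (conjExp d) μ * eLpNorm (fderiv ℝ φ) (sobExp d) μ) := by
        refine add_le_add (h1.trans ?_) h2
        exact le_mul_of_one_le_left (zero_le) (by norm_num)
    _ = 2 * (eLpNorm φ (conjExp d) μ * (eLpNorm φ (sobExp d) μ + eLpNorm (fderiv ℝ φ) (sobExp d) μ)) := by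
        ring
    _ ≤ _ := by
        unfold w1Norm
        gcongr

variable (V) in
/-- The Sobolev embedding `W^{1,2d/(d+1)} → L^{2d/(d-1)}` of a polytope, for smooth functions. -/
theorem IsRep.exists_eLpNorm_conjExp_le (h : IsRep K N) (hd : 2 ≤ d) :
    ∃ C : ℝ≥0∞, C ≠ ⊤ ∧ ∀ φ : E d → V, ContDiff ℝ 1 φ →
      eLpNorm φ (conjExp d) (volume.restrict K) ≤ C * w1Norm (sobExp d) (volume.restrict K) φ := by
  have hd' : (2 : ℝ) ≤ d := by exact_mod_cast hd
  set p : NNReal := ⟨d / (d - 1), by apply div_nonneg <;> linarith⟩ with hp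
  have hpc : NNReal.HolderConjugate d p := by
    refine NNReal.holderConjugate_iff.2 ⟨by exact_mod_cast hd, ?_⟩
    rw [← NNReal.coe_inj]
    push_cast
    rw [show ((p : NNReal) : ℝ) = d / (d - 1) from rfl]
    have h1 : (d : ℝ) - 1 ≠ 0 := by linarith
    field_simp
    ring
  have hpq : (p : ℝ≥0∞) * ENNReal.ofReal 2 = conjExp d := by
    have : (p : ℝ≥0∞) = ENNReal.ofReal (d / (d - 1)) := by
      rw [ENNReal.ofReal, Real.toNNReal_of_nonneg (by apply div_nonneg <;> linarith)]
      rfl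
    rw [this, ← ENNReal.ofReal_mul (by apply div_nonneg <;> linarith), conjExp]
    congr 1
    ring
  obtain ⟨C, hC, hle⟩ := h.exists_eLpNorm_le (by omega) hpc
  refine ⟨C * 2, ENNReal.mul_ne_top hC (by simp), fun φ hφ => ?_⟩
  have h1 := hle (fun x => ‖φ x‖ ^ 2) (hφ.norm_sq ℝ)
  have h2 : eLpNorm (fun x => ‖φ x‖ ^ 2) p (volume.restrict K) =
      eLpNorm φ (conjExp d) (volume.restrict K) ^ (2 : ℝ) := by
    have := eLpNorm_norm_rpow (μ := volume.restrict K) (p := p) φ (q := 2) (by norm_num)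
    rw [hpq] at this
    simpa using this
  rw [h2] at h1
  have h3 := h1.trans (mul_le_mul_right (lintegral_norm_sq_add_le hd hφ) C)
  set X := eLpNorm φ (conjExp d) (volume.restrict K) with hX
  have hXt : X ≠ ⊤ := (h.eLpNorm_lt_top hφ.continuous _).ne
  rcases eq_or_ne X 0 with h0 | h0
  · rw [h0]; exact zero_le
  · rw [ENNReal.rpow_two, sq] at h3
    rw [← ENNReal.mul_le_mul_iff_right h0 hXt]
    refine h3.trans (le_of_eq (by ring))

variable (V) in
/-- The trace inequality `W^{1,2d/(d+1)}(K) → L²(∂K)` of a polytope, for smooth functions. -/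
theorem IsRep.exists_eLpNorm_two_frontier_le (h : IsRep K N) (hd : 2 ≤ d) :
    ∃ C : ℝ≥0∞, C ≠ ⊤ ∧ ∀ φ : E d → V, ContDiff ℝ 1 φ →
      eLpNorm φ 2 ((surf d).restrict (frontier K)) ≤
        C * w1Norm (sobExp d) (volume.restrict K) φ := by
  obtain ⟨C, hC, hle⟩ := h.exists_eLpNorm_conjExp_le V hd
  obtain ⟨D, hD, hle'⟩ := h.exists_lintegral_frontier_le ℝ (by omega)
  refine ⟨(D * (2 * C)) ^ (1 / 2 : ℝ), ENNReal.rpow_ne_top_of_nonneg (by norm_num)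
    (ENNReal.mul_ne_top hD (ENNReal.mul_ne_top (by simp) hC)), fun φ hφ => ?_⟩
  have h1 := hle' (fun x => ‖φ x‖ ^ 2) (hφ.norm_sq ℝ)
  rw [← eLpNorm_two_sq] at h1
  have h3 := h1.trans (mul_le_mul_right (lintegral_norm_sq_add_le hd hφ) D)
  set Y := w1Norm (sobExp d) (volume.restrict K) φ with hY
  rw [← ENNReal.rpow_le_rpow_iff (z := 2) (by norm_num), ENNReal.mul_rpow_of_nonneg _ _ (by norm_num),
    ← ENNReal.rpow_mul]
  refine h3.trans ?_
  rw [show (1 / 2 * 2 : ℝ) = 1 by norm_num, ENNReal.rpow_one, ENNReal.rpow_two, sq]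
  calc D * (2 * (eLpNorm φ (conjExp d) (volume.restrict K) * Y)) ≤ D * (2 * (C * Y * Y)) := by
        gcongr
        exact hle φ hφ
    _ = _ := by ring

end

end OldroydDG

namespace OldroydDG

section SmoothApprox

variable {d : ℕ} {V W : Type*} [NormedAddCommGroup V] [NormedSpace ℝ V]
  [NormedAddCommGroup W] [NormedSpace ℝ W]
  {Ω Ω' : Set (E d)} {q r : ℝ≥0∞} {φ ψ : ℕ → E d → V} {g g₁ : E d → V} {g' g₁' : Fin d → E d → V}

/-- The distance in `W^{1,q}(Ω)` between `φ n` and the function `g` with partial derivatives `g'`. -/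
noncomputable def w1Dist (Ω : Set (E d)) (q : ℝ≥0∞) (φ g : E d → V) (g' : Fin d → E d → V) : ℝ≥0∞ :=
  eLpNorm (fun x => φ x - g x) q (volume.restrict Ω) +
    ∑ j, eLpNorm (fun x => fderiv ℝ φ x (basisVec j) - g' j x) q (volume.restrict Ω)

namespace IsSmoothApprox

theorem tendsto_w1Dist (h : IsSmoothApprox Ω q φ g g') :
    Tendsto (fun n => w1Dist Ω q (φ n) g g') atTop (𝓝 0) := by
  have := h.tendsto.add (tendsto_finsetSum Finset.univ fun j _ => h.tendsto_fderiv j)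
  simpa [w1Dist] using this

theorem aestronglyMeasurable_fderiv (h : IsSmoothApprox Ω q φ g g') (n : ℕ) (j : Fin d)
    (μ : Measure (E d)) : AEStronglyMeasurable (fun x => fderiv ℝ (φ n) x (basisVec j)) μ := by
  have hc : Continuous (fderiv ℝ (φ n)) := (h.contDiff n).continuous_fderiv (by simp)
  have : Continuous fun x => fderiv ℝ (φ n) x (basisVec j) := by fun_prop
  exact this.aestronglyMeasurable

theorem w1Norm_sub_le (hq : 1 ≤ q) (hφ : IsSmoothApprox Ω q φ g g') (hψ : IsSmoothApprox Ω q ψ g g')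
    (n m : ℕ) : w1Norm q (volume.restrict Ω) (fun x => φ n x - ψ m x) ≤
      w1Dist Ω q (φ n) g g' + w1Dist Ω q (ψ m) g g' := by
  have key : ∀ {a b c : E d → V}, AEStronglyMeasurable a (volume.restrict Ω) →
      AEStronglyMeasurable b (volume.restrict Ω) → AEStronglyMeasurable c (volume.restrict Ω) →
      eLpNorm (fun x => a x - b x) q (volume.restrict Ω) ≤
        eLpNorm (fun x => a x - c x) q (volume.restrict Ω) +
          eLpNorm (fun x => b x - c x) q (volume.restrict Ω) := by
    intro a b c ha hb hc
    have e : (fun x => a x - b x) = (fun x => a x - c x) - fun x => b x - c x := by ext x; simp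
    rw [e]
    exact eLpNorm_sub_le (ha.sub hc) (hb.sub hc) hq
  unfold w1Norm w1Dist
  rw [add_add_add_comm, ← Finset.sum_add_distrib]
  refine add_le_add (key (hφ.contDiff n).continuous.aestronglyMeasurable
    (hψ.contDiff m).continuous.aestronglyMeasurable hφ.aesm) (Finset.sum_le_sum fun j _ => ?_)
  have e : (fun x => fderiv ℝ (fun x => φ n x - ψ m x) x (basisVec j)) =
      fun x => fderiv ℝ (φ n) x (basisVec j) - fderiv ℝ (ψ m) x (basisVec j) := by
    ext1 x
    rw [fderiv_fun_sub ((hφ.contDiff n).differentiable (by simp) x)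
      ((hψ.contDiff m).differentiable (by simp) x)]
    rfl
  rw [e]
  exact key (hφ.aestronglyMeasurable_fderiv n j _) (hψ.aestronglyMeasurable_fderiv m j _) (hφ.aesm' j)

theorem congr (h : IsSmoothApprox Ω q φ g g') (hg : g =ᵐ[volume.restrict Ω] g₁)
    (hg' : ∀ j, g' j =ᵐ[volume.restrict Ω] g₁' j) : IsSmoothApprox Ω q φ g₁ g₁' where
  aesm := h.aesm.congr hg
  aesm' j := (h.aesm' j).congr (hg' j)
  contDiff := h.contDiff
  tendsto := h.tendsto.congr fun n => eLpNorm_congr_ae (by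
    filter_upwards [hg] with x hx
    rw [hx])
  tendsto_fderiv j := (h.tendsto_fderiv j).congr fun n => eLpNorm_congr_ae (by
    filter_upwards [hg' j] with x hx
    rw [hx])

theorem mono (h : IsSmoothApprox Ω q φ g g') (hs : Ω' ⊆ Ω) : IsSmoothApprox Ω' q φ g g' where
  aesm := h.aesm.mono_measure (Measure.restrict_mono hs le_rfl)
  aesm' j := (h.aesm' j).mono_measure (Measure.restrict_mono hs le_rfl)
  contDiff := h.contDiff
  tendsto := tendsto_of_tendsto_of_tendsto_of_le_of_le tendsto_const_nhds h.tendsto (fun _ => zero_le)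
    fun _ => eLpNorm_mono_measure _ (Measure.restrict_mono hs le_rfl)
  tendsto_fderiv j := tendsto_of_tendsto_of_tendsto_of_le_of_le tendsto_const_nhds
    (h.tendsto_fderiv j) (fun _ => zero_le)
    fun _ => eLpNorm_mono_measure _ (Measure.restrict_mono hs le_rfl)

theorem of_exponent_le (h : IsSmoothApprox Ω q φ g g') (hΩ : volume Ω ≠ ⊤) (hr : r ≠ 0) (hrq : r ≤ q) :
    IsSmoothApprox Ω r φ g g' where
  aesm := h.aesm
  aesm' := h.aesm'
  contDiff := h.contDiff
  tendsto := by
    have : IsFiniteMeasure (volume.restrict Ω) := ⟨by rw [Measure.restrict_apply_univ]; exact hΩ.lt_top⟩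
    exact tendsto_eLpNorm_of_exponent_le hrq
      (fun n => (h.contDiff n).continuous.aestronglyMeasurable.sub h.aesm) h.tendsto hr
  tendsto_fderiv j := by
    have : IsFiniteMeasure (volume.restrict Ω) := ⟨by rw [Measure.restrict_apply_univ]; exact hΩ.lt_top⟩
    exact tendsto_eLpNorm_of_exponent_le hrq
      (fun n => (h.aestronglyMeasurable_fderiv n j _).sub (h.aesm' j)) (h.tendsto_fderiv j) hr

theorem clm_comp (h : IsSmoothApprox Ω q φ g g') (L : V →L[ℝ] W) :
    IsSmoothApprox Ω q (fun n x => L (φ n x)) (fun x => L (g x)) (fun j x => L (g' j x)) := by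
  have key : ∀ {a : ℕ → E d → V}, Tendsto (fun n => eLpNorm (a n) q (volume.restrict Ω)) atTop (𝓝 0) →
      Tendsto (fun n => eLpNorm (fun x => L (a n x)) q (volume.restrict Ω)) atTop (𝓝 0) := by
    intro a ha
    have h2 := ENNReal.Tendsto.const_mul (a := ENNReal.ofReal ‖L‖) ha (Or.inr (by simp))
    rw [mul_zero] at h2
    exact tendsto_of_tendsto_of_tendsto_of_le_of_le tendsto_const_nhds h2 (fun _ => zero_le)
      fun n => eLpNorm_le_mul_eLpNorm_of_ae_le_mul (Eventually.of_forall fun x => L.le_opNorm _) _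
  refine ⟨L.continuous.comp_aestronglyMeasurable h.aesm,
    fun j => L.continuous.comp_aestronglyMeasurable (h.aesm' j),
    fun n => L.contDiff.comp (h.contDiff n), ?_, fun j => ?_⟩
  · simpa [map_sub] using key h.tendsto
  · refine (key (h.tendsto_fderiv j)).congr fun n => ?_
    congr 1
    ext1 x
    have h1 : HasFDerivAt (fun x => L (φ n x)) _ x :=
      L.hasFDerivAt.comp x ((h.contDiff n).differentiable (by simp) x).hasFDerivAt
    rw [h1.fderiv]
    simp

theorem hasWeakPartial_tendstoW1 (h : IsSmoothApprox Ω q φ g g')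
    (hw : ∀ j, HasWeakPartial Ω j g (g' j)) : TendstoW1 Ω q φ g :=
  ⟨h.tendsto, fun j => ⟨g' j, hw j, h.tendsto_fderiv j⟩⟩

/-- A norm that is controlled by the norm of `W^{1,q}(Ω)` on smooth functions extends to the limits
of smooth functions. -/
theorem exists_limit [CompleteSpace V] (hφ : IsSmoothApprox Ω q φ g g') (hq : 1 ≤ q) (hr : 1 ≤ r)
    {ν : Measure (E d)} (hν : ∀ f : E d → V, Continuous f → MemLp f r ν) {C : ℝ≥0∞} (hC : C ≠ ⊤)
    (hle : ∀ f : E d → V, ContDiff ℝ 1 f → eLpNorm f r ν ≤ C * w1Norm q (volume.restrict Ω) f) :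
    ∃ τ, MemLp τ r ν ∧ ∀ ψ, IsSmoothApprox Ω q ψ g g' →
      Tendsto (fun n => eLpNorm (fun x => ψ n x - τ x) r ν) atTop (𝓝 0) := by
  have hlim : ∀ {ψ}, IsSmoothApprox Ω q ψ g g' →
      Tendsto (fun n => C * w1Dist Ω q (ψ n) g g') atTop (𝓝 0) := fun hψ => by
    simpa using ENNReal.Tendsto.const_mul (a := C) hψ.tendsto_w1Dist (Or.inr hC)
  have hsub : ∀ {ψ χ : ℕ → E d → V}, IsSmoothApprox Ω q ψ g g' → IsSmoothApprox Ω q χ g g' → ∀ n m,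
      eLpNorm (fun x => ψ n x - χ m x) r ν ≤
        C * w1Dist Ω q (ψ n) g g' + C * w1Dist Ω q (χ m) g g' := fun hψ hχ n m => by
    rw [← mul_add]
    refine (hle _ (((hψ.contDiff n).sub (hχ.contDiff m)).of_le (by simp))).trans ?_
    gcongr
    exact hψ.w1Norm_sub_le hq hχ n m
  obtain ⟨τ, hτ, hτ'⟩ := exists_memLp_of_cauchy hr (fun n => hν _ (hφ.contDiff n).continuous)
    (hlim hφ) (hsub hφ hφ)
  refine ⟨τ, hτ, fun ψ hψ => ?_⟩
  refine tendsto_of_tendsto_of_tendsto_of_le_of_le tendsto_const_nhds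
    (by simpa using ((hlim hψ).add (hlim hφ)).add hτ') (fun _ => zero_le) fun n => ?_
  have e : (fun x => ψ n x - τ x) = (fun x => ψ n x - φ n x) + fun x => φ n x - τ x := by ext x; simp
  rw [e]
  refine (eLpNorm_add_le ((hν _ (hψ.contDiff n).continuous).1.sub (hν _ (hφ.contDiff n).continuous).1)
    ((hν _ (hφ.contDiff n).continuous).1.sub hτ.1) hr).trans ?_
  exact add_le_add (hsub hψ hφ n n) le_rfl

end IsSmoothApprox

theorem TendstoW1.isSmoothApprox [CompleteSpace V] (hΩ : IsOpen Ω) (h : TendstoW1 Ω q φ g)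
    (hφ : ∀ n, ContDiff ℝ ∞ (φ n)) (hg : AEStronglyMeasurable g (volume.restrict Ω))
    (hw : ∀ j, HasWeakPartial Ω j g (g' j)) : IsSmoothApprox Ω q φ g g' where
  aesm := hg
  aesm' j := (hw j).2.1.aestronglyMeasurable
  contDiff := hφ
  tendsto := h.1
  tendsto_fderiv j := by
    obtain ⟨g₂, h1, h2⟩ := h.2 j
    refine h2.congr fun n => eLpNorm_congr_ae ?_
    filter_upwards [h1.unique hΩ (hw j)] with x hx
    rw [hx]

end SmoothApprox

section Trace

variable {d : ℕ} {K : Set (E d)} {N : Finset (E d × ℝ)} {V W : Type*}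
  [NormedAddCommGroup V] [NormedAddCommGroup W] {φ : ℕ → E d → V} {g g₁ : E d → V}
  {g' : Fin d → E d → V}

theorem IsRep.isFiniteMeasure_frontier (h : IsRep K N) :
    IsFiniteMeasure ((surf d).restrict (frontier K)) :=
  ⟨by rw [Measure.restrict_apply_univ]; exact h.surf_frontier_lt_top⟩

theorem IsRep.isFiniteMeasure_interior (h : IsRep K N) :
    IsFiniteMeasure (volume.restrict (interior K)) :=
  ⟨by
    rw [Measure.restrict_apply_univ]
    exact (measure_mono interior_subset).trans_lt h.isCompact.measure_lt_top⟩

theorem IsRep.memLp_frontier (h : IsRep K N) {f : E d → V} (hf : Continuous f) (p : ℝ≥0∞) :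
    MemLp f p ((surf d).restrict (frontier K)) := by
  have := h.isFiniteMeasure_frontier
  obtain ⟨C, hC⟩ := h.isCompact.exists_bound_of_continuousOn hf.continuousOn
  exact MemLp.of_bound hf.aestronglyMeasurable C
    (ae_restrict_of_forall_mem isClosed_frontier.measurableSet
      fun x hx => hC x (h.isClosed.frontier_subset hx))

theorem IsRep.memLp_interior (h : IsRep K N) {f : E d → V} (hf : Continuous f) (p : ℝ≥0∞) :
    MemLp f p (volume.restrict (interior K)) := by
  rw [h.volume_restrict_interior]
  exact ⟨hf.aestronglyMeasurable, h.eLpNorm_lt_top hf p⟩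

variable (V) in
theorem IsRep.exists_eLpNorm_one_frontier_le [NormedSpace ℝ V] [CompleteSpace V] (h : IsRep K N) (hd : 0 < d) :
    ∃ C : ℝ≥0∞, C ≠ ⊤ ∧ ∀ φ : E d → V, ContDiff ℝ 1 φ →
      eLpNorm φ 1 ((surf d).restrict (frontier K)) ≤
        C * w1Norm 1 (volume.restrict (interior K)) φ := by
  obtain ⟨C, hC, hle⟩ := h.exists_lintegral_frontier_le V hd
  refine ⟨C, hC, fun φ hφ => ?_⟩
  rw [eLpNorm_one_eq_lintegral_enorm, h.volume_restrict_interior]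
  refine (hle φ hφ).trans ?_
  unfold w1Norm
  gcongr
  · rw [eLpNorm_one_eq_lintegral_enorm]
  · rw [← eLpNorm_one_eq_lintegral_enorm]
    exact eLpNorm_fderiv_le le_rfl hφ

section Normed

variable [NormedSpace ℝ V] [NormedSpace ℝ W]

theorem isTrace_trace (h : ∃ τ, IsTrace K g τ) : IsTrace K g (trace K g) := by
  unfold trace
  rw [dif_pos h]
  exact h.choose_spec

/-- Smooth functions that converge in `W^{1,1}(K)` converge to the trace in `L¹(∂K)`. -/
theorem IsRep.tendsto_trace_one [CompleteSpace V] (h : IsRep K N) (hd : 0 < d)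
    (hφ : IsSmoothApprox (interior K) 1 φ g g')
    (hw : ∀ j, HasWeakPartial (interior K) j g (g' j)) :
    AEStronglyMeasurable (trace K g) ((surf d).restrict (frontier K)) ∧
      Tendsto (fun n => eLpNorm (fun x => φ n x - trace K g x) 1 ((surf d).restrict (frontier K)))
        atTop (𝓝 0) := by
  obtain ⟨C, hC, hle⟩ := h.exists_eLpNorm_one_frontier_le V hd
  obtain ⟨τ, hτ, hlim⟩ := hφ.exists_limit le_rfl le_rfl (fun f hf => h.memLp_frontier hf 1) hC hle
  obtain ⟨h1, ψ, hψ, hψ', hψτ⟩ := isTrace_trace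
    ⟨τ, hτ.1, φ, hφ.contDiff, hφ.hasWeakPartial_tendstoW1 hw, hlim φ hφ⟩
  have h2 : trace K g =ᵐ[(surf d).restrict (frontier K)] τ :=
    ae_eq_of_tendsto_eLpNorm le_rfl (fun n => (hψ n).continuous.aestronglyMeasurable) h1 hτ.1 hψτ
      (hlim ψ (hψ'.isSmoothApprox isOpen_interior hψ hφ.aesm hw))
  refine ⟨h1, (hlim φ hφ).congr fun n => eLpNorm_congr_ae ?_⟩
  filter_upwards [h2] with x hx
  rw [hx]

end Normed

section Inner

variable [InnerProductSpace ℝ V] [CompleteSpace V] [InnerProductSpace ℝ W] [CompleteSpace W]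

/-- Smooth functions that converge in `W^{1,2d/(d+1)}(K)` converge to the trace in `L²(∂K)`. -/
theorem IsRep.tendsto_trace_two (h : IsRep K N) (hd : 2 ≤ d)
    (hφ : IsSmoothApprox (interior K) (sobExp d) φ g g')
    (hw : ∀ j, HasWeakPartial (interior K) j g (g' j)) :
    MemLp (trace K g) 2 ((surf d).restrict (frontier K)) ∧
      Tendsto (fun n => eLpNorm (fun x => φ n x - trace K g x) 2 ((surf d).restrict (frontier K)))
        atTop (𝓝 0) := by
  obtain ⟨C, hC, hle⟩ := h.exists_eLpNorm_two_frontier_le V hd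
  rw [← h.volume_restrict_interior] at hle
  obtain ⟨τ, hτ, hlim⟩ := hφ.exists_limit (one_le_sobExp (by omega)) one_le_two
    (fun f hf => h.memLp_frontier hf 2) hC hle
  have := h.isFiniteMeasure_frontier
  have := h.isFiniteMeasure_interior
  have hvol : volume (interior K) ≠ ⊤ := by
    have := measure_ne_top (volume.restrict (interior K)) univ
    rwa [Measure.restrict_apply_univ] at this
  have hφm : ∀ n, AEStronglyMeasurable (φ n) ((surf d).restrict (frontier K)) :=
    fun n => (hφ.contDiff n).continuous.aestronglyMeasurable
  obtain ⟨h1, h2⟩ := h.tendsto_trace_one (by omega : 0 < d)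
    (hφ.of_exponent_le hvol one_ne_zero (one_le_sobExp (by omega))) hw
  have h3 : τ =ᵐ[(surf d).restrict (frontier K)] trace K g :=
    ae_eq_of_tendsto_eLpNorm le_rfl hφm hτ.1 h1
      (tendsto_eLpNorm_of_exponent_le one_le_two (fun n => (hφm n).sub hτ.1) (hlim φ hφ) one_ne_zero) h2
  refine ⟨(memLp_congr_ae h3).1 hτ, (hlim φ hφ).congr fun n => eLpNorm_congr_ae ?_⟩
  filter_upwards [h3] with x hx
  rw [hx]

/-- Smooth functions that converge in `W^{1,2d/(d+1)}(K)` converge in `L^{2d/(d-1)}(K)`. -/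
theorem IsRep.tendsto_conjExp (h : IsRep K N) (hd : 2 ≤ d)
    (hφ : IsSmoothApprox (interior K) (sobExp d) φ g g') :
    MemLp g (conjExp d) (volume.restrict (interior K)) ∧
      Tendsto (fun n => eLpNorm (fun x => φ n x - g x) (conjExp d) (volume.restrict (interior K)))
        atTop (𝓝 0) := by
  obtain ⟨C, hC, hle⟩ := h.exists_eLpNorm_conjExp_le V hd
  rw [← h.volume_restrict_interior] at hle
  obtain ⟨τ, hτ, hlim⟩ := hφ.exists_limit (one_le_sobExp (by omega)) (one_le_conjExp hd)
    (fun f hf => h.memLp_interior hf _) hC hle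
  have := h.isFiniteMeasure_interior
  have h1 := one_le_sobExp (by omega : 1 ≤ d)
  have hφm : ∀ n, AEStronglyMeasurable (φ n) (volume.restrict (interior K)) :=
    fun n => (hφ.contDiff n).continuous.aestronglyMeasurable
  have h3 : τ =ᵐ[volume.restrict (interior K)] g :=
    ae_eq_of_tendsto_eLpNorm h1 hφm hτ.1 hφ.aesm
      (tendsto_eLpNorm_of_exponent_le (sobExp_le_conjExp hd) (fun n => (hφm n).sub hτ.1) (hlim φ hφ)
        (zero_lt_one.trans_le h1).ne') hφ.tendsto
  refine ⟨(memLp_congr_ae h3).1 hτ, (hlim φ hφ).congr fun n => eLpNorm_congr_ae ?_⟩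
  filter_upwards [h3] with x hx
  rw [hx]

theorem exists_isSmoothApprox_weakPartial {Ω : Set (E d)} (hΩ : IsOpen Ω) (hcΩ : Convex ℝ Ω)
    (hne : Ω.Nonempty) (hd : 1 ≤ d) (hg : MemSobolev Ω (sobExp d) 1 g) :
    ∃ φ, IsSmoothApprox Ω (sobExp d) φ g fun j => weakPartial Ω j g :=
  exists_isSmoothApprox hΩ hcΩ hne (one_le_sobExp hd) (sobExp_ne_top d) hg.memLp
    (fun j => hg.hasWeakPartial j) fun j => (hg.weakPartial hΩ j).memLp

theorem IsRep.exists_isSmoothApprox (h : IsRep K N) (hd : 2 ≤ d)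
    (hg : MemSobolev (interior K) (sobExp d) 1 g) :
    ∃ φ, IsSmoothApprox (interior K) (sobExp d) φ g fun j => weakPartial (interior K) j g :=
  exists_isSmoothApprox_weakPartial isOpen_interior h.convex.interior h.nonempty (by omega) hg

theorem IsRep.memLp_trace (h : IsRep K N) (hd : 2 ≤ d) (hg : MemSobolev (interior K) (sobExp d) 1 g) :
    MemLp (trace K g) 2 ((surf d).restrict (frontier K)) := by
  obtain ⟨φ, hφ⟩ := h.exists_isSmoothApprox hd hg
  exact (h.tendsto_trace_two hd hφ fun j => hg.hasWeakPartial j).1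

theorem IsRep.memLp_conjExp (h : IsRep K N) (hd : 2 ≤ d) (hg : MemSobolev (interior K) (sobExp d) 1 g) :
    MemLp g (conjExp d) (volume.restrict (interior K)) := by
  obtain ⟨φ, hφ⟩ := h.exists_isSmoothApprox hd hg
  exact (h.tendsto_conjExp hd hφ).1

theorem IsRep.trace_ae_eq_of_tendsto (h : IsRep K N) (hd : 2 ≤ d)
    (hφ : IsSmoothApprox (interior K) (sobExp d) φ g g')
    (hw : ∀ j, HasWeakPartial (interior K) j g (g' j)) {s : Set (E d)} (hs : s ⊆ frontier K)
    {τ : E d → V} (hτ : AEStronglyMeasurable τ ((surf d).restrict s))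
    (hlim : Tendsto (fun n => eLpNorm (fun x => φ n x - τ x) 2 ((surf d).restrict s)) atTop (𝓝 0)) :
    trace K g =ᵐ[(surf d).restrict s] τ := by
  obtain ⟨h1, h2⟩ := h.tendsto_trace_two hd hφ hw
  have hle := Measure.restrict_mono (μ := surf d) hs le_rfl
  refine ae_eq_of_tendsto_eLpNorm one_le_two
    (fun n => (hφ.contDiff n).continuous.aestronglyMeasurable) (h1.1.mono_measure hle) hτ ?_ hlim
  exact tendsto_of_tendsto_of_tendsto_of_le_of_le tendsto_const_nhds h2 (fun _ => zero_le)
    fun _ => eLpNorm_mono_measure _ hle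

theorem IsRep.trace_congr (h : IsRep K N) (hd : 2 ≤ d) (hg : MemSobolev (interior K) (sobExp d) 1 g)
    (he : g =ᵐ[volume.restrict (interior K)] g₁) :
    trace K g =ᵐ[(surf d).restrict (frontier K)] trace K g₁ := by
  obtain ⟨φ, hφ⟩ := h.exists_isSmoothApprox hd hg
  have hw := fun j => hg.hasWeakPartial j
  have h2 := h.tendsto_trace_two hd (hφ.congr he fun j => EventuallyEq.rfl)
    fun j => (hw j).congr he EventuallyEq.rfl
  exact h.trace_ae_eq_of_tendsto hd hφ hw subset_rfl h2.1.1 h2.2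

theorem IsRep.trace_clm_comp (h : IsRep K N) (hd : 2 ≤ d)
    (hg : MemSobolev (interior K) (sobExp d) 1 g) (L : V →L[ℝ] W) :
    trace K (fun x => L (g x)) =ᵐ[(surf d).restrict (frontier K)] fun x => L (trace K g x) := by
  obtain ⟨φ, hφ⟩ := h.exists_isSmoothApprox hd hg
  have hw := fun j => hg.hasWeakPartial j
  obtain ⟨h1, h2⟩ := h.tendsto_trace_two hd hφ hw
  refine h.trace_ae_eq_of_tendsto hd (hφ.clm_comp L) (fun j => (hw j).clm_comp L) subset_rfl
    (L.continuous.comp_aestronglyMeasurable h1.1) ?_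
  have h3 := ENNReal.Tendsto.const_mul (a := ENNReal.ofReal ‖L‖) h2 (Or.inr (by simp))
  rw [mul_zero] at h3
  refine tendsto_of_tendsto_of_tendsto_of_le_of_le tendsto_const_nhds h3 (fun _ => zero_le)
    fun n => eLpNorm_le_mul_eLpNorm_of_ae_le_mul (Eventually.of_forall fun x => ?_) _
  rw [← map_sub]
  exact L.le_opNorm _

end Inner

end Trace

end OldroydDG

namespace OldroydDG

section IntegrationByParts

variable {d : ℕ} {K : Set (E d)} {N : Finset (E d × ℝ)} {V : Type*}
  [NormedAddCommGroup V] [InnerProductSpace ℝ V]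

theorem IsRep.facet_subset_frontier (h : IsRep K N) {p : E d × ℝ} (hp : p ∈ N) :
    K ∩ hyperplane p.1 p.2 ⊆ frontier K := by
  rw [h.frontier_eq]
  exact subset_biUnion_of_mem (u := fun p : E d × ℝ => K ∩ hyperplane p.1 p.2) hp

theorem IsRep.integrable_normal_mul (h : IsRep K N) {F : E d → ℝ}
    (hF : Integrable F ((surf d).restrict (frontier K))) (j : Fin d) :
    Integrable (fun x => normal K x j * F x) ((surf d).restrict (frontier K)) := by
  rw [h.surf_restrict_frontier, integrable_finsetSum_measure]
  intro p hp
  refine ((hF.mono_measure (Measure.restrict_mono (h.facet_subset_frontier hp) le_rfl)).const_mul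
    (p.1 j)).congr ?_
  filter_upwards [h.ae_facet_normal_eq hp] with x hx
  rw [hx]

theorem IsRep.setIntegral_normal_mul (h : IsRep K N) {F : E d → ℝ}
    (hF : Integrable F ((surf d).restrict (frontier K))) (j : Fin d) :
    ∫ x in frontier K, normal K x j * F x ∂(surf d) =
      ∑ p ∈ N, p.1 j * ∫ x in K ∩ hyperplane p.1 p.2, F x ∂(surf d) := by
  have h1 := h.integrable_normal_mul hF j
  rw [h.surf_restrict_frontier, integrable_finsetSum_measure] at h1
  rw [h.surf_restrict_frontier, integral_finsetSum_measure h1]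
  refine Finset.sum_congr rfl fun p hp => ?_
  rw [← integral_const_mul]
  refine integral_congr_ae ?_
  filter_upwards [h.ae_facet_normal_eq hp] with x hx
  rw [hx]

variable [CompleteSpace V] {g w : E d → V}

theorem IsRep.integrable_inner_trace (h : IsRep K N) (hd : 2 ≤ d)
    (hg : MemSobolev (interior K) (sobExp d) 1 g) (hw : MemSobolev (interior K) (sobExp d) 1 w) :
    Integrable (fun x => ⟪trace K g x, trace K w x⟫_ℝ) ((surf d).restrict (frontier K)) :=
  integrable_inner_of_memLp (p := 2) (q := 2) (h.memLp_trace hd hg) (h.memLp_trace hd hw)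

theorem IsRep.integrable_inner_left (h : IsRep K N) (hd : 2 ≤ d)
    (hg : MemLp g (sobExp d) (volume.restrict (interior K)))
    (hw : MemSobolev (interior K) (sobExp d) 1 w) :
    Integrable (fun x => ⟪g x, w x⟫_ℝ) (volume.restrict (interior K)) := by
  have := holderConjugate_sobExp hd
  exact integrable_inner_of_memLp hg (h.memLp_conjExp hd hw)

theorem IsRep.integrable_inner_right (h : IsRep K N) (hd : 2 ≤ d)
    (hg : MemSobolev (interior K) (sobExp d) 1 g)
    (hw : MemLp w (sobExp d) (volume.restrict (interior K))) :
    Integrable (fun x => ⟪g x, w x⟫_ℝ) (volume.restrict (interior K)) := by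
  exact (h.integrable_inner_left hd hw hg).congr (Eventually.of_forall fun _ => real_inner_comm _ _)

/-- Integration by parts on a polytope. -/
theorem IsRep.integral_by_parts (h : IsRep K N) (hd : 2 ≤ d)
    (hg : MemSobolev (interior K) (sobExp d) 1 g) (hw : MemSobolev (interior K) (sobExp d) 1 w)
    (j : Fin d) :
    (∫ x in interior K, ⟪weakPartial (interior K) j g x, w x⟫_ℝ) +
        ∫ x in interior K, ⟪g x, weakPartial (interior K) j w x⟫_ℝ =
      ∫ x in frontier K, normal K x j * ⟪trace K g x, trace K w x⟫_ℝ ∂(surf d) := by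
  have hpq := holderConjugate_sobExp hd
  have hpq' : ENNReal.HolderConjugate (conjExp d) (sobExp d) := hpq.symm
  obtain ⟨φ, hφ⟩ := h.exists_isSmoothApprox hd hg
  obtain ⟨ψ, hψ⟩ := h.exists_isSmoothApprox hd hw
  have hφt := h.tendsto_trace_two hd hφ fun j => hg.hasWeakPartial j
  have hψt := h.tendsto_trace_two hd hψ fun j => hw.hasWeakPartial j
  have hφc := h.tendsto_conjExp hd hφ
  have hψc := h.tendsto_conjExp hd hψ
  have hφC : ∀ n, Continuous (φ n) := fun n => (hφ.contDiff n).continuous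
  have hψC : ∀ n, Continuous (ψ n) := fun n => (hψ.contDiff n).continuous
  have hdφ : ∀ n, Continuous fun x => fderiv ℝ (φ n) x (basisVec j) := fun n => by
    have : Continuous (fderiv ℝ (φ n)) := (hφ.contDiff n).continuous_fderiv (by simp)
    fun_prop
  have hdψ : ∀ n, Continuous fun x => fderiv ℝ (ψ n) x (basisVec j) := fun n => by
    have : Continuous (fderiv ℝ (ψ n)) := (hψ.contDiff n).continuous_fderiv (by simp)
    fun_prop
  have hlhs := (tendsto_integral_inner (p := sobExp d) (q := conjExp d)
    (fun n => h.memLp_interior (hdφ n) _) (fun n => h.memLp_interior (hψC n) _)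
    (hg.weakPartial isOpen_interior j).memLp hψc.1 (hφ.tendsto_fderiv j) hψc.2).add
    (tendsto_integral_inner (p := conjExp d) (q := sobExp d)
    (fun n => h.memLp_interior (hφC n) _) (fun n => h.memLp_interior (hdψ n) _)
    hφc.1 (hw.weakPartial isOpen_interior j).memLp hφc.2 (hψ.tendsto_fderiv j))
  have hrhs : Tendsto (fun n => ∑ p ∈ N, p.1 j *
      ∫ x in K ∩ hyperplane p.1 p.2, ⟪φ n x, ψ n x⟫_ℝ ∂(surf d)) atTop
      (𝓝 (∑ p ∈ N, p.1 j *
        ∫ x in K ∩ hyperplane p.1 p.2, ⟪trace K g x, trace K w x⟫_ℝ ∂(surf d))) := by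
    refine tendsto_finsetSum _ fun p hp => Tendsto.const_mul _ ?_
    have hle := Measure.restrict_mono (μ := surf d) (h.facet_subset_frontier hp) le_rfl
    have hmono : ∀ {f : ℕ → E d → V},
        Tendsto (fun n => eLpNorm (f n) 2 ((surf d).restrict (frontier K))) atTop (𝓝 0) →
        Tendsto (fun n => eLpNorm (f n) 2 ((surf d).restrict (K ∩ hyperplane p.1 p.2))) atTop (𝓝 0) :=
      fun hf => tendsto_of_tendsto_of_tendsto_of_le_of_le tendsto_const_nhds hf (fun _ => zero_le)
        fun _ => eLpNorm_mono_measure _ hle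
    exact tendsto_integral_inner (p := 2) (q := 2)
      (fun n => (h.memLp_frontier (hφC n) 2).mono_measure hle)
      (fun n => (h.memLp_frontier (hψC n) 2).mono_measure hle)
      (hφt.1.mono_measure hle) (hψt.1.mono_measure hle) (hmono hφt.2) (hmono hψt.2)
  rw [h.setIntegral_normal_mul (h.integrable_inner_trace hd hg hw)]
  refine tendsto_nhds_unique hlhs (hrhs.congr fun n => ?_)
  have h1 := h.setIntegral_fderiv (by omega : 0 < d)
    (f := fun x => ⟪φ n x, ψ n x⟫_ℝ)
    (((hφ.contDiff n).inner ℝ (hψ.contDiff n)).of_le (by simp)) (basisVec j)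
  have e : ∀ x, fderiv ℝ (fun x => ⟪φ n x, ψ n x⟫_ℝ) x (basisVec j) =
      ⟪fderiv ℝ (φ n) x (basisVec j), ψ n x⟫_ℝ + ⟪φ n x, fderiv ℝ (ψ n) x (basisVec j)⟫_ℝ := by
    intro x
    rw [fderiv_inner_apply ℝ ((hφ.contDiff n).differentiable (by simp) x)
      ((hψ.contDiff n).differentiable (by simp) x), add_comm]
  simp_rw [e] at h1
  have hi : ∀ {f : E d → ℝ}, Continuous f → Integrable f (volume.restrict K) := fun hf =>
    hf.continuousOn.integrableOn_compact h.isCompact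
  have hφn := hφC n
  have hψn := hψC n
  have hdφn := hdφ n
  have hdψn := hdψ n
  rw [integral_add (hi (by fun_prop)) (hi (by fun_prop))] at h1
  rw [h.volume_restrict_interior, h1]
  refine Finset.sum_congr rfl fun p _ => ?_
  simp [EuclideanSpace.inner_single_right]

end IntegrationByParts

end OldroydDG

namespace OldroydDG

theorem measure_eq_zero_of_ae_restrict_false {X : Type*} [MeasurableSpace X] {μ : Measure X} {s : Set X}
    (h : ∀ᵐ _x ∂(μ.restrict s), False) : μ s = 0 := by
  rw [eventually_false_iff_eq_bot, ae_eq_bot, Measure.restrict_eq_zero] at h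
  exact h

section Domain

variable {d : ℕ} {O : Set (E d)}

namespace IsConvexPolyhedralDomain

theorem isOpen (hO : IsConvexPolyhedralDomain O) : IsOpen O := by
  obtain ⟨-, -, m, a, b, rfl⟩ := hO
  have : {x : E d | ∀ i, ⟪a i, x⟫_ℝ < b i} = ⋂ i, {x | ⟪a i, x⟫_ℝ < b i} := by
    ext x; simp
  rw [this]
  exact isOpen_iInter_of_finite fun i => isOpen_lt (by fun_prop) continuous_const

theorem convex (hO : IsConvexPolyhedralDomain O) : Convex ℝ O := by
  obtain ⟨-, -, m, a, b, rfl⟩ := hO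
  have : {x : E d | ∀ i, ⟪a i, x⟫_ℝ < b i} = ⋂ i, {x | ⟪a i, x⟫_ℝ < b i} := by
    ext x; simp
  rw [this]
  exact convex_iInter fun i => convex_halfSpace_lt (innerSL ℝ (a i)).isLinear _

theorem interior_closure (hO : IsConvexPolyhedralDomain O) : interior (closure O) = O := by
  rw [hO.convex.interior_closure_eq_interior_of_nonempty_interior
    (by rw [hO.isOpen.interior_eq]; exact hO.1), hO.isOpen.interior_eq]

theorem volume_lt_top (hO : IsConvexPolyhedralDomain O) : volume O < ⊤ :=
  hO.2.1.measure_lt_top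

/-- At each boundary point there is a unit normal vector. -/
theorem exists_isUnitNormal (hO : IsConvexPolyhedralDomain O) {x : E d} (hx : x ∈ frontier O) :
    ∃ ν, IsUnitNormal (closure O) x ν := by
  have hxO : x ∉ O := by
    rw [hO.isOpen.frontier_eq] at hx
    exact hx.2
  obtain ⟨f, hf⟩ := geometric_hahn_banach_open_point hO.convex hO.isOpen hxO
  set v : E d := (InnerProductSpace.toDual ℝ (E d)).symm f with hv
  have hfv : ∀ y, f y = ⟪v, y⟫_ℝ := fun y => by
    rw [hv, InnerProductSpace.toDual_symm_apply]
  have hv0 : v ≠ 0 := by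
    rintro h0
    obtain ⟨y, hy⟩ := hO.1
    have := hf y hy
    simp [hfv, h0] at this
  refine ⟨‖v‖⁻¹ • v, norm_smul_inv_norm hv0, fun y hy => ?_⟩
  have h1 : closure O ⊆ {y | ⟪v, y⟫_ℝ ≤ ⟪v, x⟫_ℝ} :=
    closure_minimal (fun y hy => by simpa [hfv] using (hf y hy).le)
      (isClosed_le (by fun_prop) continuous_const)
  have h2 : ⟪v, y⟫_ℝ ≤ ⟪v, x⟫_ℝ := h1 hy
  rw [real_inner_smul_left, inner_sub_right]
  exact mul_nonpos_of_nonneg_of_nonpos (by positivity) (by linarith)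

end IsConvexPolyhedralDomain

end Domain

section Geometry

variable {d : ℕ} {O K K' L : Set (E d)} {N N' : Finset (E d × ℝ)}

theorem IsUnitNormal.mono {x ν : E d} (h : IsUnitNormal K' x ν) (hs : K ⊆ K') : IsUnitNormal K x ν :=
  ⟨h.1, fun y hy => h.2 y (hs hy)⟩

theorem IsRep.ae_normal (h : IsRep K N) : ∀ᵐ x ∂((surf d).restrict (frontier K)),
    ‖normal K x‖ = 1 ∧ ∀ ν, IsUnitNormal K x ν → normal K x = ν := by
  filter_upwards [h.ae_existsUnique_isUnitNormal] with x hx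
  exact ⟨(isUnitNormal_normal hx.exists).1, fun ν hν => hx.unique (isUnitNormal_normal hx.exists) hν⟩

theorem IsRep.closure_interior (h : IsRep K N) : closure (interior K) = K := by
  rw [h.convex.closure_interior_eq_closure_of_nonempty_interior h.nonempty, h.isClosed.closure_eq]

/-- Polytopes with disjoint interiors have a separating unit vector, which is normal to both at all
common points. -/
theorem IsRep.exists_isUnitNormal (h : IsRep K N) (h' : IsRep K' N')
    (hd : Disjoint (interior K) (interior K')) :
    ∃ ν : E d, ∀ x ∈ K ∩ K', IsUnitNormal K x ν ∧ IsUnitNormal K' x (-ν) := by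
  obtain ⟨f, u, hf, hf'⟩ := geometric_hahn_banach_open h.convex.interior isOpen_interior
    h'.convex.interior hd
  set v : E d := (InnerProductSpace.toDual ℝ (E d)).symm f with hv
  have hfv : ∀ y, f y = ⟪v, y⟫_ℝ := fun y => by
    rw [hv, InnerProductSpace.toDual_symm_apply]
  have hv0 : v ≠ 0 := by
    rintro h0
    obtain ⟨y, hy⟩ := h.nonempty
    obtain ⟨z, hz⟩ := h'.nonempty
    have h1 := hf y hy
    have h2 := hf' z hz
    simp only [hfv, h0, inner_zero_left] at h1 h2
    linarith
  have h1 : K ⊆ {y | ⟪v, y⟫_ℝ ≤ u} := by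
    rw [← h.closure_interior]
    exact closure_minimal (fun y hy => by simpa [hfv] using (hf y hy).le)
      (isClosed_le (by fun_prop) continuous_const)
  have h2 : K' ⊆ {y | u ≤ ⟪v, y⟫_ℝ} := by
    rw [← h'.closure_interior]
    exact closure_minimal (fun y hy => by simpa [hfv] using hf' y hy)
      (isClosed_le continuous_const (by fun_prop))
  refine ⟨‖v‖⁻¹ • v, fun x hx => ?_⟩
  have hx1 : ⟪v, x⟫_ℝ ≤ u := h1 hx.1
  have hx2 : u ≤ ⟪v, x⟫_ℝ := h2 hx.2
  have hpos : 0 ≤ ‖v‖⁻¹ := by positivity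
  have hn : ‖‖v‖⁻¹ • v‖ = 1 := norm_smul_inv_norm hv0
  refine ⟨⟨hn, fun y hy => ?_⟩, ⟨by rw [norm_neg, hn], fun y hy => ?_⟩⟩
  · have hy1 : ⟪v, y⟫_ℝ ≤ u := h1 hy
    rw [real_inner_smul_left, inner_sub_right]
    exact mul_nonpos_of_nonneg_of_nonpos hpos (by linarith)
  · have hy2 : u ≤ ⟪v, y⟫_ℝ := h2 hy
    rw [inner_neg_left, real_inner_smul_left, inner_sub_right, neg_nonpos]
    exact mul_nonneg hpos (by linarith)

theorem IsRep.ae_normal_eq_neg (h : IsRep K N) (h' : IsRep K' N')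
    (hd : Disjoint (interior K) (interior K')) :
    ∀ᵐ x ∂((surf d).restrict (frontier K ∩ frontier K')), normal K' x = -normal K x := by
  obtain ⟨ν, hν⟩ := h.exists_isUnitNormal h' hd
  filter_upwards [ae_restrict_mem (isClosed_frontier.inter isClosed_frontier).measurableSet,
    ae_restrict_of_ae_restrict_of_subset inter_subset_left h.ae_normal,
    ae_restrict_of_ae_restrict_of_subset inter_subset_right h'.ae_normal] with x hx h1 h2
  obtain ⟨h3, h4⟩ := hν x ⟨h.isClosed.frontier_subset hx.1, h'.isClosed.frontier_subset hx.2⟩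
  rw [h1.2 ν h3, h2.2 _ h4]

theorem IsRep.aedisjoint_frontier_inter {L : Set (E d)} {M : Finset (E d × ℝ)} (h : IsRep K N)
    (h' : IsRep K' N') (h'' : IsRep L M) (hd : Disjoint (interior K) (interior K'))
    (hd' : Disjoint (interior K) (interior L)) (hd'' : Disjoint (interior K') (interior L)) :
    AEDisjoint (surf d) (frontier K ∩ frontier K') (frontier K ∩ frontier L) := by
  refine measure_eq_zero_of_ae_restrict_false ?_
  filter_upwards [ae_restrict_of_ae_restrict_of_subset inter_subset_left (h.ae_normal_eq_neg h' hd),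
    ae_restrict_of_ae_restrict_of_subset inter_subset_right (h.ae_normal_eq_neg h'' hd'),
    ae_restrict_of_ae_restrict_of_subset (fun x hx => (⟨hx.1.2, hx.2.2⟩ : x ∈ frontier K' ∩ frontier L))
      (h'.ae_normal_eq_neg h'' hd''),
    ae_restrict_of_ae_restrict_of_subset (fun x hx => hx.1.1) h.ae_normal] with x h1 h2 h3 h4
  rw [h1, h2, neg_neg] at h3
  have h5 : normal K x = 0 := by
    have h6 : (2 : ℝ) • normal K x = 0 := by
      rw [two_smul]; nth_rewrite 1 [← h3]; simp
    simpa using h6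
  rw [h5, norm_zero] at h4
  exact zero_ne_one h4.1

theorem IsRep.surf_frontier_inter_frontier (h : IsRep K N) (h' : IsRep K' N')
    (hd : Disjoint (interior K) (interior K')) (hO : IsConvexPolyhedralDomain O)
    (hK : K ⊆ closure O) (hK' : K' ⊆ closure O) :
    surf d ((frontier K ∩ frontier K') ∩ frontier O) = 0 := by
  refine measure_eq_zero_of_ae_restrict_false ?_
  filter_upwards [ae_restrict_mem
      ((isClosed_frontier.inter isClosed_frontier).inter isClosed_frontier).measurableSet,
    ae_restrict_of_ae_restrict_of_subset inter_subset_left (h.ae_normal_eq_neg h' hd),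
    ae_restrict_of_ae_restrict_of_subset (fun x hx => hx.1.1) h.ae_normal,
    ae_restrict_of_ae_restrict_of_subset (fun x hx => hx.1.2) h'.ae_normal] with x hx h1 h2 h3
  obtain ⟨ν, hν⟩ := hO.exists_isUnitNormal hx.2
  rw [h2.2 ν (hν.mono hK), h3.2 ν (hν.mono hK')] at h1
  have h5 : ν = 0 := by
    have h6 : (2 : ℝ) • ν = 0 := by
      rw [two_smul]; nth_rewrite 1 [h1]; simp
    simpa using h6
  have := hν.1
  rw [h5, norm_zero] at this
  exact zero_ne_one this

end Geometry

namespace Mesh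

variable {d : ℕ} {O K K' : Set (E d)} (𝒦 : Mesh O)

theorem exists_isRep (hK : K ∈ 𝒦.elems) : ∃ N, IsRep K N := (𝒦.polytope K hK).exists_isRep

theorem subset_closure (hK : K ∈ 𝒦.elems) : K ⊆ closure O := by
  rw [← 𝒦.cover]
  exact subset_biUnion_of_mem (u := fun K => K) hK

theorem interior_subset (hO : IsConvexPolyhedralDomain O) (hK : K ∈ 𝒦.elems) : interior K ⊆ O :=
  (interior_mono (𝒦.subset_closure hK)).trans_eq hO.interior_closure

theorem frontier_subset (hO : IsConvexPolyhedralDomain O) (hK : K ∈ 𝒦.elems) {x : E d}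
    (hx : x ∈ frontier K) : x ∈ frontier O ∨ ∃ K' ∈ 𝒦.elems, K' ≠ K ∧ x ∈ frontier K' := by
  obtain ⟨N, h⟩ := 𝒦.exists_isRep hK
  by_cases hxO : x ∈ frontier O
  · exact Or.inl hxO
  refine Or.inr ?_
  have hxK := h.isClosed.frontier_subset hx
  have hxO' : x ∈ O := by
    by_contra hn
    exact hxO (by rw [hO.isOpen.frontier_eq]; exact ⟨𝒦.subset_closure hK hxK, hn⟩)
  have hxi : x ∉ interior K := by
    rw [h.isClosed.frontier_eq] at hx
    exact hx.2
  have hex : ∃ K' ∈ 𝒦.elems, K' ≠ K ∧ x ∈ K' := by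
    by_contra! hcon
    refine hxi ?_
    have h1 : ∀ᶠ y in 𝓝 x, ∀ K' ∈ 𝒦.elems, K' ≠ K → y ∉ K' := by
      rw [Filter.eventually_all_finset]
      intro K' hK'
      by_cases hne : K' = K
      · exact Eventually.of_forall fun y hy => absurd hne hy
      · obtain ⟨N', h'⟩ := 𝒦.exists_isRep hK'
        filter_upwards [h'.isClosed.isOpen_compl.mem_nhds (hcon K' hK' hne)] with y hy _ using hy
    rw [mem_interior_iff_mem_nhds]
    filter_upwards [h1, hO.isOpen.mem_nhds hxO'] with y hy hyO
    have h2 : y ∈ ⋃ K ∈ 𝒦.elems, K := by rw [𝒦.cover]; exact _root_.subset_closure hyO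
    simp only [mem_iUnion, exists_prop] at h2
    obtain ⟨K', hK', hyK'⟩ := h2
    by_cases hne : K' = K
    · exact hne ▸ hyK'
    · exact absurd hyK' (hy K' hK' hne)
  obtain ⟨K', hK', hne, hxK'⟩ := hex
  obtain ⟨N', h'⟩ := 𝒦.exists_isRep hK'
  refine ⟨K', hK', hne, ?_⟩
  rw [h'.isClosed.frontier_eq]
  refine ⟨hxK', fun hxi' => ?_⟩
  rw [← h.closure_interior] at hxK
  obtain ⟨y, hy1, hy2⟩ := mem_closure_iff.1 hxK _ isOpen_interior hxi'
  exact Set.disjoint_left.1 (𝒦.disjoint K hK K' hK' hne.symm) hy2 hy1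

open Classical in
theorem frontier_eq (hO : IsConvexPolyhedralDomain O) (hK : K ∈ 𝒦.elems) :
    frontier K = (⋃ K' ∈ 𝒦.elems.filter (· ≠ K), frontier K ∩ frontier K') ∪
      (frontier K ∩ frontier O) := by
  ext x
  simp only [mem_union, mem_iUnion, mem_inter_iff, exists_prop, Finset.mem_filter]
  constructor
  · intro hx
    rcases 𝒦.frontier_subset hO hK hx with h | ⟨K', h1, h2, h3⟩
    · exact Or.inr ⟨hx, h⟩
    · exact Or.inl ⟨K', ⟨h1, h2⟩, hx, h3⟩
  · rintro (⟨K', -, hx, -⟩ | hx)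
    · exact hx
    · exact hx.1

open Classical in
theorem setIntegral_frontier (hO : IsConvexPolyhedralDomain O) (hK : K ∈ 𝒦.elems) {G : E d → ℝ}
    (hG : IntegrableOn G (frontier K) (surf d)) :
    ∫ x in frontier K, G x ∂(surf d) =
      (∑ K' ∈ 𝒦.elems with K' ≠ K, ∫ x in frontier K ∩ frontier K', G x ∂(surf d)) +
        ∫ x in frontier K ∩ frontier O, G x ∂(surf d) := by
  obtain ⟨N, h⟩ := 𝒦.exists_isRep hK
  conv_lhs => rw [𝒦.frontier_eq hO hK]
  rw [setIntegral_union₀, setIntegral_biUnion_finset_of_aedisjoint]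
  · intro K₁ h₁ K₂ h₂ hne
    simp only [Finset.coe_filter, Set.mem_ofPred_eq] at h₁ h₂
    obtain ⟨N₁, hr₁⟩ := 𝒦.exists_isRep h₁.1
    obtain ⟨N₂, hr₂⟩ := 𝒦.exists_isRep h₂.1
    exact h.aedisjoint_frontier_inter hr₁ hr₂ (𝒦.disjoint K hK K₁ h₁.1 h₁.2.symm)
      (𝒦.disjoint K hK K₂ h₂.1 h₂.2.symm) (𝒦.disjoint K₁ h₁.1 K₂ h₂.1 hne)
  · exact fun K' _ => (isClosed_frontier.inter isClosed_frontier).measurableSet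
  · exact fun K' _ => hG.mono_set inter_subset_left
  · rw [AEDisjoint, iUnion₂_inter]
    refine (measure_biUnion_null_iff (Finset.countable_toSet _)).2 fun K' hK' => ?_
    simp only [Finset.coe_filter, Set.mem_ofPred_eq] at hK'
    obtain ⟨N', h'⟩ := 𝒦.exists_isRep hK'.1
    refine measure_mono_null ?_ (h.surf_frontier_inter_frontier h'
      (𝒦.disjoint K hK K' hK'.1 hK'.2.symm) hO (𝒦.subset_closure hK) (𝒦.subset_closure hK'.1))
    exact inter_subset_inter_right _ inter_subset_right
  · exact (isClosed_frontier.inter isClosed_frontier).measurableSet.nullMeasurableSet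
  · exact hG.mono_set (iUnion₂_subset fun K' _ => inter_subset_left)
  · exact hG.mono_set inter_subset_left

end Mesh

end OldroydDG

namespace OldroydDG

variable {d : ℕ} {O K K' F F' : Set (E d)} {N : Finset (E d × ℝ)}

theorem IsFacet.subset (hF : IsFacet K F) : F ⊆ K := by
  obtain ⟨-, n, b, -, -, rfl⟩ := hF
  exact fun x hx => hx.1

theorem IsFacet.isClosed (hF : IsFacet K F) (hK : IsClosed K) : IsClosed F := by
  obtain ⟨-, n, b, -, -, rfl⟩ := hF
  exact hK.inter (isClosed_eq (by fun_prop) continuous_const)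

theorem IsFacet.exists_unit (hF : IsFacet K F) : ∃ (ν : E d) (c : ℝ), ‖ν‖ = 1 ∧
    (∀ x ∈ K, ⟪ν, x⟫_ℝ ≤ c) ∧ F = {x ∈ K | ⟪ν, x⟫_ℝ = c} := by
  obtain ⟨-, n, b, hn, hle, rfl⟩ := hF
  have hpos : 0 < ‖n‖⁻¹ := by positivity
  refine ⟨‖n‖⁻¹ • n, ‖n‖⁻¹ * b, norm_smul_inv_norm hn, fun x hx => ?_, ?_⟩
  · rw [real_inner_smul_left]
    exact mul_le_mul_of_nonneg_left (hle x hx) hpos.le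
  · ext x
    simp only [Set.mem_ofPred_eq, real_inner_smul_left, mul_right_inj' hpos.ne']

/-- Two different facets of a polytope meet in a set of surface measure zero. -/
theorem IsRep.aedisjoint_isFacet (h : IsRep K N) (hF : IsFacet K F) (hF' : IsFacet K F')
    (hs : F ⊆ frontier K) (hne : F ≠ F') : AEDisjoint (surf d) F F' := by
  obtain ⟨ν, c, hν, hle, e⟩ := hF.exists_unit
  obtain ⟨ν', c', hν', hle', e'⟩ := hF'.exists_unit
  refine measure_eq_zero_of_ae_restrict_false ?_
  filter_upwards [ae_restrict_mem ((hF.isClosed h.isClosed).inter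
    (hF'.isClosed h.isClosed)).measurableSet,
    ae_restrict_of_ae_restrict_of_subset (inter_subset_left.trans hs) h.ae_normal] with x hx h1
  have h2 : ⟪ν, x⟫_ℝ = c := by have := hx.1; rw [e] at this; exact this.2
  have h3 : ⟪ν', x⟫_ℝ = c' := by have := hx.2; rw [e'] at this; exact this.2
  have h4 := h1.2 ν ⟨hν, fun y hy => by rw [inner_sub_right, h2]; linarith [hle y hy]⟩
  have h5 := h1.2 ν' ⟨hν', fun y hy => by rw [inner_sub_right, h3]; linarith [hle' y hy]⟩
  have h6 : ν = ν' := h4.symm.trans h5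
  refine hne ?_
  rw [e, e', ← h2, ← h3, h6]

namespace Mesh

variable (𝒦 : Mesh O)

theorem bface_subset_frontier (hO : IsConvexPolyhedralDomain O) {P : Set (E d) × Set (E d)}
    (hP : P ∈ 𝒦.bfaces) : P.2 ⊆ frontier P.1 := by
  obtain ⟨h1, h2, h3⟩ := (𝒦.bfaces_mem P).1 hP
  obtain ⟨N, h⟩ := 𝒦.exists_isRep h1
  intro x hx
  rw [h.isClosed.frontier_eq]
  refine ⟨h2.subset hx, fun hxi => ?_⟩
  have := h3 hx
  rw [hO.isOpen.frontier_eq] at this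
  exact this.2 (𝒦.interior_subset hO h1 hxi)

open Classical in
theorem biUnion_bfaces_ae_eq (hO : IsConvexPolyhedralDomain O) (hK : K ∈ 𝒦.elems) :
    (frontier K ∩ frontier O : Set (E d)) =ᵐ[surf d]
      (⋃ P ∈ 𝒦.bfaces.filter (·.1 = K), P.2 : Set (E d)) := by
  refine ae_eq_set.2 ⟨?_, ?_⟩
  swap
  · refine measure_mono_null ?_ (measure_empty (μ := surf d))
    rintro x ⟨hx, hx'⟩
    simp only [mem_iUnion, Finset.mem_filter, exists_prop] at hx
    obtain ⟨P, ⟨hP, rfl⟩, hxP⟩ := hx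
    exact hx' ⟨𝒦.bface_subset_frontier hO hP hxP, ((𝒦.bfaces_mem P).1 hP).2.2 hxP⟩
  obtain ⟨N, h⟩ := 𝒦.exists_isRep hK
  obtain ⟨m, a, b, hOe⟩ := hO.2.2
  have hcl : closure O ⊆ {x | ∀ i, ⟪a i, x⟫_ℝ ≤ b i} := by
    refine closure_minimal (fun x hx i => ?_) ?_
    · rw [hOe] at hx
      exact (hx i).le
    · have : {x : E d | ∀ i, ⟪a i, x⟫_ℝ ≤ b i} = ⋂ i, {x | ⟪a i, x⟫_ℝ ≤ b i} := by ext x; simp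
      rw [this]
      exact isClosed_iInter fun i => isClosed_le (by fun_prop) continuous_const
  have hfr : ∀ i x, x ∈ K → ⟪a i, x⟫_ℝ = b i → x ∈ frontier O := by
    intro i x hx he
    rw [hO.isOpen.frontier_eq]
    refine ⟨𝒦.subset_closure hK hx, fun hxO => ?_⟩
    rw [hOe] at hxO
    exact (hxO i).ne he
  have hface : ∀ i, surf d {x ∈ K | ⟪a i, x⟫_ℝ = b i} ≠ 0 → (K, {x ∈ K | ⟪a i, x⟫_ℝ = b i}) ∈ 𝒦.bfaces := by
    intro i hi
    refine (𝒦.bfaces_mem _).2 ⟨hK, ⟨pos_iff_ne_zero.2 hi, a i, b i, ?_, fun x hx => ?_, rfl⟩,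
      fun x hx => hfr i x hx.1 hx.2⟩
    · intro h0
      refine hi (measure_mono_null ?_ (measure_empty (μ := surf d)))
      rintro x ⟨-, hx⟩
      obtain ⟨y, hy⟩ := hO.1
      rw [hOe] at hy
      have := hy i
      rw [h0, inner_zero_left] at this hx
      exact this.ne hx
    · exact hcl (𝒦.subset_closure hK hx) i
  refine measure_mono_null (t := ⋃ i ∈ {i | surf d {x ∈ K | ⟪a i, x⟫_ℝ = b i} = 0},
    {x ∈ K | ⟪a i, x⟫_ℝ = b i}) ?_ ((measure_biUnion_null_iff (Set.to_countable _)).2 fun i hi => hi)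
  rintro x ⟨⟨hxK, hxO⟩, hx⟩
  have hxK' := h.isClosed.frontier_subset hxK
  rw [hO.isOpen.frontier_eq] at hxO
  have hxO2 : ∃ i, ⟪a i, x⟫_ℝ = b i := by
    by_contra! hcon
    refine hxO.2 ?_
    rw [hOe]
    exact fun i => lt_of_le_of_ne (hcl hxO.1 i) (hcon i)
  obtain ⟨i, hi⟩ := hxO2
  simp only [mem_iUnion, exists_prop]
  refine ⟨i, ?_, hxK', hi⟩
  by_contra hne
  refine hx ?_
  simp only [mem_iUnion, Finset.mem_filter, exists_prop]
  exact ⟨_, ⟨hface i hne, rfl⟩, hxK', hi⟩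

open Classical in
theorem setIntegral_frontier_inter (hO : IsConvexPolyhedralDomain O) (hK : K ∈ 𝒦.elems) {G : E d → ℝ}
    (hG : IntegrableOn G (frontier K) (surf d)) :
    ∫ x in frontier K ∩ frontier O, G x ∂(surf d) =
      ∑ P ∈ 𝒦.bfaces with P.1 = K, ∫ x in P.2, G x ∂(surf d) := by
  obtain ⟨N, h⟩ := 𝒦.exists_isRep hK
  rw [Measure.restrict_congr_set (𝒦.biUnion_bfaces_ae_eq hO hK),
    setIntegral_biUnion_finset_of_aedisjoint]
  · intro P hP Q hQ hne
    simp only [Finset.coe_filter, Set.mem_ofPred_eq] at hP hQ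
    obtain ⟨hP, rfl⟩ := hP
    obtain ⟨hQ, hQP⟩ := hQ
    obtain ⟨-, h2, -⟩ := (𝒦.bfaces_mem P).1 hP
    obtain ⟨-, h3, -⟩ := (𝒦.bfaces_mem Q).1 hQ
    rw [hQP] at h3
    exact h.aedisjoint_isFacet h2 h3 (𝒦.bface_subset_frontier hO hP)
      fun he => hne (Prod.ext hQP.symm he)
  · intro P hP
    obtain ⟨hP', rfl⟩ := Finset.mem_filter.1 hP
    exact (((𝒦.bfaces_mem P).1 hP').2.1.isClosed h.isClosed).measurableSet
  · intro P hP
    obtain ⟨hP', rfl⟩ := Finset.mem_filter.1 hP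
    exact hG.mono_set (𝒦.bface_subset_frontier hO hP')

open Classical in
theorem sum_offDiag (I : Set (E d) → Set (E d) → ℝ)
    (hI : ∀ K K', surf d (frontier K ∩ frontier K') = 0 → I K K' = 0) :
    ∑ K ∈ 𝒦.elems, ∑ K' ∈ 𝒦.elems with K' ≠ K, I K K' = ∑ P ∈ 𝒦.ifaces, (I P.1 P.2 + I P.2 P.1) := by
  have h1 : ∑ K ∈ 𝒦.elems, ∑ K' ∈ 𝒦.elems with K' ≠ K, I K K' =
      ∑ P ∈ 𝒦.elems.offDiag, I P.1 P.2 := by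
    rw [Finset.sum_sigma']
    refine Finset.sum_bij' (fun s _ => (s.1, s.2)) (fun P _ => ⟨P.1, P.2⟩) ?_ ?_ ?_ ?_ ?_
    · intro s hs
      simp only [Finset.mem_sigma, Finset.mem_filter] at hs
      exact Finset.mem_offDiag.2 ⟨hs.1, hs.2.1, hs.2.2.symm⟩
    · intro P hP
      obtain ⟨h1, h2, h3⟩ := Finset.mem_offDiag.1 hP
      simp only [Finset.mem_sigma, Finset.mem_filter]
      exact ⟨h1, h2, h3.symm⟩
    all_goals intros; rfl
  have horient : ∀ P ∈ 𝒦.ifaces, P.swap ∉ 𝒦.ifaces := by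
    intro P hP
    obtain ⟨h1, h2, h3, h4⟩ := 𝒦.ifaces_mem P hP
    exact (𝒦.ifaces_orient P.1 h1 P.2 h2 h3 h4).1 hP
  have hdisj : Disjoint 𝒦.ifaces (𝒦.ifaces.image Prod.swap) := by
    rw [Finset.disjoint_left]
    rintro P hP hP'
    obtain ⟨Q, hQ, rfl⟩ := Finset.mem_image.1 hP'
    exact horient Q hQ hP
  have h2 : ∑ P ∈ 𝒦.elems.offDiag, I P.1 P.2 =
      ∑ P ∈ 𝒦.ifaces ∪ 𝒦.ifaces.image Prod.swap, I P.1 P.2 := by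
    refine (Finset.sum_subset ?_ ?_).symm
    · intro P hP
      rcases Finset.mem_union.1 hP with hP | hP
      · obtain ⟨h1, h2, h3, -⟩ := 𝒦.ifaces_mem P hP
        exact Finset.mem_offDiag.2 ⟨h1, h2, h3⟩
      · obtain ⟨Q, hQ, rfl⟩ := Finset.mem_image.1 hP
        obtain ⟨h1, h2, h3, -⟩ := 𝒦.ifaces_mem Q hQ
        exact Finset.mem_offDiag.2 ⟨h2, h1, h3.symm⟩
    · intro P hP hP'
      obtain ⟨h1, h2, h3⟩ := Finset.mem_offDiag.1 hP
      refine hI _ _ ?_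
      by_contra hne
      refine hP' (Finset.mem_union.2 ?_)
      by_cases hmem : P ∈ 𝒦.ifaces
      · exact Or.inl hmem
      · right
        have h4 := 𝒦.ifaces_orient P.1 h1 P.2 h2 h3 (pos_iff_ne_zero.2 hne)
        have h5 : (P.2, P.1) ∈ 𝒦.ifaces := by
          by_contra h6
          exact hmem (h4.2 h6)
        exact Finset.mem_image.2 ⟨_, h5, rfl⟩
  rw [h1, h2, Finset.sum_union hdisj, Finset.sum_image (fun _ _ _ _ h => Prod.swap_injective h),
    Finset.sum_add_distrib]
  rfl

/-- A sum of integrals over the boundaries of the elements, as a sum over the faces. -/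
theorem sum_setIntegral_frontier (hO : IsConvexPolyhedralDomain O) {G : Set (E d) → E d → ℝ}
    (hG : ∀ K ∈ 𝒦.elems, IntegrableOn (G K) (frontier K) (surf d)) :
    ∑ K ∈ 𝒦.elems, ∫ x in frontier K, G K x ∂(surf d) =
      (∑ P ∈ 𝒦.ifaces, ∫ x in frontier P.1 ∩ frontier P.2, (G P.1 x + G P.2 x) ∂(surf d)) +
        ∑ P ∈ 𝒦.bfaces, ∫ x in P.2, G P.1 x ∂(surf d) := by
  classical
  rw [Finset.sum_congr rfl fun K hK => 𝒦.setIntegral_frontier hO hK (hG K hK), Finset.sum_add_distrib,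
    Finset.sum_congr rfl fun K hK => 𝒦.setIntegral_frontier_inter hO hK (hG K hK),
    𝒦.sum_offDiag (fun K K' => ∫ x in frontier K ∩ frontier K', G K x ∂(surf d))
      fun K K' h => setIntegral_measure_zero _ h]
  congr 1
  · refine Finset.sum_congr rfl fun P hP => ?_
    obtain ⟨h1, h2, -, -⟩ := 𝒦.ifaces_mem P hP
    rw [integral_add ((hG _ h1).mono_set inter_subset_left) ((hG _ h2).mono_set inter_subset_right),
      inter_comm (frontier P.2)]
  · rw [← Finset.sum_fiberwise_of_maps_to (g := Prod.fst) (t := 𝒦.elems)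
      fun P hP => ((𝒦.bfaces_mem P).1 hP).1]
    refine Finset.sum_congr rfl fun K _ => Finset.sum_congr rfl fun P hP => ?_
    rw [(Finset.mem_filter.1 hP).2]

end Mesh

end OldroydDG

namespace OldroydDG

namespace Mesh

variable {d : ℕ} {O K K' : Set (E d)} (𝒦 : Mesh O) {V : Type*} [NormedAddCommGroup V]

theorem volume_restrict (hO : IsConvexPolyhedralDomain O) :
    volume.restrict O = ∑ K ∈ 𝒦.elems, volume.restrict (interior K) := by
  rw [← restrict_biUnion_finset_of_aedisjoint
    (fun K hK K' hK' hne => (𝒦.disjoint K hK K' hK' hne).aedisjoint)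
    fun K _ => isOpen_interior.measurableSet]
  refine Measure.restrict_congr_set (ae_eq_set.2 ⟨?_, ?_⟩)
  · refine measure_mono_null (t := ⋃ K ∈ 𝒦.elems, frontier K) ?_
      ((measure_biUnion_null_iff (Finset.countable_toSet _)).2 fun K hK => ?_)
    · rintro x ⟨hx, hx'⟩
      have h2 : x ∈ ⋃ K ∈ 𝒦.elems, K := by rw [𝒦.cover]; exact _root_.subset_closure hx
      simp only [mem_iUnion, exists_prop, not_exists, not_and] at h2 hx' ⊢
      obtain ⟨K, hK, hxK⟩ := h2
      exact ⟨K, hK, _root_.subset_closure hxK, hx' K hK⟩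
    · obtain ⟨N, h⟩ := 𝒦.exists_isRep hK
      exact h.convex.addHaar_frontier volume
  · refine measure_mono_null ?_ (measure_empty (μ := volume))
    rintro x ⟨hx, hx'⟩
    simp only [mem_iUnion, exists_prop] at hx
    obtain ⟨K, hK, hxK⟩ := hx
    exact hx' (𝒦.interior_subset hO hK hxK)

theorem sum_setIntegral_interior (hO : IsConvexPolyhedralDomain O) {f : E d → ℝ}
    (hf : Integrable f (volume.restrict O)) :
    ∑ K ∈ 𝒦.elems, ∫ x in interior K, f x = ∫ x in O, f x := by
  rw [𝒦.volume_restrict hO, integrable_finsetSum_measure] at hf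
  rw [𝒦.volume_restrict hO, integral_finsetSum_measure hf]

theorem ae_interior_of_ae (hO : IsConvexPolyhedralDomain O) (hK : K ∈ 𝒦.elems) {P : E d → Prop}
    (h : ∀ᵐ x ∂(volume.restrict O), P x) : ∀ᵐ x ∂(volume.restrict (interior K)), P x :=
  ae_restrict_of_ae_restrict_of_subset (𝒦.interior_subset hO hK) h

theorem memLp_of_interior (hO : IsConvexPolyhedralDomain O) {p : ℝ≥0∞} (hp : p ≠ 0) (hp' : p ≠ ⊤)
    {g : E d → V} (hg : AEStronglyMeasurable g (volume.restrict O))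
    (h : ∀ K ∈ 𝒦.elems, MemLp g p (volume.restrict (interior K))) : MemLp g p (volume.restrict O) := by
  refine ⟨hg, ?_⟩
  rw [eLpNorm_lt_top_iff_lintegral_rpow_enorm_lt_top hp hp', 𝒦.volume_restrict hO,
    lintegral_finsetSum_measure]
  exact ENNReal.sum_lt_top.2 fun K hK =>
    (eLpNorm_lt_top_iff_lintegral_rpow_enorm_lt_top hp hp').1 (h K hK).2

section

variable [NormedSpace ℝ V] [CompleteSpace V] {g : E d → V}

theorem weakPartial_ae_eq (hO : IsConvexPolyhedralDomain O) (hK : K ∈ 𝒦.elems) {q : ℝ≥0∞} {k : ℕ}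
    (hg : MemSobolev O q (k + 1) g) (j : Fin d) :
    weakPartial (interior K) j g =ᵐ[volume.restrict (interior K)] weakPartial O j g :=
  ((hg.hasWeakPartial j).mono (𝒦.interior_subset hO hK)).weakPartial_ae_eq isOpen_interior

end

variable [InnerProductSpace ℝ V] [CompleteSpace V] {g : E d → V}

/-- A Sobolev function on the domain has no jump at the interior faces. -/
theorem trace_ae_eq (hO : IsConvexPolyhedralDomain O) (hd : 2 ≤ d) (hK : K ∈ 𝒦.elems)
    (hK' : K' ∈ 𝒦.elems) (hg : MemSobolev O (sobExp d) 1 g) :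
    trace K g =ᵐ[(surf d).restrict (frontier K ∩ frontier K')] trace K' g := by
  obtain ⟨N, h⟩ := 𝒦.exists_isRep hK
  obtain ⟨N', h'⟩ := 𝒦.exists_isRep hK'
  obtain ⟨φ, hφ⟩ := exists_isSmoothApprox_weakPartial hO.isOpen hO.convex hO.1 (by omega) hg
  have hw := fun j => hg.hasWeakPartial j
  have hle := Measure.restrict_mono (μ := surf d)
    (inter_subset_right : frontier K ∩ frontier K' ⊆ frontier K') le_rfl
  obtain ⟨h1, h2⟩ := h'.tendsto_trace_two hd (hφ.mono (𝒦.interior_subset hO hK'))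
    fun j => (hw j).mono (𝒦.interior_subset hO hK')
  refine h.trace_ae_eq_of_tendsto hd (hφ.mono (𝒦.interior_subset hO hK))
    (fun j => (hw j).mono (𝒦.interior_subset hO hK)) inter_subset_left (h1.1.mono_measure hle) ?_
  exact tendsto_of_tendsto_of_tendsto_of_le_of_le tendsto_const_nhds h2 (fun _ => zero_le)
    fun _ => eLpNorm_mono_measure _ hle

theorem trace_weakPartial_ae_eq (hO : IsConvexPolyhedralDomain O) (hd : 2 ≤ d) (hK : K ∈ 𝒦.elems)
    (hg : MemSobolev O (sobExp d) 2 g) (j : Fin d) :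
    trace K (weakPartial (interior K) j g) =ᵐ[(surf d).restrict (frontier K)]
      trace K (weakPartial O j g) := by
  obtain ⟨N, h⟩ := 𝒦.exists_isRep hK
  exact h.trace_congr hd ((hg.mono (𝒦.interior_subset hO hK)).weakPartial isOpen_interior j)
    (𝒦.weakPartial_ae_eq hO hK hg j)

theorem trace_weakPartial_jump (hO : IsConvexPolyhedralDomain O) (hd : 2 ≤ d) (hK : K ∈ 𝒦.elems)
    (hK' : K' ∈ 𝒦.elems) (hg : MemSobolev O (sobExp d) 2 g) (j : Fin d) :
    trace K (weakPartial (interior K) j g) =ᵐ[(surf d).restrict (frontier K ∩ frontier K')]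
      trace K' (weakPartial (interior K') j g) := by
  filter_upwards [ae_restrict_of_ae_restrict_of_subset inter_subset_left
    (𝒦.trace_weakPartial_ae_eq hO hd hK hg j), ae_restrict_of_ae_restrict_of_subset inter_subset_right
    (𝒦.trace_weakPartial_ae_eq hO hd hK' hg j),
    𝒦.trace_ae_eq hO hd hK hK' (hg.weakPartial hO.isOpen j)] with x h1 h2 h3
  rw [h1, h2, h3]

theorem trace_ae_eq_zero (hO : IsConvexPolyhedralDomain O) (hd : 2 ≤ d) (hK : K ∈ 𝒦.elems)
    (hg : MemSobolev O (sobExp d) 1 g) (hg0 : MemH10 O g) :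
    trace K g =ᵐ[(surf d).restrict (frontier K ∩ frontier O)] 0 := by
  obtain ⟨N, h⟩ := 𝒦.exists_isRep hK
  obtain ⟨φ, hφ, hφ'⟩ := hg0
  have hw := fun j => hg.hasWeakPartial j
  have h1 := hφ'.isSmoothApprox hO.isOpen (fun n => (hφ n).1) hg.memLp.1 hw
  have hpos : sobExp d ≠ 0 := (zero_lt_one.trans_le (one_le_sobExp (by omega))).ne'
  refine h.trace_ae_eq_of_tendsto hd
    ((h1.of_exponent_le hO.volume_lt_top.ne hpos (sobExp_le_two d)).mono (𝒦.interior_subset hO hK))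
    (fun j => (hw j).mono (𝒦.interior_subset hO hK)) inter_subset_left aestronglyMeasurable_zero ?_
  refine tendsto_const_nhds.congr fun n => ?_
  symm
  rw [← eLpNorm_zero (ε := V) (p := 2) (μ := (surf d).restrict (frontier K ∩ frontier O))]
  refine eLpNorm_congr_ae (ae_restrict_of_forall_mem
    (isClosed_frontier.inter isClosed_frontier).measurableSet fun x hx => ?_)
  have hxO : x ∉ O := by
    have := hx.2
    rw [hO.isOpen.frontier_eq] at this
    exact this.2
  simp [image_eq_zero_of_notMem_tsupport fun hx' => hxO ((hφ n).2.2 hx')]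

end Mesh

end OldroydDG

namespace OldroydDG

section Element

variable {d : ℕ} {K : Set (E d)} {N : Finset (E d × ℝ)} {u w : E d → E d} {p : E d → ℝ}

theorem IsRep.integrable_gradTrace (h : IsRep K N) (hd : 2 ≤ d)
    (hu : MemSobolev (interior K) (sobExp d) 2 u) (hw : MemSobolev (interior K) (sobExp d) 1 w) :
    Integrable (fun x => ⟪gradTrace K u (normal K) x, trace K w x⟫_ℝ)
      ((surf d).restrict (frontier K)) := by
  simp_rw [gradTrace, sum_inner, real_inner_smul_left]
  exact integrable_finsetSum _ fun j _ => h.integrable_normal_mul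
    (h.integrable_inner_trace hd (hu.weakPartial isOpen_interior j) hw) j

theorem memLp_weakLaplacian {Ω : Set (E d)} (hΩ : IsOpen Ω) {q : ℝ≥0∞} (hu : MemSobolev Ω q 2 u) :
    MemLp (weakLaplacian Ω u) q (volume.restrict Ω) := by
  have := memLp_finsetSum Finset.univ fun j (_ : j ∈ Finset.univ) =>
    ((hu.weakPartial hΩ j).weakPartial hΩ j).memLp
  exact this

/-- Green's identity on a polytope. -/
theorem IsRep.green (h : IsRep K N) (hd : 2 ≤ d) (hu : MemSobolev (interior K) (sobExp d) 2 u)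
    (hw : MemSobolev (interior K) (sobExp d) 1 w) :
    ∫ x in interior K, ∑ j, ⟪weakPartial (interior K) j u x, weakPartial (interior K) j w x⟫_ℝ =
      (∫ x in frontier K, ⟪gradTrace K u (normal K) x, trace K w x⟫_ℝ ∂(surf d)) -
        ∫ x in interior K, ⟪weakLaplacian (interior K) u x, w x⟫_ℝ := by
  have hu' := fun j => hu.weakPartial isOpen_interior j
  have hu'' := fun j => (hu' j).weakPartial isOpen_interior j
  simp_rw [gradTrace, weakLaplacian, sum_inner, real_inner_smul_left]
  rw [integral_finsetSum _ fun j _ => h.integrable_inner_right hd (hu' j)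
      (hw.weakPartial isOpen_interior j).memLp,
    integral_finsetSum _ fun j _ => h.integrable_normal_mul (h.integrable_inner_trace hd (hu' j) hw) j,
    integral_finsetSum _ fun j _ => h.integrable_inner_left hd (hu'' j).memLp hw,
    ← Finset.sum_sub_distrib]
  refine Finset.sum_congr rfl fun j _ => ?_
  rw [← h.integral_by_parts hd (hu' j) hw j]
  ring

/-- The `j`-th coordinate on `ℝᵈ`. -/
noncomputable abbrev coordCLM (j : Fin d) : E d →L[ℝ] ℝ := EuclideanSpace.proj j

theorem IsRep.ae_sum_normal_mul (h : IsRep K N) (hd : 2 ≤ d)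
    (hw : MemSobolev (interior K) (sobExp d) 1 w) (p : E d → ℝ) :
    ∀ᵐ x ∂((surf d).restrict (frontier K)),
      ∑ j, normal K x j * ⟪trace K (fun y => coordCLM j (w y)) x, trace K p x⟫_ℝ =
        trace K p x * ⟪normal K x, trace K w x⟫_ℝ := by
  filter_upwards [ae_all_iff.2 fun j => h.trace_clm_comp hd hw (coordCLM j)] with x hx
  simp only [hx, PiLp.inner_apply, Finset.mul_sum]
  refine Finset.sum_congr rfl fun j _ => ?_
  simp only [Real.inner_apply, PiLp.proj_apply]
  ring

theorem IsRep.integrable_trace_mul_normal (h : IsRep K N) (hd : 2 ≤ d)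
    (hw : MemSobolev (interior K) (sobExp d) 1 w) (hp : MemSobolev (interior K) (sobExp d) 1 p) :
    Integrable (fun x => trace K p x * ⟪normal K x, trace K w x⟫_ℝ)
      ((surf d).restrict (frontier K)) :=
  (integrable_finsetSum Finset.univ fun j _ => h.integrable_normal_mul
    (h.integrable_inner_trace hd (hw.clm_comp (coordCLM j)) hp) j).congr (h.ae_sum_normal_mul hd hw p)

theorem IsRep.integral_weakDiv_mul (h : IsRep K N) (hd : 2 ≤ d)
    (hw : MemSobolev (interior K) (sobExp d) 1 w) (hp : MemSobolev (interior K) (sobExp d) 1 p) :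
    ∫ x in interior K, weakDiv (interior K) w x * p x =
      (∫ x in frontier K, trace K p x * ⟪normal K x, trace K w x⟫_ℝ ∂(surf d)) -
        ∫ x in interior K, ⟪weakGrad (interior K) p x, w x⟫_ℝ := by
  have hW := fun j => hw.clm_comp (coordCLM (d := d) j)
  have h1 : ∫ x in interior K, weakDiv (interior K) w x * p x = ∫ x in interior K,
      ∑ j, ⟪weakPartial (interior K) j (fun y => coordCLM j (w y)) x, p x⟫_ℝ := by
    refine integral_congr_ae ?_
    filter_upwards [ae_all_iff.2 fun j =>
      ((hw.hasWeakPartial j).clm_comp (coordCLM j)).weakPartial_ae_eq isOpen_interior] with x hx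
    simp only [weakDiv, Finset.sum_mul, Real.inner_apply]
    exact Finset.sum_congr rfl fun j _ => by rw [hx j]; rfl
  have h2 : ∀ x, ⟪weakGrad (interior K) p x, w x⟫_ℝ =
      ∑ j, ⟪coordCLM j (w x), weakPartial (interior K) j p x⟫_ℝ := by
    intro x
    rw [PiLp.inner_apply]
    refine Finset.sum_congr rfl fun j _ => ?_
    simp only [weakGrad, Real.inner_apply, PiLp.proj_apply]
    ring
  rw [h1, ← integral_congr_ae (h.ae_sum_normal_mul hd hw p)]
  simp_rw [h2]
  rw [integral_finsetSum _ fun j _ => h.integrable_inner_left hd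
      ((hW j).weakPartial isOpen_interior j).memLp hp,
    integral_finsetSum _ fun j _ => h.integrable_normal_mul (h.integrable_inner_trace hd (hW j) hp) j,
    integral_finsetSum _ fun j _ => h.integrable_inner_right hd (hW j)
      (hp.weakPartial isOpen_interior j).memLp,
    ← Finset.sum_sub_distrib]
  refine Finset.sum_congr rfl fun j _ => ?_
  rw [← h.integral_by_parts hd (hW j) hp j]
  ring

end Element

end OldroydDG

namespace OldroydDG

namespace Mesh

variable {d : ℕ} {O K : Set (E d)} (𝒦 : Mesh O) {u w : E d → E d} {p : E d → ℝ}

theorem memLp_conjExp (hO : IsConvexPolyhedralDomain O) (hd : 2 ≤ d)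
    (hwm : AEStronglyMeasurable w (volume.restrict O))
    (hw : ∀ K ∈ 𝒦.elems, MemSobolev (interior K) (sobExp d) 1 w) :
    MemLp w (conjExp d) (volume.restrict O) := by
  refine 𝒦.memLp_of_interior hO (zero_lt_one.trans_le (one_le_conjExp hd)).ne'
    ENNReal.ofReal_ne_top hwm fun K hK => ?_
  obtain ⟨N, h⟩ := 𝒦.exists_isRep hK
  exact h.memLp_conjExp hd (hw K hK)

theorem integrable_inner (hO : IsConvexPolyhedralDomain O) (hd : 2 ≤ d)
    (hwm : AEStronglyMeasurable w (volume.restrict O))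
    (hw : ∀ K ∈ 𝒦.elems, MemSobolev (interior K) (sobExp d) 1 w) {g : E d → E d}
    (hg : MemLp g (sobExp d) (volume.restrict O)) :
    Integrable (fun x => ⟪g x, w x⟫_ℝ) (volume.restrict O) := by
  have := holderConjugate_sobExp hd
  exact integrable_inner_of_memLp hg (𝒦.memLp_conjExp hO hd hwm hw)

theorem weakLaplacian_ae_eq (hO : IsConvexPolyhedralDomain O) (hK : K ∈ 𝒦.elems) {q : ℝ≥0∞}
    (hu : MemSobolev O q 2 u) :
    weakLaplacian (interior K) u =ᵐ[volume.restrict (interior K)] weakLaplacian O u := by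
  have h1 : ∀ j, weakPartial (interior K) j (weakPartial (interior K) j u)
      =ᵐ[volume.restrict (interior K)] weakPartial O j (weakPartial O j u) := fun j =>
    ((((hu.weakPartial hO.isOpen j).hasWeakPartial j).mono (𝒦.interior_subset hO hK)).congr
      (𝒦.weakPartial_ae_eq hO hK hu j).symm EventuallyEq.rfl).weakPartial_ae_eq isOpen_interior
  filter_upwards [ae_all_iff.2 h1] with x hx
  exact Finset.sum_congr rfl fun j _ => hx j

theorem jump_ae_eq_zero (hO : IsConvexPolyhedralDomain O) (hd : 2 ≤ d)
    (hu : MemSobolev O (sobExp d) 1 u) {P : Set (E d) × Set (E d)} (hP : P ∈ 𝒦.ifaces) :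
    ∀ᵐ x ∂((surf d).restrict (frontier P.1 ∩ frontier P.2)), trace P.1 u x - trace P.2 u x = 0 := by
  obtain ⟨h1, h2, -, -⟩ := 𝒦.ifaces_mem P hP
  filter_upwards [𝒦.trace_ae_eq hO hd h1 h2 hu] with x hx
  rw [hx, sub_self]

theorem trace_bface_ae_eq_zero (hO : IsConvexPolyhedralDomain O) (hd : 2 ≤ d)
    (hu : MemSobolev O (sobExp d) 1 u) (hu0 : MemH10 O u) {P : Set (E d) × Set (E d)}
    (hP : P ∈ 𝒦.bfaces) : ∀ᵐ x ∂((surf d).restrict P.2), trace P.1 u x = 0 := by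
  obtain ⟨h1, -, h3⟩ := (𝒦.bfaces_mem P).1 hP
  exact ae_restrict_of_ae_restrict_of_subset (subset_inter (𝒦.bface_subset_frontier hO hP) h3)
    (𝒦.trace_ae_eq_zero hO hd h1 hu hu0)

/-- Consistency of the interior penalty form. -/
theorem Aeps_eq (hO : IsConvexPolyhedralDomain O) (hd : 2 ≤ d) (ε σ : ℝ)
    (hu : MemSobolev O (sobExp d) 2 u) (hu0 : MemH10 O u)
    (hwm : AEStronglyMeasurable w (volume.restrict O))
    (hw : ∀ K ∈ 𝒦.elems, MemSobolev (interior K) (sobExp d) 1 w) :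
    𝒦.Aeps ε σ u w = -∫ x in O, ⟪weakLaplacian O u x, w x⟫_ℝ := by
  have hu1 := hu.of_succ
  have hjump := fun {P} hP => 𝒦.jump_ae_eq_zero hO hd hu1 (P := P) hP
  have hbdry := fun {P} hP => 𝒦.trace_bface_ae_eq_zero hO hd hu1 hu0 (P := P) hP
  have e1 : ∑ P ∈ 𝒦.ifaces, ∫ x in frontier P.1 ∩ frontier P.2,
      ⟪(1 / 2 : ℝ) • (gradTrace P.1 w (normal P.1) x + gradTrace P.2 w (normal P.1) x),
        trace P.1 u x - trace P.2 u x⟫_ℝ ∂(surf d) = 0 :=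
    Finset.sum_eq_zero fun P hP => integral_eq_zero_of_ae (by
      filter_upwards [hjump hP] with x hx
      rw [hx, inner_zero_right]; rfl)
  have e2 : ∑ P ∈ 𝒦.bfaces, ∫ x in P.2,
      ⟪gradTrace P.1 w (normal P.1) x, trace P.1 u x⟫_ℝ ∂(surf d) = 0 :=
    Finset.sum_eq_zero fun P hP => integral_eq_zero_of_ae (by
      filter_upwards [hbdry hP] with x hx
      rw [hx, inner_zero_right]; rfl)
  have e3 : ∑ P ∈ 𝒦.ifaces, σ / faceSize (frontier P.1 ∩ frontier P.2) *
      ∫ x in frontier P.1 ∩ frontier P.2,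
        ⟪trace P.1 u x - trace P.2 u x, trace P.1 w x - trace P.2 w x⟫_ℝ ∂(surf d) = 0 :=
    Finset.sum_eq_zero fun P hP => by
      rw [integral_eq_zero_of_ae, mul_zero]
      filter_upwards [hjump hP] with x hx
      rw [hx, inner_zero_left]; rfl
  have e4 : ∑ P ∈ 𝒦.bfaces, σ / faceSize P.2 *
      ∫ x in P.2, ⟪trace P.1 u x, trace P.1 w x⟫_ℝ ∂(surf d) = 0 :=
    Finset.sum_eq_zero fun P hP => by
      rw [integral_eq_zero_of_ae, mul_zero]
      filter_upwards [hbdry hP] with x hx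
      rw [hx, inner_zero_left]; rfl
  have e5 : ∑ K ∈ 𝒦.elems, ∫ x in interior K,
      ∑ j, ⟪weakPartial (interior K) j u x, weakPartial (interior K) j w x⟫_ℝ =
      (∑ K ∈ 𝒦.elems, ∫ x in frontier K,
        ⟪gradTrace K u (normal K) x, trace K w x⟫_ℝ ∂(surf d)) -
        ∫ x in O, ⟪weakLaplacian O u x, w x⟫_ℝ := by
    rw [← 𝒦.sum_setIntegral_interior hO (𝒦.integrable_inner hO hd hwm hw
      (memLp_weakLaplacian hO.isOpen hu)), ← Finset.sum_sub_distrib]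
    refine Finset.sum_congr rfl fun K hK => ?_
    obtain ⟨N, h⟩ := 𝒦.exists_isRep hK
    rw [h.green hd (hu.mono (𝒦.interior_subset hO hK)) (hw K hK)]
    congr 1
    refine integral_congr_ae ?_
    filter_upwards [𝒦.weakLaplacian_ae_eq hO hK hu] with x hx
    rw [hx]
  have e6 : ∀ P ∈ 𝒦.ifaces, ∫ x in frontier P.1 ∩ frontier P.2,
      (⟪gradTrace P.1 u (normal P.1) x, trace P.1 w x⟫_ℝ +
        ⟪gradTrace P.2 u (normal P.2) x, trace P.2 w x⟫_ℝ) ∂(surf d) =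
      ∫ x in frontier P.1 ∩ frontier P.2,
        ⟪(1 / 2 : ℝ) • (gradTrace P.1 u (normal P.1) x + gradTrace P.2 u (normal P.1) x),
          trace P.1 w x - trace P.2 w x⟫_ℝ ∂(surf d) := by
    intro P hP
    obtain ⟨h1, h2, h3, -⟩ := 𝒦.ifaces_mem P hP
    obtain ⟨N₁, hr₁⟩ := 𝒦.exists_isRep h1
    obtain ⟨N₂, hr₂⟩ := 𝒦.exists_isRep h2
    refine integral_congr_ae ?_
    filter_upwards [hr₁.ae_normal_eq_neg hr₂ (𝒦.disjoint _ h1 _ h2 h3),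
      ae_all_iff.2 fun j => 𝒦.trace_weakPartial_jump hO hd h1 h2 hu j] with x hn ht
    have g1 : gradTrace P.2 u (normal P.1) x = gradTrace P.1 u (normal P.1) x := by
      simp only [gradTrace, ht]
    have g2 : gradTrace P.2 u (normal P.2) x = -gradTrace P.1 u (normal P.1) x := by
      simp only [gradTrace, ht, hn, PiLp.neg_apply, neg_smul, Finset.sum_neg_distrib]
    rw [g1, g2, ← two_smul ℝ, smul_smul, inner_neg_left, inner_sub_right]
    norm_num
    ring
  rw [𝒦.sum_setIntegral_frontier hO (G := fun K x => ⟪gradTrace K u (normal K) x, trace K w x⟫_ℝ)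
    fun K hK => ?_, Finset.sum_congr rfl e6] at e5
  · rw [Aeps, e1, e2, e3, e4, e5]
    ring
  · obtain ⟨N, h⟩ := 𝒦.exists_isRep hK
    exact h.integrable_gradTrace hd (hu.mono (𝒦.interior_subset hO hK)) (hw K hK)

theorem memLp_weakGrad {Ω : Set (E d)} (hΩ : IsOpen Ω) {q : ℝ≥0∞} (hp : MemSobolev Ω q 1 p) :
    MemLp (weakGrad Ω p) q (volume.restrict Ω) := by
  have e : weakGrad Ω p = fun x => ∑ j, weakPartial Ω j p x • (basisVec j : E d) := by
    ext x j
    simp [weakGrad, Pi.single_apply]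
  rw [e]
  exact memLp_finsetSum Finset.univ fun j (_ : j ∈ Finset.univ) =>
    ((ContinuousLinearMap.toSpanSingleton ℝ (basisVec j : E d)).comp_memLp'
      (hp.weakPartial hΩ j).memLp)

/-- Consistency of the pressure form. -/
theorem b_eq (hO : IsConvexPolyhedralDomain O) (hd : 2 ≤ d) (hp : MemSobolev O (sobExp d) 1 p)
    (hwm : AEStronglyMeasurable w (volume.restrict O))
    (hw : ∀ K ∈ 𝒦.elems, MemSobolev (interior K) (sobExp d) 1 w) :
    𝒦.b w p = -∫ x in O, ⟪weakGrad O p x, w x⟫_ℝ := by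
  have e5 : ∑ K ∈ 𝒦.elems, ∫ x in interior K, weakDiv (interior K) w x * p x =
      (∑ K ∈ 𝒦.elems, ∫ x in frontier K, trace K p x * ⟪normal K x, trace K w x⟫_ℝ ∂(surf d)) -
        ∫ x in O, ⟪weakGrad O p x, w x⟫_ℝ := by
    rw [← 𝒦.sum_setIntegral_interior hO (𝒦.integrable_inner hO hd hwm hw
      (memLp_weakGrad hO.isOpen hp)), ← Finset.sum_sub_distrib]
    refine Finset.sum_congr rfl fun K hK => ?_
    obtain ⟨N, h⟩ := 𝒦.exists_isRep hK
    rw [h.integral_weakDiv_mul hd (hw K hK) (hp.mono (𝒦.interior_subset hO hK))]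
    congr 1
    refine integral_congr_ae ?_
    filter_upwards [ae_all_iff.2 fun j => 𝒦.weakPartial_ae_eq hO hK hp j] with x hx
    simp only [weakGrad, hx]
  have e6 : ∀ P ∈ 𝒦.ifaces, ∫ x in frontier P.1 ∩ frontier P.2,
      (trace P.1 p x * ⟪normal P.1 x, trace P.1 w x⟫_ℝ +
        trace P.2 p x * ⟪normal P.2 x, trace P.2 w x⟫_ℝ) ∂(surf d) =
      ∫ x in frontier P.1 ∩ frontier P.2, (1 / 2 * (trace P.1 p x + trace P.2 p x)) *
        ⟪normal P.1 x, trace P.1 w x - trace P.2 w x⟫_ℝ ∂(surf d) := by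
    intro P hP
    obtain ⟨h1, h2, h3, -⟩ := 𝒦.ifaces_mem P hP
    obtain ⟨N₁, hr₁⟩ := 𝒦.exists_isRep h1
    obtain ⟨N₂, hr₂⟩ := 𝒦.exists_isRep h2
    refine integral_congr_ae ?_
    filter_upwards [hr₁.ae_normal_eq_neg hr₂ (𝒦.disjoint _ h1 _ h2 h3),
      𝒦.trace_ae_eq hO hd h1 h2 hp] with x hn ht
    rw [hn, ht, inner_neg_left, inner_sub_right]
    ring
  rw [𝒦.sum_setIntegral_frontier hO (G := fun K x => trace K p x * ⟪normal K x, trace K w x⟫_ℝ)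
    fun K hK => ?_, Finset.sum_congr rfl e6] at e5
  · rw [b, e5]
    ring
  · obtain ⟨N, h⟩ := 𝒦.exists_isRep hK
    exact h.integrable_trace_mul_normal hd (hw K hK) (hp.mono (𝒦.interior_subset hO hK))

/-- Consistency of the convective form. -/
theorem Ac_eq (hO : IsConvexPolyhedralDomain O) (hd : 2 ≤ d) (hu : MemSobolev O (sobExp d) 1 u)
    (hu0 : MemH10 O u) (hdiv : ∀ᵐ x ∂(volume.restrict O), weakDiv O u x = 0)
    (hint : Integrable (fun x => ⟪convect O u u x, w x⟫_ℝ) (volume.restrict O)) :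
    𝒦.Ac u u u w = ∫ x in O, ⟪convect O u u x, w x⟫_ℝ := by
  classical
  have hjump := fun {P} hP => 𝒦.jump_ae_eq_zero hO hd hu (P := P) hP
  have hbdry := fun {P} hP => 𝒦.trace_bface_ae_eq_zero hO hd hu hu0 (P := P) hP
  have e1 : ∑ K ∈ 𝒦.elems, ((∫ x in interior K, ⟪convect (interior K) u u x, w x⟫_ℝ) +
      1 / 2 * ∫ x in interior K, weakDiv (interior K) u x * ⟪u x, w x⟫_ℝ) =
      ∫ x in O, ⟪convect O u u x, w x⟫_ℝ := by
    rw [← 𝒦.sum_setIntegral_interior hO hint]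
    refine Finset.sum_congr rfl fun K hK => ?_
    have hp := ae_all_iff.2 fun j => 𝒦.weakPartial_ae_eq hO hK hu j
    have h1 : ∫ x in interior K, weakDiv (interior K) u x * ⟪u x, w x⟫_ℝ = 0 := by
      refine integral_eq_zero_of_ae ?_
      filter_upwards [hp, 𝒦.ae_interior_of_ae hO hK hdiv] with x hx hx'
      have : weakDiv (interior K) u x = weakDiv O u x := by simp only [weakDiv, hx]
      rw [this, hx', zero_mul]; rfl
    rw [h1, mul_zero, add_zero]
    refine integral_congr_ae ?_
    filter_upwards [hp] with x hx
    simp only [convect, hx]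
  have e2 : ∑ P ∈ 𝒦.ifaces, ∫ x in frontier P.1 ∩ frontier P.2,
      ⟪trace P.1 u x - trace P.2 u x, normal P.1 x⟫_ℝ *
        (1 / 2 * (⟪trace P.1 u x, trace P.1 w x⟫_ℝ + ⟪trace P.2 u x, trace P.2 w x⟫_ℝ)) ∂(surf d)
      = 0 :=
    Finset.sum_eq_zero fun P hP => integral_eq_zero_of_ae (by
      filter_upwards [hjump hP] with x hx
      rw [hx, inner_zero_left, zero_mul]; rfl)
  have e3 : ∑ P ∈ 𝒦.bfaces, ∫ x in P.2,
      ⟪trace P.1 u x, normal P.1 x⟫_ℝ * ⟪trace P.1 u x, trace P.1 w x⟫_ℝ ∂(surf d) = 0 :=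
    Finset.sum_eq_zero fun P hP => integral_eq_zero_of_ae (by
      filter_upwards [hbdry hP] with x hx
      rw [hx, inner_zero_left, zero_mul]; rfl)
  rw [Ac, e1, e2, e3, add_zero, mul_zero, sub_zero, add_eq_left]
  refine Finset.sum_eq_zero fun K hK => ?_
  rw [integral_eq_zero_of_ae, add_zero]
  · refine Finset.sum_eq_zero fun K' hK' => integral_eq_zero_of_ae ?_
    filter_upwards [ae_restrict_of_ae_restrict_of_subset (sep_subset _ _)
      (𝒦.trace_ae_eq hO hd hK (Finset.mem_filter.1 hK').1 hu)] with x hx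
    rw [hx, sub_self, inner_zero_left, mul_zero]; rfl
  · filter_upwards [ae_restrict_of_ae_restrict_of_subset (sep_subset _ _)
      (𝒦.trace_ae_eq_zero hO hd hK hu hu0)] with x hx
    rw [hx, Pi.zero_apply, sub_zero, inner_zero_left, inner_zero_left, mul_zero]; rfl

end Mesh

end OldroydDG

namespace OldroydDG

variable {d : ℕ} {O : Set (E d)}

/-- The functional `v ↦ ∫ ⟪v, w⟫` on `L^q(O)`, `q = 2d/(d+1)`. -/
theorem exists_clm_integral_inner [Fact (1 ≤ sobExp d)] (hd : 2 ≤ d) {w : E d → E d}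
    (hw : MemLp w (conjExp d) (volume.restrict O)) :
    ∃ Λ : Lp (E d) (sobExp d) (volume.restrict O) →L[ℝ] ℝ, ∀ v, Λ v = ∫ x in O, ⟪v x, w x⟫_ℝ := by
  have := holderConjugate_sobExp hd
  have : Fact (1 ≤ conjExp d) := ⟨one_le_conjExp hd⟩
  refine ⟨((innerSL ℝ : E d →L[ℝ] E d →L[ℝ] ℝ).lpPairing (volume.restrict O) (sobExp d)
    (conjExp d)).flip (hw.toLp w), fun v => ?_⟩
  rw [ContinuousLinearMap.flip_apply, ContinuousLinearMap.lpPairing_eq_integral]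
  refine integral_congr_ae ?_
  filter_upwards [hw.coeFn_toLp] with x hx
  rw [hx, innerSL_apply_apply]

theorem lapLp_ae_eq (hO : IsOpen O) {v : VecL2 O} (hv : MemSobolev O (sobExp d) 2 v) :
    lapLp v =ᵐ[volume.restrict O] weakLaplacian O v := by
  have h := memLp_weakLaplacian hO hv
  unfold lapLp
  rw [dif_pos h]
  exact h.coeFn_toLp

theorem continuous_kernel (lam kap : ℝ) : Continuous (kernel lam kap) := by
  unfold kernel
  fun_prop

end OldroydDG

open OldroydDG in
theorem lemma3 {d : ℕ} [Fact (d = 2 ∨ d = 3)] (O : Set (OldroydDG.E d))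
    (hO : OldroydDG.IsConvexPolyhedralDomain O) (𝒦 : OldroydDG.Mesh O)
    (lam kap T : ℝ) (hlam : 0 < lam) (hkap : 0 < kap) (hT : 0 < T)
    (ε : ℝ) (hε : ε = -1 ∨ ε = 0 ∨ ε = 1) (σ : ℝ) (hσ : 0 < σ)
    (S : Set ℝ) (f : ℝ → OldroydDG.VecL2 O) (u₀ : OldroydDG.VecL2 O)
    (u : ℝ → OldroydDG.VecL2 O) (p : ℝ → OldroydDG.ScalL2 O)
    (hup : OldroydDG.IsSolution O lam kap T S f u₀ u p) :
    ∀ t ∈ S, ∀ w : OldroydDG.VecL2 O, 𝒦.MemM w →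
      IntervalIntegrable (fun s => OldroydDG.kernel lam kap (t - s) * 𝒦.Aeps ε σ (u s) w)
          volume 0 t ∧
        inner ℝ (derivWithin u (Icc 0 T) t) w + 𝒦.Ac (u t) (u t) (u t) w
            + OldroydDG.viscosity lam kap * 𝒦.Aeps ε σ (u t) w
            + ∫ s in (0 : ℝ)..t, OldroydDG.kernel lam kap (t - s) * 𝒦.Aeps ε σ (u s) w
          = 𝒦.b w (p t) + inner ℝ (f t) w := by
  intro t ht w hwM
  have hd : 2 ≤ d := by rcases (Fact.out : d = 2 ∨ d = 3) with h | h <;> omega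
  obtain ⟨ht0, htT⟩ := hup.times_sub ht
  have hwm : AEStronglyMeasurable w (volume.restrict O) := (Lp.memLp w).1
  have hw : ∀ K ∈ 𝒦.elems, MemSobolev (interior K) (sobExp d) 1 w := fun K hK => (hwM K hK).of_succ
  obtain ⟨Λ, hΛ⟩ := exists_clm_integral_inner hd (𝒦.memLp_conjExp hO hd hwm hw)
  have hAeps : ∀ s ∈ S, 𝒦.Aeps ε σ (u s) w = -Λ (lapLp (u s)) := by
    intro s hs
    rw [𝒦.Aeps_eq hO hd ε σ (hup.vel_mem s hs) (hup.boundary s hs) hwm hw, hΛ]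
    congr 1
    refine integral_congr_ae ?_
    filter_upwards [lapLp_ae_eq hO.isOpen (hup.vel_mem s hs)] with x hx
    rw [hx]
  set M : ℝ → Lp (E d) (sobExp d) (volume.restrict O) :=
    fun s => kernel lam kap (t - s) • lapLp (u s) with hM
  have hMint : IntervalIntegrable M volume 0 t := by
    refine (hup.lap_integrable.mono_set ?_).continuousOn_smul
      ((continuous_kernel lam kap).comp (by fun_prop)).continuousOn
    rw [uIcc_of_le ht0.le, uIcc_of_le (ht0.le.trans htT)]
    exact Icc_subset_Icc_right htT
  have hae : (fun s => -Λ (M s)) =ᵐ[volume.restrict (uIoc 0 t)]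
      fun s => kernel lam kap (t - s) * 𝒦.Aeps ε σ (u s) w := by
    rw [uIoc_of_le ht0.le]
    filter_upwards [ae_restrict_of_ae_restrict_of_subset (Ioc_subset_Ioc_right htT) hup.times_ae]
      with s hs
    rw [hAeps s hs, hM, map_smul, smul_eq_mul, mul_neg]
  have hΛM : IntervalIntegrable (fun s => -Λ (M s)) volume 0 t :=
    IntervalIntegrable.neg ⟨Λ.integrable_comp hMint.1, Λ.integrable_comp hMint.2⟩
  refine ⟨hΛM.congr_ae hae, ?_⟩
  have hmem : ∫ s in (0 : ℝ)..t, kernel lam kap (t - s) * 𝒦.Aeps ε σ (u s) w =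
      -∫ x in O, ⟪(∫ s in (0 : ℝ)..t, M s : Lp (E d) (sobExp d) (volume.restrict O)) x, w x⟫_ℝ := by
    rw [← hΛ, ← Λ.intervalIntegral_comp_comm hMint, ← intervalIntegral.integral_neg]
    exact (intervalIntegral.integral_congr_ae_restrict hae).symm
  have hvel := hup.vel_mem t ht
  have hpres := hup.pres_mem t ht
  have i1 : Integrable (fun x => ⟪f t x, w x⟫_ℝ) (volume.restrict O) := L2.integrable_inner _ _
  have i2 : Integrable (fun x => ⟪derivWithin u (Icc 0 T) t x, w x⟫_ℝ) (volume.restrict O) :=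
    L2.integrable_inner _ _
  have i3 := (𝒦.integrable_inner hO hd hwm hw (memLp_weakLaplacian hO.isOpen hvel)).const_mul
    (viscosity lam kap)
  have i4 := 𝒦.integrable_inner hO hd hwm hw
    (Lp.memLp (∫ s in (0 : ℝ)..t, M s : Lp (E d) (sobExp d) (volume.restrict O)))
  have i5 := 𝒦.integrable_inner hO hd hwm hw (Mesh.memLp_weakGrad hO.isOpen hpres)
  have hconv : (fun x => ⟪f t x, w x⟫_ℝ - ⟪derivWithin u (Icc 0 T) t x, w x⟫_ℝ +
      viscosity lam kap * ⟪weakLaplacian O (u t) x, w x⟫_ℝ +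
      ⟪(∫ s in (0 : ℝ)..t, M s : Lp (E d) (sobExp d) (volume.restrict O)) x, w x⟫_ℝ -
      ⟪weakGrad O (p t) x, w x⟫_ℝ) =ᵐ[volume.restrict O]
      fun x => ⟪convect O (u t) (u t) x, w x⟫_ℝ := by
    filter_upwards [hup.momentum t ht] with x hx
    rw [← hx]
    simp only [inner_add_left, inner_sub_left, real_inner_smul_left, hM]
    ring
  have iconv := ((((i1.sub i2).add i3).add i4).sub i5).congr hconv
  have hAc := 𝒦.Ac_eq hO hd hvel.of_succ (hup.boundary t ht) (hup.incompressible t ht) iconv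
  rw [hAc, ← integral_congr_ae hconv, integral_sub ?_ i5, integral_add ?_ i4, integral_add ?_ i3,
    integral_sub i1 i2, integral_const_mul, hmem,
    𝒦.Aeps_eq hO hd ε σ hvel (hup.boundary t ht) hwm hw, 𝒦.b_eq hO hd hpres hwm hw, L2.inner_def,
    L2.inner_def]
  · ring
  · exact i1.sub i2
  · exact (i1.sub i2).add i3
  · exact ((i1.sub i2).add i3).add i4
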